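/- Let $G$ be a compact Lie group acting smoothly on a manifold $M$. A $G$-cover is a $G$-equivariant surjective submersion $\pi\colon Y\to M$ of $G$-manifolds; write $Y^{[p]}$ for its $p$-fold fiber product over $M$, $\pi_i,\pi_{ij},\dots$ for the projections, and $\Omega^2_G$ for equivariant $2$-forms (Cartan model: an invariant $2$-form together with an equivariant map to $\mathfrak g^*$). All bundles below are $G$-equivariant principal $S^1$-bundles, and connections on them are $G$-invariant, with equivariant curvature $\operatorname{curv}_G(\nabla)\in\Omega^2_G$. Obvious pullbacks are not written. A $G$-equivariant bundle gerbe with connection $\widehat{\mathcal L}=(Y,L,\nabla,B,\mu)$ on $M$ consists of a $G$-cover $\pi\colon Y\to M$, a bundle with connection $(L,\nabla)$ on $Y^{[2]}$, a form $B\in\Omega^2_G(Y)$ with $\operatorname{curv}_G(\nabla)=\pi_2^*B-\pi_1^*B$, and a connection-preserving equivariant isomorphism $\mu\colon\pi_{12}^*L\otimes\pi_{23}^*L\to\pi_{13}^*L$ over $Y^{[3]}$ which is associative over $Y^{[4]}$. A $1$-morphism $\widehat{\mathcal K}=(Z,K,\nabla_K,\alpha)\colon\widehat{\mathcal L}_1\to\widehat{\mathcal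 L}_2$ consists of a $G$-cover $\zeta\colon Z\to P:=Y_1\times_MY_2$, a bundle with connection $(K,\nabla_K)$ on $Z$ with $\operatorname{curv}_G(\nabla_K)=\zeta^*(B_2-B_1)$, and a connection-preserving equivariant isomorphism $\alpha\colon L_1\otimes\zeta_2^*K\to\zeta_1^*K\otimes L_2$ over $Z\times_MZ$ such that, over $Z\times_MZ\times_MZ$, $$\zeta_{13}^*\alpha\circ(\mu_1\otimes\operatorname{id})=(\operatorname{id}\otimes\mu_2)\circ(\zeta_{12}^*\alpha\otimes\operatorname{id})\circ(\operatorname{id}\otimes\zeta_{23}^*\alpha).$$ A $2$-morphism $\widehat{\mathcal K}_1\Rightarrow\widehat{\mathcal K}_2$ is an equivalence class of pairs $(W,\beta)$ of a $G$-cover $\omega\colon W\to Z_1\times_PZ_2$ and a connection-preserving equivariant isomorphism $\beta\colon K_1\to K_2$ over $W$ such that $(\omega_1^*\beta\otimes\operatorname{id})\circ\alpha_1=\alpha_2\circ(\operatorname{id}\otimes\omega_2^*\beta)$ over $W\times_MW$, where $\omega_1^*\beta$ and $\omega_2^*\beta$ denote the pullbacks of $\beta$ along the two projections $W\times_MW\to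 W$. Pairs $(W,\beta)$ and $(W',\beta')$ are equivalent if there are $G$-covers $\rho\colon X\to W$ and $\rho'\colon X\to W'$ with $\omega\circ\rho=\omega'\circ\rho'$ and $\rho^*\beta=\rho'^*\beta'$. The composite of $(W,\beta)\colon\widehat{\mathcal K}_1\Rightarrow\widehat{\mathcal K}_2$ and $(W',\beta')\colon\widehat{\mathcal K}_2\Rightarrow\widehat{\mathcal K}_3$ is $(W\times_{Z_2}W',\beta'\circ\beta)$. The $1$-morphisms $\widehat{\mathcal L}_1\to\widehat{\mathcal L}_2$ and the $2$-morphisms between them form a category $G\text{-}\mathrm{Grb}_\nabla(\widehat{\mathcal L}_1,\widehat{\mathcal L}_2)$. Let $G\text{-}\mathrm{Grb}^{\mathrm{FP}}_\nabla(\widehat{\mathcal L}_1,\widehat{\mathcal L}_2)$ be the subcategory of fiber product morphisms (stable isomorphisms): the objects are the $1$-morphisms with $Z=P$ and $\zeta=\operatorname{id}$, and the morphisms are the $2$-morphisms with $W=P$ and $\omega$ the identity (under $P\times_PP\cong P$). Ignoring all connections and differential forms gives $G$-equivariant bundle gerbes $\mathcal L_i$ without connection and categories $G\text{-}\mathrm{Grb}^{\mathrm{FP}}(\mathcal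 L_1,\mathcal L_2)$ and $G\text{-}\mathrm{Grb}(\mathcal L_1,\mathcal L_2)$. Then the natural inclusions $$G\text{-}\mathrm{Grb}^{\mathrm{FP}}(\mathcal L_1,\mathcal L_2)\longrightarrow G\text{-}\mathrm{Grb}(\mathcal L_1,\mathcal L_2),\qquad G\text{-}\mathrm{Grb}^{\mathrm{FP}}_\nabla(\widehat{\mathcal L}_1,\widehat{\mathcal L}_2)\longrightarrow G\text{-}\mathrm{Grb}_\nabla(\widehat{\mathcal L}_1,\widehat{\mathcal L}_2)$$ are equivalences of categories, for all $G$-equivariant bundle gerbes $\mathcal L_1,\mathcal L_2$ on $M$, respectively all $G$-equivariant bundle gerbes with connection $\widehat{\mathcal L}_1,\widehat{\mathcal L}_2$ on $M$. -/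

import Mathlib

open scoped Manifold ContDiff Topology
open Set Function Manifold

set_option linter.unusedSectionVars false
set_option linter.style.haveILetI false

universe v u

namespace EqGerbe

/-- In finite dimensions, a smooth map with surjective differential at a point is a submersion
at that point. -/
theorem submersionAt_of_surjective {m n : ℕ} {A C : Type*}
    [TopologicalSpace A] [ChartedSpace (EuclideanSpace ℝ (Fin m)) A] [IsManifold (𝓡 m) ∞ A]
    [TopologicalSpace C] [ChartedSpace (EuclideanSpace ℝ (Fin n)) C] [IsManifold (𝓡 n) ∞ C]
    {f : A → C} (hf : ContMDiff (𝓡 m) (𝓡 n) ∞ f) (x : A)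
    (hx : Surjective (mfderiv (𝓡 m) (𝓡 n) f x)) :
    IsSubmersionAtOfComplement (EuclideanSpace ℝ (Fin (m - n))) (𝓡 m) (𝓡 n) ∞ f x := by
  set φ := chartAt (EuclideanSpace ℝ (Fin m)) x with hφ
  set ψ := chartAt (EuclideanSpace ℝ (Fin n)) (f x) with hψ
  set g : EuclideanSpace ℝ (Fin m) → EuclideanSpace ℝ (Fin n) := ψ ∘ f ∘ φ.symm with hg
  set u₀ := φ x with hu₀
  have hxs : x ∈ φ.source := mem_chart_source _ x
  -- the domain on which `g` is smooth
  set V : Set (EuclideanSpace ℝ (Fin m)) := φ.target ∩ φ.symm ⁻¹' (f ⁻¹' ψ.source) with hV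
  have hVo : IsOpen V :=
    φ.symm.isOpen_inter_preimage (ψ.open_source.preimage hf.continuous)
  have hu₀V : u₀ ∈ V := ⟨φ.map_source hxs, by simp [u₀, φ.left_inv hxs, ψ]⟩
  have hgs : ∀ u ∈ V, ContDiffAt ℝ ∞ g u := by
    intro u hu
    have h1 : ContMDiffAt (𝓡 m) (𝓡 m) ∞ φ.symm u :=
      contMDiffAt_symm_of_mem_maximalAtlas (IsManifold.chart_mem_maximalAtlas x) hu.1
    have h2 : ContMDiffAt (𝓡 n) (𝓡 n) ∞ ψ (f (φ.symm u)) :=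
      contMDiffAt_of_mem_maximalAtlas (IsManifold.chart_mem_maximalAtlas (f x)) hu.2
    exact contMDiffAt_iff_contDiffAt.1 (h2.comp u (hf.contMDiffAt.comp u h1))
  have hD : HasFDerivAt g (mfderiv (𝓡 m) (𝓡 n) f x : EuclideanSpace ℝ (Fin m) →L[ℝ] EuclideanSpace ℝ (Fin n)) u₀ := by
    have h := (hf.mdifferentiableAt (x := x) (by simp)).hasMFDerivAt.2
    have h' : HasFDerivWithinAt g (mfderiv (𝓡 m) (𝓡 n) f x :
        EuclideanSpace ℝ (Fin m) →L[ℝ] EuclideanSpace ℝ (Fin n)) univ u₀ := by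
      simpa [writtenInExtChartAt, extChartAt, g, φ, ψ] using h
    exact h'.hasFDerivAt Filter.univ_mem
  set D : EuclideanSpace ℝ (Fin m) →L[ℝ] EuclideanSpace ℝ (Fin n) := mfderiv (𝓡 m) (𝓡 n) f x with hDdef
  have hDs : Surjective D := hx
  have hrange : LinearMap.range (D : EuclideanSpace ℝ (Fin m) →ₗ[ℝ] EuclideanSpace ℝ (Fin n)) = ⊤ :=
    LinearMap.range_eq_top.2 hDs
  set K := LinearMap.ker (D : EuclideanSpace ℝ (Fin m) →ₗ[ℝ] EuclideanSpace ℝ (Fin n)) with hK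
  have hKdim : Module.finrank ℝ K = m - n := by
    have h := LinearMap.finrank_range_add_finrank_ker (D : EuclideanSpace ℝ (Fin m) →ₗ[ℝ] EuclideanSpace ℝ (Fin n))
    rw [hrange, finrank_top, finrank_euclideanSpace_fin, finrank_euclideanSpace_fin] at h
    change n + Module.finrank ℝ K = m at h
    omega
  obtain ⟨P, hP⟩ := LinearMap.exists_leftInverse_of_injective K.subtype K.ker_subtype
  let eK : K ≃ₗ[ℝ] EuclideanSpace ℝ (Fin (m - n)) := LinearEquiv.ofFinrankEq _ _ (by simp [hKdim])
  let Q : EuclideanSpace ℝ (Fin m) →L[ℝ] EuclideanSpace ℝ (Fin (m - n)) :=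
    LinearMap.toContinuousLinearMap (eK.toLinearMap ∘ₗ P)
  have hQ : ∀ u ∈ K, Q u = 0 → u = 0 := by
    intro u hu h
    have h1 : P u = 0 := by simpa [Q] using h
    have h2 : P u = ⟨u, hu⟩ := by
      have := LinearMap.congr_fun hP ⟨u, hu⟩
      simpa using this
    rw [h2] at h1
    simpa using congrArg Subtype.val h1
  have hinj : Injective (D.prod Q) := by
    rw [injective_iff_map_eq_zero]
    intro u hu
    have h1 : D u = 0 := congrArg Prod.fst hu
    have h2 : Q u = 0 := congrArg Prod.snd hu
    exact hQ u h1 h2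
  have hnm : n ≤ m := by
    have := LinearMap.finrank_le_finrank_of_surjective (f := (D : EuclideanSpace ℝ (Fin m) →ₗ[ℝ] EuclideanSpace ℝ (Fin n))) hDs
    simpa using this
  have hdim : Module.finrank ℝ (EuclideanSpace ℝ (Fin m)) =
      Module.finrank ℝ (EuclideanSpace ℝ (Fin n) × EuclideanSpace ℝ (Fin (m - n))) := by
    simp; omega
  let A' : EuclideanSpace ℝ (Fin m) ≃L[ℝ] EuclideanSpace ℝ (Fin n) × EuclideanSpace ℝ (Fin (m - n)) :=
    (LinearMap.linearEquivOfInjective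
      ((D.prod Q : EuclideanSpace ℝ (Fin m) →L[ℝ] _) : EuclideanSpace ℝ (Fin m) →ₗ[ℝ] _) hinj hdim).toContinuousLinearEquiv
  have hA' : ∀ u, A' u = (D u, Q u) := fun u => rfl
  let h : EuclideanSpace ℝ (Fin m) → EuclideanSpace ℝ (Fin m) := fun u => A'.symm (g u, Q u)
  have hhs : ∀ u ∈ V, ContDiffAt ℝ ∞ h u := fun u hu =>
    A'.symm.contDiff.contDiffAt.comp u ((hgs u hu).prodMk Q.contDiff.contDiffAt)
  have hh0 : HasFDerivAt h ((ContinuousLinearEquiv.refl ℝ _ : EuclideanSpace ℝ (Fin m) ≃L[ℝ] _) :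
      EuclideanSpace ℝ (Fin m) →L[ℝ] EuclideanSpace ℝ (Fin m)) u₀ := by
    have h1 := A'.symm.hasFDerivAt.comp u₀ (hD.prodMk Q.hasFDerivAt)
    have h2 : (A'.symm : _ →L[ℝ] EuclideanSpace ℝ (Fin m)).comp (D.prod Q) =
        ((ContinuousLinearEquiv.refl ℝ _ : EuclideanSpace ℝ (Fin m) ≃L[ℝ] _) :
          EuclideanSpace ℝ (Fin m) →L[ℝ] EuclideanSpace ℝ (Fin m)) :=
      ContinuousLinearMap.ext fun u => A'.symm_apply_apply u
    rw [← h2]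
    exact h1
  let Φ := (hhs u₀ hu₀V).toOpenPartialHomeomorph h hh0 (by simp)
  have hΦ : (Φ : _ → _) = h := rfl
  have hu₀Φ : u₀ ∈ Φ.source := (hhs u₀ hu₀V).mem_toOpenPartialHomeomorph_source hh0 (by simp)
  -- shrink to where the derivative is invertible
  let R : Set (EuclideanSpace ℝ (Fin m)) := {u ∈ V | fderiv ℝ h u ∈ range ((↑) : (EuclideanSpace ℝ (Fin m) ≃L[ℝ] EuclideanSpace ℝ (Fin m)) → _)}
  have hRo : IsOpen R := by
    have hc : ContinuousOn (fderiv ℝ h) V := by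
      intro u hu
      exact ((hhs u hu).fderiv_right (m := 0) (by simp)).continuousAt.continuousWithinAt
    exact hc.isOpen_inter_preimage hVo ContinuousLinearEquiv.isOpen
  have hu₀R : u₀ ∈ R := ⟨hu₀V, ⟨_, hh0.fderiv.symm⟩⟩
  let Ψ := Φ.restrOpen R hRo
  have hΨs : Ψ.source = Φ.source ∩ R := rfl
  have hΨ : (Ψ : _ → _) = h := rfl
  let dom := φ.trans Ψ
  have hxdom : x ∈ dom.source := by
    simp only [dom, OpenPartialHomeomorph.trans_source]
    exact ⟨hxs, hu₀Φ, hu₀R⟩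
  have hdomV : ∀ a ∈ dom.source, a ∈ φ.source ∧ φ a ∈ V := by
    intro a ha
    simp only [dom, OpenPartialHomeomorph.trans_source] at ha
    exact ⟨ha.1, ha.2.2.1⟩
  have hdom : dom ∈ IsManifold.maximalAtlas (𝓡 m) ∞ A := by
    apply OpenPartialHomeomorph.mem_maximalAtlas_of_contMDiffOn
    · intro a ha
      obtain ⟨h1, h2⟩ := hdomV a ha
      exact ((hhs _ h2).contMDiffAt.comp a (contMDiffAt_of_mem_maximalAtlas
        (IsManifold.chart_mem_maximalAtlas x) h1)).contMDiffWithinAt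
    · intro u hu
      have hu1 : u ∈ Ψ.target := hu.1
      have hu2 : Ψ.symm u ∈ Ψ.source := Ψ.map_target hu1
      obtain ⟨e, he⟩ := hu2.2.2
      have h1 : ContDiffAt ℝ ∞ Ψ.symm u := by
        refine Ψ.contDiffAt_symm (f₀' := e) hu1 ?_ (hhs _ hu2.2.1)
        rw [he]
        exact ((hhs _ hu2.2.1).differentiableAt (by simp)).hasFDerivAt
      exact ((contMDiffAt_symm_of_mem_maximalAtlas (IsManifold.chart_mem_maximalAtlas x)
        hu.2).comp u h1.contMDiffAt).contMDiffWithinAt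
  refine IsSubmersionAtOfComplement.mk_of_charts A' dom ψ hxdom (mem_chart_source _ _) hdom
    (IsManifold.chart_mem_maximalAtlas _) ?_ ?_
  · intro a ha
    have := (hdomV a ha).2.2
    simpa [φ.left_inv (hdomV a ha).1] using this
  · intro u hu
    have hu' : u ∈ dom.target := by simpa using hu
    have hu1 : u ∈ Ψ.target := hu'.1
    have h3 : h (Ψ.symm u) = u := Ψ.right_inv hu1
    have h4 : A' u = (g (Ψ.symm u), Q (Ψ.symm u)) := by
      rw [← A'.apply_symm_apply (g (Ψ.symm u), Q (Ψ.symm u))]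
      exact congrArg A' h3.symm
    simp [h4, g, dom]


section FiberProduct
variable {a b c : ℕ} {A B C : Type*}
    [TopologicalSpace A] [ChartedSpace (EuclideanSpace ℝ (Fin a)) A] [IsManifold (𝓡 a) ∞ A]
    [TopologicalSpace B] [ChartedSpace (EuclideanSpace ℝ (Fin b)) B] [IsManifold (𝓡 b) ∞ B]
    [TopologicalSpace C] [ChartedSpace (EuclideanSpace ℝ (Fin c)) C] [IsManifold (𝓡 c) ∞ C]
    {f : A → C} {g : B → C}

theorem exists_fiberProduct_chart (hf : IsSubmersion (𝓡 a) (𝓡 c) ∞ f)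
    (hg : ContMDiff (𝓡 b) (𝓡 c) ∞ g) (s₀ : {p : A × B // f p.1 = g p.2}) :
    ∃ e : OpenPartialHomeomorph {p : A × B // f p.1 = g p.2} (EuclideanSpace ℝ (Fin (a + b - c))),
      s₀ ∈ e.source ∧
      (∃ H : A × B → EuclideanSpace ℝ (Fin (a + b - c)), (∀ s, e s = H s.1) ∧
        ∀ s ∈ e.source, ContMDiffAt ((𝓡 a).prod (𝓡 b)) (𝓡 (a + b - c)) ∞ H s.1) ∧
      (∀ u ∈ e.target, ContMDiffAt (𝓡 (a + b - c)) (𝓡 a) ∞ (fun v => (e.symm v).1.1) u) ∧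
      (∀ u ∈ e.target, ContMDiffAt (𝓡 (a + b - c)) (𝓡 b) ∞ (fun v => (e.symm v).1.2) u) := by
  have h0 := hf.isSubmersionOfComplement_complement s₀.1.1
  let F := hf.complement
  let φ := h0.domChart
  let ψ := h0.codChart
  let q : EuclideanSpace ℝ (Fin a) ≃L[ℝ] EuclideanSpace ℝ (Fin c) × F := h0.equiv
  let χ := chartAt (EuclideanSpace ℝ (Fin b)) s₀.1.2
  have hφs : s₀.1.1 ∈ φ.source := h0.mem_domChart_source
  have hχs : s₀.1.2 ∈ χ.source := mem_chart_source _ _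
  have hφ : φ ∈ IsManifold.maximalAtlas (𝓡 a) ∞ A := h0.domChart_mem_maximalAtlas
  have hψ : ψ ∈ IsManifold.maximalAtlas (𝓡 c) ∞ C := h0.codChart_mem_maximalAtlas
  have hχ : χ ∈ IsManifold.maximalAtlas (𝓡 b) ∞ B := IsManifold.chart_mem_maximalAtlas _
  have hsub : ∀ x ∈ φ.source, f x ∈ ψ.source := h0.source_subset_preimage_source
  have hnorm : ∀ u ∈ φ.target, ψ (f (φ.symm u)) = (q u).1 := by
    intro u hu
    have := h0.writtenInCharts (show u ∈ (h0.domChart.extend (𝓡 a)).target by simpa using hu)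
    simpa using this
  have hfc : Continuous f := hf.contMDiff.continuous
  have hgc : Continuous g := hg.continuous
  have : FiniteDimensional ℝ F :=
    FiniteDimensional.of_surjective
      ((ContinuousLinearMap.snd ℝ (EuclideanSpace ℝ (Fin c)) F).comp (q : _ →L[ℝ] _)).toLinearMap
      (fun v => ⟨q.symm (0, v), by simp⟩)
  have hdimF : a = c + Module.finrank ℝ F := by
    have := q.toLinearEquiv.finrank_eq
    simpa using this
  let r : (F × EuclideanSpace ℝ (Fin b)) ≃L[ℝ] EuclideanSpace ℝ (Fin (a + b - c)) :=
    ContinuousLinearEquiv.ofFinrankEq (by simp; omega)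
  -- the chart and its inverse
  let H : A × B → EuclideanSpace ℝ (Fin (a + b - c)) := fun p => r ((q (φ p.1)).2, χ p.2)
  let Jb : EuclideanSpace ℝ (Fin (a + b - c)) → B := fun u => χ.symm (r.symm u).2
  let Ju : EuclideanSpace ℝ (Fin (a + b - c)) → EuclideanSpace ℝ (Fin a) :=
    fun u => q.symm (ψ (g (Jb u)), (r.symm u).1)
  let T1 : Set (EuclideanSpace ℝ (Fin (a + b - c))) := {u | (r.symm u).2 ∈ χ.target}
  let T2 : Set (EuclideanSpace ℝ (Fin (a + b - c))) := T1 ∩ Jb ⁻¹' (g ⁻¹' ψ.source)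
  let T : Set (EuclideanSpace ℝ (Fin (a + b - c))) := T2 ∩ Ju ⁻¹' φ.target
  have hT1 : IsOpen T1 := χ.open_target.preimage (by fun_prop)
  have hJb : ∀ u ∈ T1, ContMDiffAt (𝓡 (a + b - c)) (𝓡 b) ∞ Jb u := fun u hu =>
    (contMDiffAt_symm_of_mem_maximalAtlas hχ hu).comp u
      ((ContinuousLinearMap.snd ℝ F (EuclideanSpace ℝ (Fin b))).contDiff.comp
        r.symm.contDiff).contMDiff.contMDiffAt
  have hJbc : ContinuousOn Jb T1 := fun u hu => (hJb u hu).continuousAt.continuousWithinAt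
  have hT2 : IsOpen T2 := hJbc.isOpen_inter_preimage hT1 (ψ.open_source.preimage hgc)
  have hJu : ∀ u ∈ T2, ContMDiffAt (𝓡 (a + b - c)) (𝓡 a) ∞ Ju u := by
    intro u hu
    have h1 : ContMDiffAt (𝓡 (a + b - c)) (𝓡 c) ∞ (fun v => ψ (g (Jb v))) u :=
      (contMDiffAt_of_mem_maximalAtlas hψ hu.2).comp u (hg.contMDiffAt.comp u (hJb u hu.1))
    have h2 : ContDiffAt ℝ ∞ (fun v => (r.symm v).1) u :=
      ((ContinuousLinearMap.fst ℝ F (EuclideanSpace ℝ (Fin b))).contDiff.comp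
        r.symm.contDiff).contDiffAt
    exact (q.symm.contDiff.contDiffAt.comp u (h1.contDiffAt.prodMk h2)).contMDiffAt
  have hJuc : ContinuousOn Ju T2 := fun u hu => (hJu u hu).continuousAt.continuousWithinAt
  have hT : IsOpen T := hJuc.isOpen_inter_preimage hT2 φ.open_target
  have hJf : ∀ u ∈ T, f (φ.symm (Ju u)) = g (Jb u) := by
    intro u hu
    have h1 : ψ (f (φ.symm (Ju u))) = ψ (g (Jb u)) := by
      rw [hnorm _ hu.2]; simp [Ju]
    exact ψ.injOn (hsub _ (φ.map_target hu.2)) hu.1.2 h1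
  have hJa : ∀ u ∈ T, ContMDiffAt (𝓡 (a + b - c)) (𝓡 a) ∞ (fun v => φ.symm (Ju v)) u := fun u hu =>
    (contMDiffAt_symm_of_mem_maximalAtlas hφ hu.2).comp u (hJu u hu.1)
  let S := {p : A × B // f p.1 = g p.2}
  let src : Set S := {s | s.1.1 ∈ φ.source ∧ s.1.2 ∈ χ.source}
  have hHa : ∀ s ∈ src, ContMDiffAt ((𝓡 a).prod (𝓡 b)) (𝓡 (a + b - c)) ∞ H s.1 := by
    intro s hs
    have h1 : ContMDiffAt ((𝓡 a).prod (𝓡 b)) (𝓡 a) ∞ (fun p : A × B => φ p.1) s.1 :=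
      (contMDiffAt_of_mem_maximalAtlas hφ hs.1).comp s.1 contMDiffAt_fst
    have h2 : ContMDiffAt ((𝓡 a).prod (𝓡 b)) (𝓡 b) ∞ (fun p : A × B => χ p.2) s.1 :=
      (contMDiffAt_of_mem_maximalAtlas hχ hs.2).comp s.1 contMDiffAt_snd
    have h3 : ContMDiffAt ((𝓡 a).prod (𝓡 b)) 𝓘(ℝ, F) ∞ (fun p : A × B => (q (φ p.1)).2) s.1 :=
      (((ContinuousLinearMap.snd ℝ (EuclideanSpace ℝ (Fin c)) F).contDiff.comp
        q.contDiff).contMDiff.contMDiffAt).comp s.1 h1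
    exact r.contDiff.contMDiff.contMDiffAt.comp s.1 (h3.prodMk_space h2)
  have hJmem : ∀ u ∈ T, φ.symm (Ju u) ∈ φ.source ∧ Jb u ∈ χ.source := fun u hu =>
    ⟨φ.map_target hu.2, χ.map_target hu.1.1⟩
  have hHJ : ∀ u ∈ T, H (φ.symm (Ju u), Jb u) = u := by
    intro u hu
    have h1 : φ (φ.symm (Ju u)) = Ju u := φ.right_inv hu.2
    have h2 : χ (Jb u) = (r.symm u).2 := χ.right_inv hu.1.1
    simp only [H, h1, h2]
    simp [Ju]
  have hJbH : ∀ s ∈ src, Jb (H s.1) = s.1.2 := by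
    intro s hs
    simp [Jb, H, χ.left_inv hs.2]
  have hJuH : ∀ s ∈ src, Ju (H s.1) = φ s.1.1 := by
    intro s hs
    have h1 : ψ (g s.1.2) = (q (φ s.1.1)).1 := by
      rw [← hnorm _ (φ.map_source hs.1), φ.left_inv hs.1, s.2]
    simp only [Ju, hJbH s hs, h1]
    simp [H]
  have hHT : ∀ s ∈ src, H s.1 ∈ T := by
    intro s hs
    refine ⟨⟨?_, ?_⟩, ?_⟩
    · simpa [T1, H] using χ.map_source hs.2
    · change g (Jb (H s.1)) ∈ ψ.source
      rw [hJbH s hs, ← s.2]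
      exact hsub _ hs.1
    · change Ju (H s.1) ∈ φ.target
      rw [hJuH s hs]
      exact φ.map_source hs.1
  classical
  let J : EuclideanSpace ℝ (Fin (a + b - c)) → S := fun u =>
    if h : u ∈ T then ⟨(φ.symm (Ju u), Jb u), hJf u h⟩ else s₀
  have hJ : ∀ u ∈ T, (J u).1 = (φ.symm (Ju u), Jb u) := fun u hu => by simp [J, hu]
  let e : OpenPartialHomeomorph S (EuclideanSpace ℝ (Fin (a + b - c))) :=
    { toFun := fun s => H s.1
      invFun := J
      source := src
      target := T
      map_source' := hHT
      map_target' := fun u hu => by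
        change (J u).1.1 ∈ φ.source ∧ (J u).1.2 ∈ χ.source
        rw [hJ u hu]; exact hJmem u hu
      left_inv' := fun s hs => by
        apply Subtype.ext
        rw [hJ _ (hHT s hs), hJuH s hs, hJbH s hs, φ.left_inv hs.1]
      right_inv' := fun u hu => by
        rw [hJ u hu]; exact hHJ u hu
      open_source := (φ.open_source.preimage (by fun_prop)).inter
        (χ.open_source.preimage (by fun_prop))
      open_target := hT
      continuousOn_toFun := fun s hs =>
        ((hHa s hs).continuousAt.comp continuous_subtype_val.continuousAt).continuousWithinAt
      continuousOn_invFun := by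
        refine (Topology.IsInducing.mk rfl :
          Topology.IsInducing (Subtype.val : S → A × B)).continuousOn_iff.2 ?_
        intro u hu
        have h1 : ContinuousWithinAt (fun v => (φ.symm (Ju v), Jb v)) T u :=
          ((hJa u hu).continuousAt.prodMk (hJb u hu.1.1).continuousAt).continuousWithinAt
        exact h1.congr (fun v hv => hJ v hv) (hJ u hu) }
  refine ⟨e, ⟨hφs, hχs⟩, ⟨H, fun s => rfl, hHa⟩, ?_, ?_⟩
  · intro u hu
    refine (hJa u hu).congr_of_eventuallyEq ?_
    filter_upwards [hT.mem_nhds hu] with v hv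
    exact congrArg Prod.fst (hJ v hv)
  · intro u hu
    refine (hJb u hu.1.1).congr_of_eventuallyEq ?_
    filter_upwards [hT.mem_nhds hu] with v hv
    exact congrArg Prod.snd (hJ v hv)

/-- The smooth structure on the fiber product `A ×_C B` of a submersion `A → C` and a smooth map
`B → C`, as an embedded submanifold of `A × B`. -/
@[reducible] noncomputable def fpCharted (hf : IsSubmersion (𝓡 a) (𝓡 c) ∞ f)
    (hg : ContMDiff (𝓡 b) (𝓡 c) ∞ g) :
    ChartedSpace (EuclideanSpace ℝ (Fin (a + b - c))) {p : A × B // f p.1 = g p.2} where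
  atlas := range fun s => (exists_fiberProduct_chart hf hg s).choose
  chartAt s := (exists_fiberProduct_chart hf hg s).choose
  mem_chart_source s := (exists_fiberProduct_chart hf hg s).choose_spec.1
  chart_mem_atlas s := ⟨s, rfl⟩

variable (hf : IsSubmersion (𝓡 a) (𝓡 c) ∞ f) (hg : ContMDiff (𝓡 b) (𝓡 c) ∞ g)

theorem fp_isManifold :
    letI := fpCharted hf hg
    IsManifold (𝓡 (a + b - c)) ∞ {p : A × B // f p.1 = g p.2} := by
  letI := fpCharted hf hg
  refine isManifold_of_contDiffOn _ _ _ ?_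
  rintro _ _ ⟨s, rfl⟩ ⟨t, rfl⟩
  obtain ⟨_, -, h1, h2⟩ := (exists_fiberProduct_chart hf hg s).choose_spec
  obtain ⟨_, ⟨H, hH, hHs⟩, -⟩ := (exists_fiberProduct_chart hf hg t).choose_spec
  intro u hu
  have hu1 : u ∈ (exists_fiberProduct_chart hf hg s).choose.target := hu.1.1
  have hu2 : (exists_fiberProduct_chart hf hg s).choose.symm u ∈
    (exists_fiberProduct_chart hf hg t).choose.source := hu.1.2
  have h3 := (hHs _ hu2).comp u ((h1 u hu1).prodMk (h2 u hu1))
  refine (ContDiffAt.congr_of_eventuallyEq h3.contDiffAt ?_).contDiffWithinAt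
  exact Filter.Eventually.of_forall fun v => hH _

theorem fp_contMDiff_fst :
    letI := fpCharted hf hg
    ContMDiff (𝓡 (a + b - c)) (𝓡 a) ∞ (fun s : {p : A × B // f p.1 = g p.2} => s.1.1) := by
  letI := fpCharted hf hg
  intro s
  obtain ⟨h0, -, h1, h2⟩ := (exists_fiberProduct_chart hf hg s).choose_spec
  rw [contMDiffAt_iff_source]
  exact (h1 _ ((exists_fiberProduct_chart hf hg s).choose.map_source h0)).contMDiffWithinAt

theorem fp_contMDiff_snd :
    letI := fpCharted hf hg
    ContMDiff (𝓡 (a + b - c)) (𝓡 b) ∞ (fun s : {p : A × B // f p.1 = g p.2} => s.1.2) := by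
  letI := fpCharted hf hg
  intro s
  obtain ⟨h0, -, h1, h2⟩ := (exists_fiberProduct_chart hf hg s).choose_spec
  rw [contMDiffAt_iff_source]
  exact (h2 _ ((exists_fiberProduct_chart hf hg s).choose.map_source h0)).contMDiffWithinAt

theorem fp_contMDiffAt_mk {EN HN N : Type*} [NormedAddCommGroup EN] [NormedSpace ℝ EN]
    [TopologicalSpace HN] {J : ModelWithCorners ℝ EN HN} [TopologicalSpace N] [ChartedSpace HN N]
    {k : N → {p : A × B // f p.1 = g p.2}} {x : N}
    (h1 : ContMDiffAt J (𝓡 a) ∞ (fun y => (k y).1.1) x)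
    (h2 : ContMDiffAt J (𝓡 b) ∞ (fun y => (k y).1.2) x) :
    letI := fpCharted hf hg
    ContMDiffAt J (𝓡 (a + b - c)) ∞ k x := by
  letI := fpCharted hf hg
  obtain ⟨h0, ⟨H, hH, hHs⟩, -⟩ := (exists_fiberProduct_chart hf hg (k x)).choose_spec
  rw [contMDiffAt_iff_target]
  refine ⟨?_, ?_⟩
  · refine (Topology.IsInducing.mk rfl : Topology.IsInducing
      (Subtype.val : {p : A × B // f p.1 = g p.2} → A × B)).continuousAt_iff.2 ?_
    exact h1.continuousAt.prodMk h2.continuousAt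
  · exact ((hHs _ h0).comp x (h1.prodMk h2)).congr_of_eventuallyEq
      (Filter.Eventually.of_forall fun y => hH _)

end FiberProduct

section Sections
variable {m n : ℕ} {A C : Type*}
    [TopologicalSpace A] [ChartedSpace (EuclideanSpace ℝ (Fin m)) A] [IsManifold (𝓡 m) ∞ A]
    [TopologicalSpace C] [ChartedSpace (EuclideanSpace ℝ (Fin n)) C] [IsManifold (𝓡 n) ∞ C]
    {f : A → C}

/-- A submersion has a smooth local section through every point. -/
theorem exists_section_of_isSubmersion (hf : IsSubmersion (𝓡 m) (𝓡 n) ∞ f) (x : A) :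
    ∃ σ : C → A, ContMDiffAt (𝓡 n) (𝓡 m) ∞ σ (f x) ∧ σ (f x) = x ∧
      ∀ᶠ y in 𝓝 (f x), f (σ y) = y := by
  have h0 := hf.isSubmersionOfComplement_complement x
  let F := hf.complement
  let φ := h0.domChart
  let ψ := h0.codChart
  let q : EuclideanSpace ℝ (Fin m) ≃L[ℝ] EuclideanSpace ℝ (Fin n) × F := h0.equiv
  have hφs : x ∈ φ.source := h0.mem_domChart_source
  have hψs : f x ∈ ψ.source := h0.mem_codChart_source
  have hφ : φ ∈ IsManifold.maximalAtlas (𝓡 m) ∞ A := h0.domChart_mem_maximalAtlas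
  have hψ : ψ ∈ IsManifold.maximalAtlas (𝓡 n) ∞ C := h0.codChart_mem_maximalAtlas
  have hsub : ∀ x ∈ φ.source, f x ∈ ψ.source := h0.source_subset_preimage_source
  have hnorm : ∀ u ∈ φ.target, ψ (f (φ.symm u)) = (q u).1 := by
    intro u hu
    have := h0.writtenInCharts (show u ∈ (h0.domChart.extend (𝓡 m)).target by simpa using hu)
    simpa using this
  have hx0 : (q (φ x)).1 = ψ (f x) := by rw [← hnorm _ (φ.map_source hφs), φ.left_inv hφs]
  let τ : C → EuclideanSpace ℝ (Fin m) := fun y => q.symm (ψ y, (q (φ x)).2)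
  have hτx : τ (f x) = φ x := by simp [τ, ← hx0]
  have hτ : ContMDiffAt (𝓡 n) (𝓡 m) ∞ τ (f x) :=
    q.symm.contDiff.contMDiff.contMDiffAt.comp (f x)
      ((contMDiffAt_of_mem_maximalAtlas hψ hψs).prodMk_space contMDiffAt_const)
  refine ⟨fun y => φ.symm (τ y), ?_, ?_, ?_⟩
  · refine ContMDiffAt.comp (f x) (I' := 𝓡 m) ?_ hτ
    rw [hτx]
    exact contMDiffAt_symm_of_mem_maximalAtlas hφ (φ.map_source hφs)
  · simp only [hτx]; exact φ.left_inv hφs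
  · have h1 : ∀ᶠ y in 𝓝 (f x), τ y ∈ φ.target :=
      hτ.continuousAt.eventually_mem (by
        rw [hτx]; exact φ.open_target.mem_nhds (φ.map_source hφs))
    filter_upwards [h1, ψ.open_source.mem_nhds hψs] with y hy1 hy2
    refine ψ.injOn (hsub _ (φ.map_target hy1)) hy2 ?_
    rw [hnorm _ hy1]
    simp [τ]

/-- A smooth map with a smooth local section through every point is a submersion. -/
theorem isSubmersion_of_exists_section (hf : ContMDiff (𝓡 m) (𝓡 n) ∞ f)
    (h : ∀ x, ∃ σ : C → A, ContMDiffAt (𝓡 n) (𝓡 m) ∞ σ (f x) ∧ σ (f x) = x ∧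
      ∀ᶠ y in 𝓝 (f x), f (σ y) = y) : IsSubmersion (𝓡 m) (𝓡 n) ∞ f := by
  refine ⟨EuclideanSpace ℝ (Fin (m - n)), inferInstance, inferInstance, fun x => ?_⟩
  refine submersionAt_of_surjective hf x fun v => ?_
  obtain ⟨σ, hσ, hσx, hσf⟩ := h x
  have hσ' : MDifferentiableAt (𝓡 n) (𝓡 m) σ (f x) := hσ.mdifferentiableAt (by simp)
  have hf' : MDifferentiableAt (𝓡 m) (𝓡 n) f (σ (f x)) := hf.mdifferentiableAt (by simp)
  have h1 : HasMFDerivAt (𝓡 n) (𝓡 n) (f ∘ σ) (f x)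
      ((mfderiv (𝓡 m) (𝓡 n) f (σ (f x))).comp (mfderiv (𝓡 n) (𝓡 m) σ (f x))) :=
    hf'.hasMFDerivAt.comp (f x) hσ'.hasMFDerivAt
  have h2 : HasMFDerivAt (𝓡 n) (𝓡 n) (f ∘ σ) (f x) (ContinuousLinearMap.id ℝ _) :=
    (hasMFDerivAt_id (f x)).congr_of_eventuallyEq hσf
  have h3 := hasMFDerivAt_unique h1 h2
  rw [hσx] at h3
  exact ⟨mfderiv (𝓡 n) (𝓡 m) σ (f x) v, DFunLike.congr_fun h3 v⟩

end Sections

/-- A compact Lie group. -/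
structure CompactLieGroup where
  carrier : Type v
  dim : ℕ
  [topology : TopologicalSpace carrier]
  [charted : ChartedSpace (EuclideanSpace ℝ (Fin dim)) carrier]
  [group : Group carrier]
  [lieGroup : LieGroup (𝓡 dim) ∞ carrier]
  [compact : CompactSpace carrier]
  [t2 : T2Space carrier]

namespace CompactLieGroup
instance : CoeSort CompactLieGroup.{v} (Type v) := ⟨carrier⟩
attribute [instance] topology charted group lieGroup compact t2

/-- The Lie algebra of `G`, as the tangent space at the identity. -/
abbrev lie (G : CompactLieGroup.{v}) : Type := GroupLieAlgebra (𝓡 G.dim) G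

/-- The adjoint action of `G` on its Lie algebra: the differential of `h ↦ g * h * g⁻¹` at `1`. -/
noncomputable def Ad (G : CompactLieGroup.{v}) (g : G) (ξ : G.lie) : G.lie :=
  mfderiv (𝓡 G.dim) (𝓡 G.dim) (fun h : G => g * h * g⁻¹) 1 ξ
end CompactLieGroup

/-- A smooth manifold (Hausdorff, second countable, finite-dimensional, without boundary) with a
smooth left action of `G`. -/
structure GManifold (G : CompactLieGroup.{v}) where
  carrier : Type u
  dim : ℕ
  [topology : TopologicalSpace carrier]
  [charted : ChartedSpace (EuclideanSpace ℝ (Fin dim)) carrier]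
  [isManifold : IsManifold (𝓡 dim) ∞ carrier]
  [t2 : T2Space carrier]
  [secondCountable : SecondCountableTopology carrier]
  [action : MulAction G carrier]
  [smoothAction : ContMDiffSMul (𝓡 G.dim) (𝓡 dim) ∞ G carrier]

variable {G : CompactLieGroup.{v}}

namespace GManifold
instance : CoeSort (GManifold.{v, u} G) (Type u) := ⟨carrier⟩
attribute [instance] topology charted isManifold t2 secondCountable action smoothAction

/-- The model with corners of a `G`-manifold. -/
noncomputable abbrev model (X : GManifold.{v, u} G) := 𝓡 X.dim

/-- The infinitesimal action at `x`: it sends `ξ` in the Lie algebra to the value at `x` of the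
fundamental vector field of `ξ`, i.e. to the derivative of `g ↦ g • x` at `1` in direction `ξ`. -/
noncomputable def fundamental (X : GManifold.{v, u} G) (x : X) :
    G.lie →L[ℝ] TangentSpace X.model x :=
  mfderiv (𝓡 G.dim) X.model (fun g : G => g • x) 1
end GManifold

/-- A smooth `G`-equivariant map of `G`-manifolds. -/
structure GMap (X Y : GManifold.{v, u} G) where
  toFun : X → Y
  smooth : ContMDiff X.model Y.model ∞ toFun
  map_smul : ∀ (g : G) (x : X), toFun (g • x) = g • toFun x

namespace GMap
instance (X Y : GManifold.{v, u} G) : CoeFun (GMap X Y) fun _ => X → Y := ⟨toFun⟩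

/-- The identity map. -/
def id (X : GManifold.{v, u} G) : GMap X X := ⟨fun x => x, contMDiff_id, fun _ _ => rfl⟩

/-- Composition: first `f`, then `g`. -/
def comp {X Y Z : GManifold.{v, u} G} (f : GMap X Y) (g : GMap Y Z) : GMap X Z :=
  ⟨fun x => g (f x), g.smooth.comp f.smooth, fun a x => by rw [f.map_smul, g.map_smul]⟩

theorem contMDiffAt {X Y : GManifold.{v, u} G} (f : GMap X Y) (x : X) :
    ContMDiffAt X.model Y.model ∞ f x := f.smooth x

theorem mdiff {X Y : GManifold.{v, u} G} (f : GMap X Y) (x : X) :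
    MDifferentiableAt X.model Y.model f x := f.smooth.mdifferentiableAt (by simp)
end GMap

/-- A `G`-cover: a `G`-equivariant surjective submersion. -/
structure IsGCover {Y X : GManifold.{v, u} G} (π : GMap Y X) : Prop where
  surjective : Surjective π
  submersion : IsSubmersion Y.model X.model ∞ π

/-- `f` has smooth local sections through every point of its domain. -/
def HasSections {Y X : GManifold.{v, u} G} (f : GMap Y X) : Prop :=
  ∀ y : Y, ∃ σ : X → Y, ContMDiffAt X.model Y.model ∞ σ (f y) ∧ σ (f y) = y ∧
    ∀ᶠ x in 𝓝 (f y), f (σ x) = x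

namespace IsGCover
variable {X Y Z : GManifold.{v, u} G}

theorem sections {f : GMap Y X} (hf : IsGCover f) : HasSections f :=
  exists_section_of_isSubmersion hf.submersion

theorem of_sections {f : GMap Y X} (h1 : Surjective f) (h2 : HasSections f) : IsGCover f :=
  ⟨h1, isSubmersion_of_exists_section f.smooth h2⟩

theorem id (X : GManifold.{v, u} G) : IsGCover (GMap.id X) :=
  of_sections (fun x => ⟨x, rfl⟩)
    fun _ => ⟨fun x => x, contMDiffAt_id, rfl, Filter.Eventually.of_forall fun _ => rfl⟩

theorem comp {f : GMap X Y} {g : GMap Y Z} (hf : IsGCover f) (hg : IsGCover g) :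
    IsGCover (f.comp g) := by
  refine of_sections (hg.surjective.comp hf.surjective) fun x => ?_
  obtain ⟨σ, s1, s2, s3⟩ := hf.sections x
  obtain ⟨τ, t1, t2, t3⟩ := hg.sections (f x)
  refine ⟨fun z => σ (τ z), ?_, ?_, ?_⟩
  · refine ContMDiffAt.comp (I' := Y.model) (g (f x)) ?_ t1
    rw [t2]; exact s1
  · change σ (τ (g (f x))) = x
    rw [t2, s2]
  · have h : Filter.Tendsto τ (𝓝 (g (f x))) (𝓝 (f x)) := by
      have := t1.continuousAt.tendsto
      rwa [t2] at this
    filter_upwards [t3, h.eventually s3] with z h1 h2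
    change g (f (σ (τ z))) = z
    rw [h2, h1]
end IsGCover

section FiberProd
variable {A B C X : GManifold.{v, u} G}

/-- The fiber product `A ×_C B` of a `G`-cover `f : A → C` and a `G`-map `g : B → C`, with the
diagonal action. -/
noncomputable def fiberProd (f : GMap A C) (g : GMap B C) (hf : IsGCover f) :
    GManifold.{v, u} G :=
  letI := fpCharted hf.submersion g.smooth
  letI : IsManifold (𝓡 (A.dim + B.dim - C.dim)) ∞ {p : A × B // f p.1 = g p.2} :=
    fp_isManifold hf.submersion g.smooth
  letI act : MulAction G {p : A × B // f p.1 = g p.2} :=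
    { smul := fun a p => ⟨(a • p.1.1, a • p.1.2), by
        change f (a • p.1.1) = g (a • p.1.2)
        rw [f.map_smul, g.map_smul, p.2]⟩
      one_smul := fun p => Subtype.ext (Prod.ext (one_smul G p.1.1) (one_smul G p.1.2))
      mul_smul := fun a b p =>
        Subtype.ext (Prod.ext (mul_smul a b p.1.1) (mul_smul a b p.1.2)) }
  { carrier := {p : A × B // f p.1 = g p.2}
    dim := A.dim + B.dim - C.dim
    secondCountable := (Topology.IsInducing.mk rfl : Topology.IsInducing
      (Subtype.val : {p : A × B // f p.1 = g p.2} → A × B)).secondCountableTopology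
    smoothAction := ⟨fun q => fp_contMDiffAt_mk hf.submersion g.smooth
      (contMDiff_fst.smul ((fp_contMDiff_fst hf.submersion g.smooth).comp contMDiff_snd)
        |>.contMDiffAt)
      (contMDiff_fst.smul ((fp_contMDiff_snd hf.submersion g.smooth).comp contMDiff_snd)
        |>.contMDiffAt)⟩ }

namespace fiberProd
variable {f : GMap A C} {g : GMap B C} {hf : IsGCover f}

/-- The point `(a, b)` of the fiber product. -/
def mk (hf : IsGCover f) (a : A) (b : B) (h : f a = g b) : fiberProd f g hf := ⟨(a, b), h⟩

/-- The first projection. -/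
noncomputable def fst (f : GMap A C) (g : GMap B C) (hf : IsGCover f) :
    GMap (fiberProd f g hf) A :=
  ⟨fun p => p.1.1, fp_contMDiff_fst hf.submersion g.smooth, fun _ _ => rfl⟩

/-- The second projection. -/
noncomputable def snd (f : GMap A C) (g : GMap B C) (hf : IsGCover f) :
    GMap (fiberProd f g hf) B :=
  ⟨fun p => p.1.2, fp_contMDiff_snd hf.submersion g.smooth, fun _ _ => rfl⟩

theorem condition (p : fiberProd f g hf) : f (fst f g hf p) = g (snd f g hf p) := p.2

theorem ext {p q : fiberProd f g hf} (h1 : fst f g hf p = fst f g hf q)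
    (h2 : snd f g hf p = snd f g hf q) : p = q := Subtype.ext (Prod.ext h1 h2)

theorem contMDiffAt_mk {EN HN N : Type*} [NormedAddCommGroup EN] [NormedSpace ℝ EN]
    [TopologicalSpace HN] {J : ModelWithCorners ℝ EN HN} [TopologicalSpace N] [ChartedSpace HN N]
    {k : N → fiberProd f g hf} {x : N}
    (h1 : ContMDiffAt J A.model ∞ (fun y => fst f g hf (k y)) x)
    (h2 : ContMDiffAt J B.model ∞ (fun y => snd f g hf (k y)) x) :
    ContMDiffAt J (fiberProd f g hf).model ∞ k x :=
  fp_contMDiffAt_mk hf.submersion g.smooth h1 h2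

/-- The map into the fiber product with given components. -/
noncomputable def lift (hf : IsGCover f) (a : GMap X A) (b : GMap X B)
    (h : ∀ x, f (a x) = g (b x)) : GMap X (fiberProd f g hf) :=
  ⟨fun x => mk hf (a x) (b x) (h x), fun x => contMDiffAt_mk (a.contMDiffAt x) (b.contMDiffAt x),
    fun c x => Subtype.ext (Prod.ext (a.map_smul c x) (b.map_smul c x))⟩

/-- A point of the fiber product depending smoothly on parameters, from local data. -/
theorem exists_mk_section {EN HN N : Type*} [NormedAddCommGroup EN] [NormedSpace ℝ EN]
    [TopologicalSpace HN] {J : ModelWithCorners ℝ EN HN} [TopologicalSpace N] [ChartedSpace HN N]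
    {a : N → A} {b : N → B} {x : N} (p₀ : fiberProd f g hf)
    (ha : ContMDiffAt J A.model ∞ a x) (hb : ContMDiffAt J B.model ∞ b x)
    (h : ∀ᶠ y in 𝓝 x, f (a y) = g (b y)) (ha0 : a x = fst f g hf p₀) (hb0 : b x = snd f g hf p₀) :
    ∃ k : N → fiberProd f g hf, ContMDiffAt J (fiberProd f g hf).model ∞ k x ∧ k x = p₀ ∧
      ∀ᶠ y in 𝓝 x, fst f g hf (k y) = a y ∧ snd f g hf (k y) = b y := by
  classical
  let k : N → fiberProd f g hf := fun y =>
    if hy : f (a y) = g (b y) then mk hf (a y) (b y) hy else p₀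
  have hk : ∀ y, f (a y) = g (b y) → fst f g hf (k y) = a y ∧ snd f g hf (k y) = b y := by
    intro y hy
    simp only [k, hy, dif_pos]
    exact ⟨rfl, rfl⟩
  have hev := h.mono hk
  refine ⟨k, contMDiffAt_mk (ha.congr_of_eventuallyEq (hev.mono fun y hy => hy.1))
    (hb.congr_of_eventuallyEq (hev.mono fun y hy => hy.2)), ?_, hev⟩
  have h0 := hev.self_of_nhds
  exact ext (h0.1.trans ha0) (h0.2.trans hb0)

theorem isGCover_snd (f : GMap A C) (g : GMap B C) (hf : IsGCover f) :
    IsGCover (snd f g hf) := by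
  refine IsGCover.of_sections (fun b => ?_) fun p => ?_
  · obtain ⟨a, ha⟩ := hf.surjective (g b)
    exact ⟨mk hf a b ha, rfl⟩
  · obtain ⟨σ, s1, s2, s3⟩ := hf.sections (fst f g hf p)
    have hc : f (fst f g hf p) = g (snd f g hf p) := p.2
    rw [hc] at s1 s2 s3
    have hg := g.contMDiffAt (snd f g hf p)
    obtain ⟨k, k1, k2, k3⟩ := exists_mk_section (J := B.model) (a := fun b => σ (g b))
      (b := fun b => b) (x := snd f g hf p) p (s1.comp _ hg) contMDiffAt_id
      (hg.continuousAt.eventually s3) s2 rfl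
    exact ⟨k, k1, k2, k3.mono fun y hy => hy.2⟩

theorem isGCover_fst (f : GMap A C) (g : GMap B C) (hf : IsGCover f) (hg : IsGCover g) :
    IsGCover (fst f g hf) := by
  refine IsGCover.of_sections (fun a => ?_) fun p => ?_
  · obtain ⟨b, hb⟩ := hg.surjective (f a)
    exact ⟨mk hf a b hb.symm, rfl⟩
  · obtain ⟨σ, s1, s2, s3⟩ := hg.sections (snd f g hf p)
    have hc : f (fst f g hf p) = g (snd f g hf p) := p.2
    rw [← hc] at s1 s2 s3
    have hf' := f.contMDiffAt (fst f g hf p)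
    obtain ⟨k, k1, k2, k3⟩ := exists_mk_section (J := A.model) (a := fun a => a)
      (b := fun a => σ (f a)) (x := fst f g hf p) p contMDiffAt_id (s1.comp _ hf')
      ((hf'.continuousAt.eventually s3).mono fun y hy => hy.symm) rfl s2
    exact ⟨k, k1, k2, k3.mono fun y hy => hy.1⟩

end fiberProd
end FiberProd

section Torsor

/-- A principal homogeneous space of the circle group. -/
class CircleTorsor (T : Type u) extends MulAction Circle T where
  nonempty : Nonempty T
  existsUnique_smul : ∀ p q : T, ∃! z : Circle, z • q = p

variable {T S : Type u} [CircleTorsor T] [CircleTorsor S]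

/-- The unique `z` in the circle with `z • q = p`. -/
noncomputable def ratio (p q : T) : Circle := (CircleTorsor.existsUnique_smul p q).choose

theorem ratio_smul (p q : T) : ratio p q • q = p :=
  (CircleTorsor.existsUnique_smul p q).choose_spec.1

theorem ratio_unique {p q : T} {z : Circle} (h : z • q = p) : ratio p q = z :=
  ((CircleTorsor.existsUnique_smul p q).choose_spec.2 z h).symm

theorem ratio_self (p : T) : ratio p p = 1 := ratio_unique (one_smul _ _)

theorem ratio_mul (p q r : T) : ratio p q * ratio q r = ratio p r :=
  (ratio_unique (by rw [mul_smul, ratio_smul, ratio_smul])).symm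

theorem ratio_inv (p q : T) : (ratio p q)⁻¹ = ratio q p :=
  inv_eq_of_mul_eq_one_left (by rw [ratio_mul, ratio_self])

theorem smul_ratio_left (z : Circle) (p q : T) : ratio (z • p) q = z * ratio p q :=
  ratio_unique (by rw [mul_smul, ratio_smul])

theorem smul_ratio_right (z : Circle) (p q : T) : ratio p (z • q) = z⁻¹ * ratio p q := by
  rw [← ratio_inv, smul_ratio_left, mul_inv, ratio_inv]

theorem ratio_eq_one {p q : T} (h : ratio p q = 1) : p = q := by
  rw [← ratio_smul p q, h, one_smul]

theorem ratio_map {φ : T → S} (h : ∀ (z : Circle) p, φ (z • p) = z • φ p) (p q : T) :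
    ratio (φ p) (φ q) = ratio p q :=
  ratio_unique (by rw [← h, ratio_smul])

/-- Two pairs represent the same element of the tensor product if they differ by the antidiagonal
circle action. -/
def tensorSetoid (T S : Type u) [CircleTorsor T] [CircleTorsor S] : Setoid (T × S) where
  r a b := ∃ z : Circle, z • b.1 = a.1 ∧ z • a.2 = b.2
  iseqv :=
    ⟨fun a => ⟨1, one_smul _ _, one_smul _ _⟩,
     fun ⟨z, h1, h2⟩ => ⟨z⁻¹, by rw [← h1, inv_smul_smul], by rw [← h2, inv_smul_smul]⟩,
     fun ⟨z, h1, h2⟩ ⟨w, h3, h4⟩ => ⟨z * w, by rw [mul_smul, h3, h1],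
      by rw [mul_comm, mul_smul, h2, h4]⟩⟩

/-- The tensor product (contracted product) `T ⊗ S` of circle torsors: `T × S` modulo
`(z • t, s) ∼ (t, z • s)`. -/
def Tensor (T S : Type u) [CircleTorsor T] [CircleTorsor S] : Type u :=
  Quotient (tensorSetoid T S)

/-- The element `t ⊗ s`. -/
def tmul (t : T) (s : S) : Tensor T S := Quotient.mk (tensorSetoid T S) (t, s)

theorem tmul_surj (x : Tensor T S) : ∃ t s, tmul t s = x := by
  induction x using Quotient.inductionOn with
  | h a => exact ⟨a.1, a.2, rfl⟩

theorem smul_tmul_comm (z : Circle) (t : T) (s : S) : tmul (z • t) s = tmul t (z • s) :=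
  Quotient.sound ⟨z, rfl, rfl⟩

instance : CircleTorsor (Tensor T S) where
  smul z := Quotient.map' (s₁ := tensorSetoid T S) (s₂ := tensorSetoid T S)
    (fun a => (z • a.1, a.2)) fun a b ⟨w, h1, h2⟩ =>
      ⟨w, by change w • z • b.1 = z • a.1; rw [smul_comm, h1], h2⟩
  one_smul := by
    rintro ⟨a⟩
    exact congrArg (fun t => tmul t a.2) (one_smul _ a.1)
  mul_smul := by
    rintro z w ⟨a⟩
    exact congrArg (fun t => tmul t a.2) (mul_smul z w a.1)
  nonempty := by
    obtain ⟨t⟩ := CircleTorsor.nonempty (T := T)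
    obtain ⟨s⟩ := CircleTorsor.nonempty (T := S)
    exact ⟨tmul t s⟩
  existsUnique_smul := by
    intro x y
    obtain ⟨t, s, rfl⟩ := tmul_surj x
    obtain ⟨t', s', rfl⟩ := tmul_surj y
    refine ⟨ratio t t' * ratio s s', ?_, ?_⟩
    · change tmul ((ratio t t' * ratio s s') • t') s' = _
      rw [mul_comm, mul_smul, ratio_smul, smul_tmul_comm, ratio_smul]
    · intro z hz
      obtain ⟨w, h1, h2⟩ := Quotient.exact (s := tensorSetoid T S) hz
      change w • t = z • t' at h1
      change w • s' = s at h2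
      rw [ratio_unique h2]
      have h3 : t = (w⁻¹ * z) • t' := by rw [mul_smul, ← h1, inv_smul_smul]
      rw [ratio_unique h3.symm, mul_comm, mul_inv_cancel_left]

theorem smul_tmul (z : Circle) (t : T) (s : S) : tmul (z • t) s = z • tmul t s := rfl

theorem tmul_smul (z : Circle) (t : T) (s : S) : tmul t (z • s) = z • tmul t s := by
  rw [← smul_tmul_comm, smul_tmul]

theorem ratio_tmul (t t' : T) (s s' : S) :
    ratio (tmul t s) (tmul t' s') = ratio t t' * ratio s s' :=
  ratio_unique (by rw [mul_smul, ← tmul_smul, ← smul_tmul, ratio_smul, ratio_smul])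

theorem tmul_left_cancel {t : T} {s s' : S} (h : tmul t s = tmul t s') : s = s' := by
  have h1 := ratio_tmul t t s s'
  rw [h, ratio_self, ratio_self, one_mul] at h1
  exact ratio_eq_one h1.symm

theorem tmul_right_cancel {t t' : T} {s : S} (h : tmul t s = tmul t' s) : t = t' := by
  have h1 := ratio_tmul t t' s s
  rw [h, ratio_self, ratio_self, mul_one] at h1
  exact ratio_eq_one h1.symm

end Torsor

section DLog
variable {n m : ℕ} {N M : Type*} [TopologicalSpace N] [ChartedSpace (EuclideanSpace ℝ (Fin n)) N]
  [TopologicalSpace M] [ChartedSpace (EuclideanSpace ℝ (Fin m)) M]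

/-- The logarithmic differential `du / (i u)` of a circle-valued function on an `n`-manifold, a
real `1`-form; if `u = exp (i θ)` locally, this is `dθ`. -/
noncomputable def dlog (n : ℕ) {N : Type*} [TopologicalSpace N]
    [ChartedSpace (EuclideanSpace ℝ (Fin n)) N] (u : N → Circle) (x : N) :
    TangentSpace (𝓡 n) x →L[ℝ] ℝ :=
  Complex.imCLM.comp ((starRingEnd ℂ (u x : ℂ)) • mvfderiv (𝓡 n) (fun y => (u y : ℂ)) x)

theorem contMDiff_circle_coe : ContMDiff (𝓡 1) 𝓘(ℝ, ℂ) ∞ (fun z : Circle => (z : ℂ)) :=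
  haveI := finrank_real_complex_fact'
  contMDiff_coe_sphere (E := ℂ)

theorem mdiff_coe {u : N → Circle} {x : N} (hu : ContMDiffAt (𝓡 n) (𝓡 1) ∞ u x) :
    MDifferentiableAt (𝓡 n) 𝓘(ℝ, ℂ) (fun y => (u y : ℂ)) x :=
  (contMDiff_circle_coe.contMDiffAt.comp x hu).mdifferentiableAt (by simp)

theorem dlog_congr {u w : N → Circle} {x : N} (h : ∀ᶠ y in 𝓝 x, u y = w y) :
    dlog n u x = dlog n w x := by
  have h1 : (fun y => (u y : ℂ)) =ᶠ[𝓝 x] fun y => (w y : ℂ) := 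
    h.mono fun y hy => congrArg (fun z : Circle => (z : ℂ)) hy
  have h2 : mvfderiv (𝓡 n) (fun y => (u y : ℂ)) x = mvfderiv (𝓡 n) (fun y => (w y : ℂ)) x :=
    h1.mfderiv_eq
  simp only [dlog, h.self_of_nhds, h2]

theorem dlog_const (z : Circle) (x : N) : dlog n (fun _ : N => z) x = 0 := by
  have h : mvfderiv (𝓡 n) (fun _ : N => (z : ℂ)) x = 0 := mvfderiv_const _
  simp only [dlog, h, smul_zero, ContinuousLinearMap.comp_zero]

theorem dlog_mul {u w : N → Circle} {x : N} (hu : ContMDiffAt (𝓡 n) (𝓡 1) ∞ u x)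
    (hw : ContMDiffAt (𝓡 n) (𝓡 1) ∞ w x) :
    dlog n (fun y => u y * w y) x = dlog n u x + dlog n w x := by
  have h := ((mdiff_coe hu).hasMFDerivAt.mul (mdiff_coe hw).hasMFDerivAt).mfderiv
  have h2 : mvfderiv (𝓡 n) (fun y => ((u y * w y : Circle) : ℂ)) x =
      (u x : ℂ) • mvfderiv (𝓡 n) (fun y => (w y : ℂ)) x +
      (w x : ℂ) • mvfderiv (𝓡 n) (fun y => (u y : ℂ)) x := h
  have hu1 : starRingEnd ℂ (u x : ℂ) * (u x : ℂ) = 1 := by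
    rw [← Circle.coe_inv_eq_conj, ← Circle.coe_mul, inv_mul_cancel, Circle.coe_one]
  have hw1 : starRingEnd ℂ (w x : ℂ) * (w x : ℂ) = 1 := by
    rw [← Circle.coe_inv_eq_conj, ← Circle.coe_mul, inv_mul_cancel, Circle.coe_one]
  unfold dlog
  rw [h2]
  ext v
  simp only [Circle.coe_mul, map_mul, ContinuousLinearMap.comp_apply, add_apply, smul_apply,
    smul_eq_mul, Complex.imCLM_apply]
  rw [← Complex.add_im]
  congr 1
  linear_combination (starRingEnd ℂ (w x : ℂ) * mvfderiv (𝓡 n) (fun y => (w y : ℂ)) x v) * hu1 +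
    (starRingEnd ℂ (u x : ℂ) * mvfderiv (𝓡 n) (fun y => (u y : ℂ)) x v) * hw1

theorem dlog_inv {u : N → Circle} {x : N} (hu : ContMDiffAt (𝓡 n) (𝓡 1) ∞ u x) :
    dlog n (fun y => (u y)⁻¹) x = - dlog n u x := by
  have h := dlog_mul hu hu.inv
  have h1 : dlog n (fun y => u y * (u y)⁻¹) x = 0 := by
    simp only [mul_inv_cancel]; exact dlog_const 1 x
  rw [h1] at h
  exact (neg_eq_of_add_eq_zero_right h.symm).symm

theorem dlog_comp {u : M → Circle} {f : N → M} {x : N}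
    (hu : ContMDiffAt (𝓡 m) (𝓡 1) ∞ u (f x)) (hf : MDifferentiableAt (𝓡 n) (𝓡 m) f x) :
    dlog n (fun y => u (f y)) x = (dlog m u (f x)).comp (mfderiv (𝓡 n) (𝓡 m) f x) := by
  have h : mvfderiv (𝓡 n) (fun y => (u (f y) : ℂ)) x =
      (mvfderiv (𝓡 m) (fun y => (u y : ℂ)) (f x)).comp (mfderiv (𝓡 n) (𝓡 m) f x) :=
    mfderiv_comp (I' := 𝓡 m) (I'' := 𝓘(ℝ, ℂ)) (g := fun y => (u y : ℂ)) x (mdiff_coe hu) hf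
  simp only [dlog, h]
  rfl

end DLog

theorem GManifold.mdiff_smul (X : GManifold.{v, u} G) (g : G) (x : X) :
    MDifferentiableAt X.model X.model (fun y : X => g • y) x :=
  (((contMDiff_const (I := X.model) (I' := 𝓡 G.dim) (c := g)).smul contMDiff_id :
    ContMDiff X.model X.model ∞ fun y : X => g • y) x).mdifferentiableAt (by simp)

section Bundles
variable {X Y Z : GManifold.{v, u} G}

/-- A `G`-equivariant principal circle bundle on `X`.  It is given by its fibers, circle torsors
depending on `x`, together with an atlas of local trivializations: for every `i` a section `sec i`
over an open neighbourhood `dom i` of `i`, with smooth transition functions (values of `sec i`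
outside `dom i` are irrelevant), and by a lift of the `G`-action to the fibers which commutes with
the circle action and is smooth in the local trivializations.  For `h : g • x = y`, `act g h` is
the action of `g` from the fiber at `x` to the fiber at `y`. -/
structure GBundle (X : GManifold.{v, u} G) where
  fiber : X → Type u
  [torsor : ∀ x, CircleTorsor (fiber x)]
  dom : X → Set X
  isOpen_dom : ∀ i, IsOpen (dom i)
  mem_dom : ∀ i, i ∈ dom i
  sec : ∀ _ : X, ∀ x, fiber x
  smooth_sec : ∀ i j, ∀ x ∈ dom i ∩ dom j,
    ContMDiffAt X.model (𝓡 1) ∞ (fun y => ratio (sec i y) (sec j y)) x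
  act : ∀ (g : G) {x y : X}, g • x = y → fiber x → fiber y
  act_smul : ∀ (g : G) {x y : X} (h : g • x = y) (z : Circle) (p : fiber x),
    act g h (z • p) = z • act g h p
  one_act : ∀ {x : X} (h : (1 : G) • x = x) (p : fiber x), act 1 h p = p
  mul_act : ∀ (g g' : G) {x y w : X} (h : g' • x = y) (h' : g • y = w) (h'' : (g * g') • x = w)
    (p : fiber x), act (g * g') h'' p = act g h' (act g' h p)
  smooth_act : ∀ i j (g : G) (x : X), x ∈ dom i → g • x ∈ dom j →
    ContMDiffAt ((𝓡 G.dim).prod X.model) (𝓡 1) ∞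
      (fun q : G × X => ratio (act q.1 (y := q.1 • q.2) rfl (sec i q.2)) (sec j (q.1 • q.2))) (g, x)

namespace GBundle
attribute [instance] torsor

/-- Transport of points of the fibers along an equality of base points. -/
def tr (P : GBundle X) {x y : X} (h : x = y) (p : P.fiber x) : P.fiber y := h ▸ p

@[simp] theorem tr_rfl (P : GBundle X) {x : X} (h : x = x) (p : P.fiber x) : P.tr h p = p := rfl

@[simp] theorem tr_tr (P : GBundle X) {x y w : X} (h : x = y) (h' : y = w) (p : P.fiber x) :
    P.tr h' (P.tr h p) = P.tr (h.trans h') p := by subst h; rfl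

theorem tr_smul (P : GBundle X) {x y : X} (h : x = y) (z : Circle) (p : P.fiber x) :
    P.tr h (z • p) = z • P.tr h p := by subst h; rfl

theorem ratio_tr (P : GBundle X) {x y : X} (h : x = y) (p q : P.fiber x) :
    ratio (P.tr h p) (P.tr h q) = ratio p q := by subst h; rfl

theorem tr_sec (P : GBundle X) {x y : X} (h : x = y) (i : X) :
    P.tr h (P.sec i x) = P.sec i y := by subst h; rfl

theorem act_tr (P : GBundle X) (g : G) {x x' y : X} (h : x = x') (h' : g • x' = y)
    (h'' : g • x = y) (p : P.fiber x) : P.act g h' (P.tr h p) = P.act g h'' p := by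
  subst h; rfl

theorem tr_act (P : GBundle X) (g : G) {x y y' : X} (h : g • x = y) (h' : y = y')
    (h'' : g • x = y') (p : P.fiber x) : P.tr h' (P.act g h p) = P.act g h'' p := by
  subst h'; rfl

theorem smooth_act' (P : GBundle X) (i j : X) (g : G) (x : X) (h1 : x ∈ P.dom i)
    (h2 : g • x ∈ P.dom j) : ContMDiffAt X.model (𝓡 1) ∞
      (fun y => ratio (P.act g (y := g • y) rfl (P.sec i y)) (P.sec j (g • y))) x :=
  (P.smooth_act i j g x h1 h2).comp x (f := fun y => (g, y))
    (contMDiffAt_const.prodMk contMDiffAt_id)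

theorem ratio_act_sec (P : GBundle X) (g : G) {x y y' : X} (h : g • x = y) (h' : g • x = y')
    (p : P.fiber x) (j : X) :
    ratio (P.act g h p) (P.sec j y) = ratio (P.act g h' p) (P.sec j y') := by
  subst h; subst h'; rfl

/-- The pullback `f^* P` of an equivariant bundle along an equivariant map. -/
def pull (P : GBundle Y) (f : GMap X Y) : GBundle X where
  fiber x := P.fiber (f x)
  dom i := f ⁻¹' P.dom (f i)
  isOpen_dom i := (P.isOpen_dom _).preimage f.smooth.continuous
  mem_dom i := P.mem_dom _
  sec i x := P.sec (f i) (f x)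
  smooth_sec i j x hx := (P.smooth_sec (f i) (f j) (f x) hx).comp x (f.contMDiffAt x)
  act g x y h p := P.act g (by rw [← f.map_smul, h]) p
  act_smul g x y h z p := P.act_smul g _ z p
  one_act h p := P.one_act _ p
  mul_act g g' x y w h h' h'' p := P.mul_act g g' _ _ _ p
  smooth_act i j g x hx hg := by
    have hg' : g • f x ∈ P.dom (f j) := by rw [← f.map_smul]; exact hg
    have h1 : ContMDiffAt ((𝓡 G.dim).prod X.model) ((𝓡 G.dim).prod Y.model) ∞
        (fun q : G × X => (q.1, f q.2)) (g, x) :=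
      contMDiffAt_fst.prodMk ((f.contMDiffAt x).comp (g, x) contMDiffAt_snd)
    refine ((P.smooth_act (f i) (f j) g (f x) hx hg').comp (g, x) h1).congr_of_eventuallyEq
      (Filter.Eventually.of_forall fun q => ?_)
    exact P.ratio_act_sec q.1 _ _ _ _

/-- The tensor product `P ⊗ Q` of equivariant bundles. -/
def tensor (P Q : GBundle X) : GBundle X where
  fiber x := Tensor (P.fiber x) (Q.fiber x)
  dom i := P.dom i ∩ Q.dom i
  isOpen_dom i := (P.isOpen_dom i).inter (Q.isOpen_dom i)
  mem_dom i := ⟨P.mem_dom i, Q.mem_dom i⟩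
  sec i x := tmul (P.sec i x) (Q.sec i x)
  smooth_sec i j x hx := by
    simp only [ratio_tmul]
    exact (P.smooth_sec i j x ⟨hx.1.1, hx.2.1⟩).mul (Q.smooth_sec i j x ⟨hx.1.2, hx.2.2⟩)
  act g x y h := Quotient.map' (s₁ := tensorSetoid _ _) (s₂ := tensorSetoid _ _)
    (fun a => (P.act g h a.1, Q.act g h a.2)) fun a b ⟨z, h1, h2⟩ =>
      ⟨z, by rw [← P.act_smul, h1], by rw [← Q.act_smul, h2]⟩
  act_smul g x y h z p := by
    obtain ⟨a, b, rfl⟩ := tmul_surj p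
    exact congrArg (fun t => tmul t (Q.act g h b)) (P.act_smul g h z a)
  one_act h p := by
    obtain ⟨a, b, rfl⟩ := tmul_surj p
    exact congrArg₂ tmul (P.one_act h a) (Q.one_act h b)
  mul_act g g' x y w h h' h'' p := by
    obtain ⟨a, b, rfl⟩ := tmul_surj p
    exact congrArg₂ tmul (P.mul_act g g' h h' h'' a) (Q.mul_act g g' h h' h'' b)
  smooth_act i j g x hx hg := by
    refine ((P.smooth_act i j g x hx.1 hg.1).mul
      (Q.smooth_act i j g x hx.2 hg.2)).congr_of_eventuallyEq
      (Filter.Eventually.of_forall fun q => ?_)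
    exact ratio_tmul _ _ _ _

end GBundle

/-- A morphism (automatically an isomorphism) of equivariant circle bundles over the identity of
`X`: fiberwise equivariant for the circle, `G`-equivariant, and smooth in local trivializations. -/
structure Iso (P Q : GBundle X) where
  toFun : ∀ x, P.fiber x → Q.fiber x
  map_smul : ∀ x (z : Circle) (p : P.fiber x), toFun x (z • p) = z • toFun x p
  map_act : ∀ (g : G) {x y : X} (h : g • x = y) (p : P.fiber x),
    toFun y (P.act g h p) = Q.act g h (toFun x p)
  smooth : ∀ i j, ∀ x ∈ P.dom i ∩ Q.dom j,
    ContMDiffAt X.model (𝓡 1) ∞ (fun y => ratio (toFun y (P.sec i y)) (Q.sec j y)) x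

/-- A `G`-invariant connection on an equivariant circle bundle, given by its local connection
`1`-forms: `form i` is the pullback along `sec i` of the connection `1`-form on the total space,
a smooth `1`-form on `dom i` (as a function on the tangent bundle). -/
structure Connection (P : GBundle X) where
  form : ∀ _ : X, ∀ x : X, TangentSpace X.model x →L[ℝ] ℝ
  smooth : ∀ i (w : TangentBundle X.model X), w.proj ∈ P.dom i →
    ContMDiffAt X.model.tangent 𝓘(ℝ, ℝ) ∞
      (fun w : TangentBundle X.model X => form i w.proj w.snd) w
  gauge : ∀ i j, ∀ x ∈ P.dom i ∩ P.dom j,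
    form i x = form j x + dlog X.dim (fun y => ratio (P.sec i y) (P.sec j y)) x
  invariant : ∀ i j (g : G) (x : X), x ∈ P.dom i → g • x ∈ P.dom j →
    form i x = (form j (g • x)).comp (mfderiv X.model X.model (fun y => g • y) x) +
      dlog X.dim (fun y => ratio (P.act g (y := g • y) rfl (P.sec i y)) (P.sec j (g • y))) x

/-- The isomorphism `φ` preserves the connections. -/
def Iso.Preserves {P Q : GBundle X} (φ : Iso P Q) (A : Connection P) (B : Connection Q) : Prop :=
  ∀ i j, ∀ x ∈ P.dom i ∩ Q.dom j,
    A.form i x = B.form j x + dlog X.dim (fun y => ratio (φ.toFun y (P.sec i y)) (Q.sec j y)) x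

namespace Connection

/-- The pullback connection. -/
noncomputable def pull {P : GBundle Y} (A : Connection P) (f : GMap X Y) :
    Connection (P.pull f) where
  form i x := (A.form (f i) (f x)).comp (mfderiv X.model Y.model f x)
  smooth i w hw :=
    (A.smooth (f i) (tangentMap X.model Y.model f w) hw).comp w
      (f.smooth.contMDiff_tangentMap (m := ∞) (by simp) w)
  gauge i j x hx := by
    rw [A.gauge (f i) (f j) (f x) hx, ContinuousLinearMap.add_comp]
    congr 1
    exact (dlog_comp (P.smooth_sec (f i) (f j) (f x) hx) (f.mdiff x)).symm
  invariant i j g x hx hg := by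
    have hg' : g • f x ∈ P.dom (f j) := by rw [← f.map_smul]; exact hg
    have e : (fun y => ratio ((P.pull f).act g (y := g • y) rfl ((P.pull f).sec i y))
        ((P.pull f).sec j (g • y))) = fun y => ratio (P.act g (y := g • f y) rfl
          (P.sec (f i) (f y))) (P.sec (f j) (g • f y)) := by
      funext y
      exact P.ratio_act_sec g _ _ _ _
    rw [e, dlog_comp (u := fun y => ratio (P.act g (y := g • y) rfl (P.sec (f i) y))
      (P.sec (f j) (g • y))) (P.smooth_act' (f i) (f j) g (f x) hx hg') (f.mdiff x),
      A.invariant (f i) (f j) g (f x) hx hg', ContinuousLinearMap.add_comp]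
    congr 1
    have h1 : mfderiv X.model Y.model (fun y => f (g • y)) x =
        (mfderiv X.model Y.model f (g • x)).comp
          (mfderiv X.model X.model (fun y => g • y) x) :=
      mfderiv_comp x (f.mdiff _) (X.mdiff_smul g x)
    have h2 : mfderiv X.model Y.model (fun y => g • f y) x =
        (mfderiv Y.model Y.model (fun y => g • y) (f x)).comp
          (mfderiv X.model Y.model f x) :=
      mfderiv_comp x (Y.mdiff_smul g _) (f.mdiff x)
    rw [ContinuousLinearMap.comp_assoc, ← h2]
    have h3 : (fun y => f (g • y)) = fun y => g • f y := funext fun y => f.map_smul g y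
    have h4 : ∀ (a b : Y) (F : ∀ y : Y, TangentSpace Y.model y →L[ℝ] ℝ) (hab : a = b)
      (L : TangentSpace X.model x →L[ℝ] EuclideanSpace ℝ (Fin Y.dim)),
        (F a).comp (M₂ := TangentSpace Y.model a) L = (F b).comp (M₂ := TangentSpace Y.model b) L := by
      intro a b F hab L; subst hab; rfl
    rw [ContinuousLinearMap.comp_assoc, ← h1, h3]
    exact h4 _ _ (A.form (f j)) (f.map_smul g x).symm _

/-- The tensor product connection. -/
noncomputable def tensor {P Q : GBundle X} (A : Connection P) (B : Connection Q) :
    Connection (P.tensor Q) where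
  form i x := A.form i x + B.form i x
  smooth i w hw := (A.smooth i w hw.1).add (B.smooth i w hw.2)
  gauge i j x hx := by
    have e : (fun y => ratio ((P.tensor Q).sec i y) ((P.tensor Q).sec j y)) = fun y =>
        ratio (P.sec i y) (P.sec j y) * ratio (Q.sec i y) (Q.sec j y) :=
      funext fun y => ratio_tmul _ _ _ _
    rw [e, dlog_mul (P.smooth_sec i j x ⟨hx.1.1, hx.2.1⟩) (Q.smooth_sec i j x ⟨hx.1.2, hx.2.2⟩),
      A.gauge i j x ⟨hx.1.1, hx.2.1⟩, B.gauge i j x ⟨hx.1.2, hx.2.2⟩]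
    abel
  invariant i j g x hx hg := by
    have e : (fun y => ratio ((P.tensor Q).act g (y := g • y) rfl ((P.tensor Q).sec i y))
        ((P.tensor Q).sec j (g • y))) = fun y =>
        ratio (P.act g (y := g • y) rfl (P.sec i y)) (P.sec j (g • y)) *
        ratio (Q.act g (y := g • y) rfl (Q.sec i y)) (Q.sec j (g • y)) :=
      funext fun y => ratio_tmul _ _ _ _
    rw [e, dlog_mul (P.smooth_act' i j g x hx.1 hg.1) (Q.smooth_act' i j g x hx.2 hg.2),
      A.invariant i j g x hx.1 hg.1, B.invariant i j g x hx.2 hg.2,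
      ContinuousLinearMap.add_comp]
    abel

end Connection
end Bundles

section Isos
variable {X Y Z : GManifold.{v, u} G}

namespace Iso
variable {P Q R : GBundle X}

@[ext] theorem ext {φ ψ : Iso P Q} (h : ∀ x p, φ.toFun x p = ψ.toFun x p) : φ = ψ := by
  cases φ; cases ψ
  congr
  exact funext fun x => funext fun p => h x p

theorem ratio_eq {φ : ∀ x, P.fiber x → Q.fiber x}
    (h : ∀ x (z : Circle) (p : P.fiber x), φ x (z • p) = z • φ x p) (i j i' j' : X) (y : X) :
    ratio (φ y (P.sec i y)) (Q.sec j y) = ratio (P.sec i y) (P.sec i' y) *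
      ratio (φ y (P.sec i' y)) (Q.sec j' y) * ratio (Q.sec j' y) (Q.sec j y) := by
  rw [← ratio_map (h y) (P.sec i y), ratio_mul, ratio_mul]

theorem smooth_of {φ : ∀ x, P.fiber x → Q.fiber x}
    (h : ∀ x (z : Circle) (p : P.fiber x), φ x (z • p) = z • φ x p)
    (h2 : ∀ x, ContMDiffAt X.model (𝓡 1) ∞ (fun y => ratio (φ y (P.sec x y)) (Q.sec x y)) x) :
    ∀ i j, ∀ x ∈ P.dom i ∩ Q.dom j,
      ContMDiffAt X.model (𝓡 1) ∞ (fun y => ratio (φ y (P.sec i y)) (Q.sec j y)) x := by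
  intro i j x hx
  have e : (fun y => ratio (φ y (P.sec i y)) (Q.sec j y)) = _ :=
    funext fun y => ratio_eq h i j x x y
  rw [e]
  exact ((P.smooth_sec i x x ⟨hx.1, P.mem_dom x⟩).mul (h2 x)).mul
    (Q.smooth_sec x j x ⟨Q.mem_dom x, hx.2⟩)

theorem preserves_of (φ : Iso P Q) {A : Connection P} {B : Connection Q}
    (h : ∀ x, A.form x x = B.form x x +
      dlog X.dim (fun y => ratio (φ.toFun y (P.sec x y)) (Q.sec x y)) x) : φ.Preserves A B := by
  intro i j x hx
  have e : (fun y => ratio (φ.toFun y (P.sec i y)) (Q.sec j y)) = _ :=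
    funext fun y => ratio_eq φ.map_smul i j x x y
  have h1 := P.smooth_sec i x x ⟨hx.1, P.mem_dom x⟩
  have h2 := φ.smooth x x x ⟨P.mem_dom x, Q.mem_dom x⟩
  have h3 := Q.smooth_sec x j x ⟨Q.mem_dom x, hx.2⟩
  have h12 : ContMDiffAt X.model (𝓡 1) ∞ (fun y => ratio (P.sec i y) (P.sec x y) *
      ratio (φ.toFun y (P.sec x y)) (Q.sec x y)) x := h1.mul h2
  rw [e, dlog_mul h12 h3, dlog_mul h1 h2, A.gauge i x x ⟨hx.1, P.mem_dom x⟩, h x,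
    B.gauge x j x ⟨Q.mem_dom x, hx.2⟩]
  abel

/-- The identity. -/
def id (P : GBundle X) : Iso P P where
  toFun _ p := p
  map_smul _ _ _ := rfl
  map_act _ _ _ _ _ := rfl
  smooth := P.smooth_sec

theorem id_preserves (A : Connection P) : (Iso.id P).Preserves A A := A.gauge

/-- Composition: first `φ`, then `ψ`. -/
def comp (φ : Iso P Q) (ψ : Iso Q R) : Iso P R where
  toFun x p := ψ.toFun x (φ.toFun x p)
  map_smul x z p := by rw [φ.map_smul, ψ.map_smul]
  map_act g x y h p := by rw [φ.map_act, ψ.map_act]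
  smooth := by
    refine smooth_of (φ := fun x p => ψ.toFun x (φ.toFun x p))
      (fun x z p => by rw [φ.map_smul, ψ.map_smul]) fun x => ?_
    have e : (fun y => ratio (ψ.toFun y (φ.toFun y (P.sec x y))) (R.sec x y)) = fun y =>
        ratio (φ.toFun y (P.sec x y)) (Q.sec x y) * ratio (ψ.toFun y (Q.sec x y)) (R.sec x y) := by
      funext y
      rw [← ratio_map (ψ.map_smul y), ratio_mul]
    rw [e]
    exact (φ.smooth x x x ⟨P.mem_dom x, Q.mem_dom x⟩).mul
      (ψ.smooth x x x ⟨Q.mem_dom x, R.mem_dom x⟩)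

theorem Preserves.comp {φ : Iso P Q} {ψ : Iso Q R} {A : Connection P} {B : Connection Q}
    {C : Connection R} (h1 : φ.Preserves A B) (h2 : ψ.Preserves B C) :
    (φ.comp ψ).Preserves A C := by
  refine preserves_of _ fun x => ?_
  have e : (fun y => ratio ((φ.comp ψ).toFun y (P.sec x y)) (R.sec x y)) = fun y =>
      ratio (φ.toFun y (P.sec x y)) (Q.sec x y) * ratio (ψ.toFun y (Q.sec x y)) (R.sec x y) := by
    funext y
    change ratio (ψ.toFun y (φ.toFun y (P.sec x y))) (R.sec x y) = _
    rw [← ratio_map (ψ.map_smul y), ratio_mul]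
  rw [e, dlog_mul (φ.smooth x x x ⟨P.mem_dom x, Q.mem_dom x⟩)
    (ψ.smooth x x x ⟨Q.mem_dom x, R.mem_dom x⟩), h1 x x x ⟨P.mem_dom x, Q.mem_dom x⟩,
    h2 x x x ⟨Q.mem_dom x, R.mem_dom x⟩]
  abel

theorem injective (φ : Iso P Q) (x : X) : Injective (φ.toFun x) := by
  intro p q h
  have h1 := ratio_map (φ.map_smul x) p q
  rw [h, ratio_self] at h1
  exact ratio_eq_one h1.symm

theorem surjective (φ : Iso P Q) (x : X) : Surjective (φ.toFun x) := by
  intro q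
  obtain ⟨p⟩ := CircleTorsor.nonempty (T := P.fiber x)
  exact ⟨ratio q (φ.toFun x p) • p, by rw [φ.map_smul, ratio_smul]⟩

/-- The inverse. -/
noncomputable def symm (φ : Iso P Q) : Iso Q P where
  toFun x q := (φ.surjective x q).choose
  map_smul x z q := by
    apply φ.injective x
    rw [φ.map_smul, (φ.surjective x _).choose_spec, (φ.surjective x _).choose_spec]
  map_act g x y h q := by
    apply φ.injective y
    rw [φ.map_act, (φ.surjective y _).choose_spec, (φ.surjective x _).choose_spec]
  smooth i j x hx := by
    have e : (fun y => ratio ((φ.surjective y (Q.sec i y)).choose) (P.sec j y)) = fun y =>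
        (ratio (φ.toFun y (P.sec j y)) (Q.sec i y))⁻¹ := by
      funext y
      rw [ratio_inv, ← ratio_map (φ.map_smul y), (φ.surjective y _).choose_spec]
    rw [e]
    exact (φ.smooth j i x hx.symm).inv

theorem apply_symm (φ : Iso P Q) (x : X) (q : Q.fiber x) : φ.toFun x (φ.symm.toFun x q) = q :=
  (φ.surjective x q).choose_spec

theorem Preserves.symm {φ : Iso P Q} {A : Connection P} {B : Connection Q}
    (h : φ.Preserves A B) : φ.symm.Preserves B A := by
  intro i j x hx
  have e : (fun y => ratio (φ.symm.toFun y (Q.sec i y)) (P.sec j y)) = fun y =>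
      (ratio (φ.toFun y (P.sec j y)) (Q.sec i y))⁻¹ := by
    funext y
    rw [ratio_inv, ← ratio_map (φ.map_smul y), φ.apply_symm]
  rw [e, dlog_inv (φ.smooth j i x hx.symm), h j i x hx.symm]
  abel

/-- The pullback of an isomorphism. -/
def pull {P Q : GBundle Y} (φ : Iso P Q) (f : GMap X Y) : Iso (P.pull f) (Q.pull f) where
  toFun x := φ.toFun (f x)
  map_smul x := φ.map_smul (f x)
  map_act g _ _ _ p := φ.map_act g _ p
  smooth i j x hx := (φ.smooth (f i) (f j) (f x) hx).comp x (f.contMDiffAt x)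

theorem Preserves.pull {P Q : GBundle Y} {φ : Iso P Q} {A : Connection P} {B : Connection Q}
    (h : φ.Preserves A B) (f : GMap X Y) : (φ.pull f).Preserves (A.pull f) (B.pull f) := by
  intro i j x hx
  change (A.form (f i) (f x)).comp _ = (B.form (f j) (f x)).comp _ + _
  rw [h (f i) (f j) (f x) hx, ContinuousLinearMap.add_comp]
  congr 1
  exact (dlog_comp (φ.smooth (f i) (f j) (f x) hx) (f.mdiff x)).symm

/-- The canonical isomorphism between the pullbacks along equal maps. -/
def cong (P : GBundle Y) (f g : GMap X Y) (h : ∀ x, f x = g x) : Iso (P.pull f) (P.pull g) where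
  toFun x := P.tr (h x)
  map_smul x := P.tr_smul (h x)
  map_act a x y hxy p := by
    refine (P.tr_act a _ _ (by rw [← f.map_smul, hxy, h]) p).trans ?_
    exact (P.act_tr a _ _ _ p).symm
  smooth i j x hx := by
    obtain rfl : f = g := by
      cases f; cases g; congr; exact funext h
    exact (P.pull f).smooth_sec i j x hx

theorem cong_preserves {P : GBundle Y} (A : Connection P) (f g : GMap X Y) (h : ∀ x, f x = g x) :
    (cong P f g h).Preserves (A.pull f) (A.pull g) := by
  obtain rfl : f = g := by
    cases f; cases g; congr; exact funext h
  exact (A.pull f).gauge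

end Iso

theorem Connection.ext {P : GBundle X} {A B : Connection P} (h : ∀ i x, A.form i x = B.form i x) :
    A = B := by
  cases A; cases B
  congr
  exact funext fun i => funext fun x => h i x

theorem Connection.pull_pull {P : GBundle Z} (A : Connection P) (f : GMap X Y) (g : GMap Y Z) :
    (A.pull g).pull f = A.pull (f.comp g) := by
  refine Connection.ext fun i x => ?_
  change ((A.form _ _).comp _).comp _ = (A.form _ _).comp _
  rw [ContinuousLinearMap.comp_assoc]
  congr 1
  exact (mfderiv_comp x (g.mdiff _) (f.mdiff x)).symm

theorem Connection.pull_tensor {P Q : GBundle Y} (A : Connection P) (B : Connection Q)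
    (f : GMap X Y) : (A.tensor B).pull f = (A.pull f).tensor (B.pull f) :=
  Connection.ext fun _ _ => ContinuousLinearMap.add_comp _ _ _

/-- A smooth invariant section of an equivariant circle bundle. -/
structure Sect (P : GBundle X) where
  toFun : ∀ x, P.fiber x
  act : ∀ (g : G) {x y : X} (h : g • x = y), P.act g h (toFun x) = toFun y
  smooth : ∀ x, ContMDiffAt X.model (𝓡 1) ∞ (fun y => ratio (toFun y) (P.sec x y)) x

namespace Sect
variable {P Q : GBundle X}

/-- The section is flat. -/
def Flat (e : Sect P) (A : Connection P) : Prop :=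
  ∀ x, A.form x x + dlog X.dim (fun y => ratio (e.toFun y) (P.sec x y)) x = 0

/-- The pullback of a section. -/
def pull {P : GBundle Y} (e : Sect P) (f : GMap X Y) : Sect (P.pull f) where
  toFun x := e.toFun (f x)
  act g _ _ _ := e.act g _
  smooth x := (e.smooth (f x)).comp x (f.contMDiffAt x)

theorem Flat.pull {P : GBundle Y} {e : Sect P} {A : Connection P} (h : e.Flat A) (f : GMap X Y) :
    (e.pull f).Flat (A.pull f) := by
  intro x
  have h1 : dlog X.dim (fun y => ratio ((e.pull f).toFun y) ((P.pull f).sec x y)) x = _ :=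
    dlog_comp (e.smooth (f x)) (f.mdiff x)
  rw [h1]
  change (A.form (f x) (f x)).comp _ + _ = _
  rw [← ContinuousLinearMap.add_comp, h (f x), ContinuousLinearMap.zero_comp]

/-- The image of a section under an isomorphism. -/
def map (e : Sect P) (φ : Iso P Q) : Sect Q where
  toFun x := φ.toFun x (e.toFun x)
  act g x y h := by rw [← φ.map_act, e.act]
  smooth x := by
    have e1 : (fun y => ratio (φ.toFun y (e.toFun y)) (Q.sec x y)) = fun y =>
        ratio (e.toFun y) (P.sec x y) * ratio (φ.toFun y (P.sec x y)) (Q.sec x y) := by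
      funext y
      rw [← ratio_map (φ.map_smul y), ratio_mul]
    rw [e1]
    exact (e.smooth x).mul (φ.smooth x x x ⟨P.mem_dom x, Q.mem_dom x⟩)

theorem Flat.map {e : Sect P} {φ : Iso P Q} {A : Connection P} {B : Connection Q} (h : e.Flat A)
    (h2 : φ.Preserves A B) : (e.map φ).Flat B := by
  intro x
  have e1 : (fun y => ratio ((e.map φ).toFun y) (Q.sec x y)) = fun y =>
      ratio (e.toFun y) (P.sec x y) * ratio (φ.toFun y (P.sec x y)) (Q.sec x y) := by
    funext y
    rw [← ratio_map (φ.map_smul y), ratio_mul]; rfl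
  rw [e1, dlog_mul (e.smooth x) (φ.smooth x x x ⟨P.mem_dom x, Q.mem_dom x⟩), ← h x,
    h2 x x x ⟨P.mem_dom x, Q.mem_dom x⟩]
  abel

/-- Tensoring with a section on the left. -/
def tmulLeft (e : Sect P) (Q : GBundle X) : Iso Q (P.tensor Q) where
  toFun x q := tmul (e.toFun x) q
  map_smul x z q := tmul_smul z _ _
  map_act g x y h q := by
    change _ = tmul (P.act g h (e.toFun x)) (Q.act g h q)
    rw [e.act]
  smooth := by
    refine Iso.smooth_of (Q := P.tensor Q) (φ := fun x q => tmul (e.toFun x) q)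
      (fun x z q => tmul_smul z _ _) fun x => ?_
    exact ((e.smooth x).mul
      (Q.smooth_sec x x x ⟨Q.mem_dom x, Q.mem_dom x⟩)).congr_of_eventuallyEq
      (Filter.Eventually.of_forall fun y => ratio_tmul _ _ _ _)

/-- Tensoring with a section on the right. -/
def tmulRight (e : Sect P) (Q : GBundle X) : Iso Q (Q.tensor P) where
  toFun x q := tmul q (e.toFun x)
  map_smul _ _ _ := rfl
  map_act g x y h q := by
    change _ = tmul (Q.act g h q) (P.act g h (e.toFun x))
    rw [e.act]
  smooth := by
    refine Iso.smooth_of (Q := Q.tensor P) (φ := fun x q => tmul q (e.toFun x))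
      (fun x z q => rfl) fun x => ?_
    exact ((Q.smooth_sec x x x ⟨Q.mem_dom x, Q.mem_dom x⟩).mul
      (e.smooth x)).congr_of_eventuallyEq
      (Filter.Eventually.of_forall fun y => ratio_tmul _ _ _ _)

theorem Flat.tmulLeft {e : Sect P} {A : Connection P} (h : e.Flat A) (B : Connection Q) :
    (e.tmulLeft Q).Preserves B (A.tensor B) := by
  refine Iso.preserves_of _ fun x => ?_
  have e1 : (fun y => ratio ((e.tmulLeft Q).toFun y (Q.sec x y)) ((P.tensor Q).sec x y)) =
      fun y => ratio (e.toFun y) (P.sec x y) := by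
    funext y
    refine (ratio_tmul _ _ _ _).trans ?_
    rw [ratio_self, mul_one]
  rw [e1]
  change _ = A.form x x + B.form x x + _
  rw [add_right_comm, h x, zero_add]

theorem Flat.tmulRight {e : Sect P} {A : Connection P} (h : e.Flat A) (B : Connection Q) :
    (e.tmulRight Q).Preserves B (B.tensor A) := by
  refine Iso.preserves_of _ fun x => ?_
  have e1 : (fun y => ratio ((e.tmulRight Q).toFun y (Q.sec x y)) ((Q.tensor P).sec x y)) =
      fun y => ratio (e.toFun y) (P.sec x y) := by
    funext y
    refine (ratio_tmul _ _ _ _).trans ?_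
    rw [ratio_self, one_mul]
  rw [e1]
  change _ = B.form x x + A.form x x + _
  rw [add_assoc, h x, add_zero]

end Sect
end Isos

section Forms
variable {X Y : GManifold.{v, u} G}

/-- The data of an element of degree two of the Cartan complex `(S(𝔤^*) ⊗ Ω(X))^G`: a bilinear
form on each tangent space, and a linear map `𝔤 → ℝ` at each point (no conditions imposed). -/
@[ext] structure Form2 (X : GManifold.{v, u} G) where
  form : ∀ x : X, TangentSpace X.model x →L[ℝ] TangentSpace X.model x →L[ℝ] ℝ
  moment : X → G.lie →L[ℝ] ℝ

/-- The bilinear form `(v, w) ↦ B (T v, T w)`. -/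
noncomputable def pullBilin {n m : ℕ}
    (B : EuclideanSpace ℝ (Fin m) →L[ℝ] EuclideanSpace ℝ (Fin m) →L[ℝ] ℝ)
    (T : EuclideanSpace ℝ (Fin n) →L[ℝ] EuclideanSpace ℝ (Fin m)) :
    EuclideanSpace ℝ (Fin n) →L[ℝ] EuclideanSpace ℝ (Fin n) →L[ℝ] ℝ :=
  B.bilinearComp T T

namespace Form2
noncomputable instance : Sub (Form2 X) :=
  ⟨fun A B => ⟨fun x => A.form x - B.form x, fun x => A.moment x - B.moment x⟩⟩

/-- The pullback along an equivariant map. -/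
noncomputable def pull (B : Form2 Y) (f : GMap X Y) : Form2 X where
  form x := pullBilin (B.form (f x)) (mfderiv X.model Y.model f x)
  moment x := B.moment (f x)
end Form2

/-- An equivariant `2`-form on `X` in the Cartan model, `Ω²_G(X) = Ω²(X)^G ⊕ (𝔤^* ⊗ C^∞(X))^G`:
an invariant smooth `2`-form and an equivariant smooth map `X → 𝔤^*`. -/
structure EquivForm2 (X : GManifold.{v, u} G) extends Form2 X where
  alternating : ∀ x v, form x v v = 0
  smooth_form : ContMDiff X.model (X.model.prod 𝓘(ℝ, EuclideanSpace ℝ (Fin X.dim) →L[ℝ]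
    EuclideanSpace ℝ (Fin X.dim) →L[ℝ] ℝ)) ∞
    (fun x => Bundle.TotalSpace.mk' (EuclideanSpace ℝ (Fin X.dim) →L[ℝ]
      EuclideanSpace ℝ (Fin X.dim) →L[ℝ] ℝ)
      (E := fun x => TangentSpace X.model x →L[ℝ] TangentSpace X.model x →L[ℝ] ℝ) x (form x))
  invariant_form : ∀ (g : G) x v w, form x v w =
    form (g • x) (mfderiv X.model X.model (fun y => g • y) x v)
      (mfderiv X.model X.model (fun y => g • y) x w)
  smooth_moment : ∀ ξ : G.lie, ContMDiff X.model 𝓘(ℝ, ℝ) ∞ (fun x => moment x ξ)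
  equivariant_moment : ∀ (g : G) x ξ, moment (g • x) (G.Ad g ξ) = moment x ξ

/-- The exterior derivative at `x` of a `1`-form, computed in the preferred chart at `x` (whose
derivative at `x` is the identity, by the definition of the tangent space in Mathlib):
`dA (v, w) = ∂_v A w - ∂_w A v`. -/
noncomputable def extDeriv1 {n : ℕ} {N : Type*} [TopologicalSpace N]
    [ChartedSpace (EuclideanSpace ℝ (Fin n)) N] (A : ∀ y : N, TangentSpace (𝓡 n) y →L[ℝ] ℝ)
    (x : N) : TangentSpace (𝓡 n) x →L[ℝ] TangentSpace (𝓡 n) x →L[ℝ] ℝ :=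
  let D : EuclideanSpace ℝ (Fin n) →L[ℝ] EuclideanSpace ℝ (Fin n) →L[ℝ] ℝ :=
    fderiv ℝ (fun e : EuclideanSpace ℝ (Fin n) =>
      ((A ((extChartAt (𝓡 n) x).symm e)).comp
        (mfderiv 𝓘(ℝ, EuclideanSpace ℝ (Fin n)) (𝓡 n) (extChartAt (𝓡 n) x).symm e) :
        EuclideanSpace ℝ (Fin n) →L[ℝ] ℝ)) (extChartAt (𝓡 n) x x)
  D - D.flip

/-- The equivariant curvature `d_G Θ = (d - ι) Θ` of an invariant connection `Θ`, descended to the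
base.  Its component in `Ω²` is the exterior derivative of the local connection forms.  Its
component in `𝔤^* ⊗ C^∞` sends `ξ` to minus the value of `Θ` on the vector field generated by `ξ`
on the total space; at the point `sec x x` this vector is the derivative at `1` in direction `ξ` of
`g ↦ g • sec x x = u g • sec x (g • x)`, with `u g` the ratio below. -/
noncomputable def Connection.curv {P : GBundle X} (A : Connection P) : Form2 X where
  form x := extDeriv1 (A.form x) x
  moment x := -((A.form x x).comp (X.fundamental x) +
    dlog G.dim (fun g : G => ratio (P.act g (y := g • x) rfl (P.sec x x)) (P.sec x (g • x))) 1)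

end Forms

section Gerbes
variable {M : GManifold.{v, u} G}

section Cover
variable {Y : GManifold.{v, u} G} (π : GMap Y M) (h : IsGCover π)

/-- The fiber product `Y^[2] = Y ×_M Y`. -/
noncomputable abbrev sq : GManifold.{v, u} G := fiberProd π π h

/-- The fiber product `Y^[3]`, with points written `(a, (b, c))`. -/
noncomputable abbrev cube : GManifold.{v, u} G :=
  fiberProd π ((fiberProd.fst π π h).comp π) h

/-- The projection `π₁₂ : Y^[3] → Y^[2]`. -/
noncomputable def proj12 : GMap (cube π h) (sq π h) :=
  fiberProd.lift h (fiberProd.fst _ _ h) ((fiberProd.snd _ _ h).comp (fiberProd.fst _ _ h))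
    fun p => fiberProd.condition p

/-- The projection `π₂₃ : Y^[3] → Y^[2]`. -/
noncomputable def proj23 : GMap (cube π h) (sq π h) := fiberProd.snd _ _ h

/-- The projection `π₁₃ : Y^[3] → Y^[2]`. -/
noncomputable def proj13 : GMap (cube π h) (sq π h) :=
  fiberProd.lift h (fiberProd.fst _ _ h) ((fiberProd.snd _ _ h).comp (fiberProd.snd _ _ h))
    fun p => (fiberProd.condition p).trans (fiberProd.condition (fiberProd.snd _ _ h p))

variable {π h}

/-- The multiplication on points: `μ (l ⊗ l')` for `l` over `(a, b)` and `l'` over `(b, c)`. -/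
noncomputable def mulAt {L : GBundle (sq π h)}
    (μ : Iso ((L.pull (proj12 π h)).tensor (L.pull (proj23 π h))) (L.pull (proj13 π h)))
    {a b c : Y} (hab : π a = π b) (hbc : π b = π c) (l : L.fiber (fiberProd.mk h a b hab))
    (l' : L.fiber (fiberProd.mk h b c hbc)) : L.fiber (fiberProd.mk h a c (hab.trans hbc)) :=
  μ.toFun (fiberProd.mk h a (fiberProd.mk h b c hbc) hab) (tmul (T := L.fiber _) (S := L.fiber _) l l')
end Cover

/-- A `G`-equivariant bundle gerbe on `M`: a `G`-cover `π : Y → M`, an equivariant circle bundle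
`L` on `Y^[2]`, and a multiplication `μ : π₁₂^* L ⊗ π₂₃^* L → π₁₃^* L` which is associative over
`Y^[4]`. -/
structure Gerbe (M : GManifold.{v, u} G) where
  Y : GManifold.{v, u} G
  π : GMap Y M
  cover : IsGCover π
  L : GBundle (sq π cover)
  μ : Iso ((L.pull (proj12 π cover)).tensor (L.pull (proj23 π cover))) (L.pull (proj13 π cover))
  assoc : ∀ {a b c d : Y} (hab : π a = π b) (hbc : π b = π c) (hcd : π c = π d)
    (l : L.fiber (fiberProd.mk cover a b hab)) (l' : L.fiber (fiberProd.mk cover b c hbc))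
    (l'' : L.fiber (fiberProd.mk cover c d hcd)),
    mulAt μ (hab.trans hbc) hcd (mulAt μ hab hbc l l') l'' =
      mulAt μ hab (hbc.trans hcd) l (mulAt μ hbc hcd l' l'')

namespace Gerbe

/-- The fiber of `L` over `(a, b)`. -/
noncomputable abbrev fib (L : Gerbe M) {a b : L.Y} (h : L.π a = L.π b) : Type u :=
  L.L.fiber (fiberProd.mk L.cover a b h)

/-- The fiber of `L` over a pair of points depends only on the points. -/
noncomputable def cast (L : Gerbe M) {a b a' b' : L.Y} (ha : a = a') (hb : b = b') (h : L.π a = L.π b)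
    (h' : L.π a' = L.π b') : L.fib h → L.fib h' :=
  L.L.tr (by subst ha hb; rfl)

/-- The fiber product `Y₁ ×_M Y₂` of the covers of two gerbes. -/
noncomputable abbrev prod (L₁ L₂ : Gerbe M) : GManifold.{v, u} G :=
  fiberProd L₁.π L₂.π L₁.cover

variable (L₁ L₂ : Gerbe M) {Z : GManifold.{v, u} G} (ζ : GMap Z (L₁.prod L₂))

/-- The map `Z → Y₁`. -/
noncomputable def fst : GMap Z L₁.Y := ζ.comp (fiberProd.fst _ _ L₁.cover)

/-- The map `Z → Y₂`. -/
noncomputable def snd : GMap Z L₂.Y := ζ.comp (fiberProd.snd _ _ L₁.cover)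

/-- The map `Z → M`. -/
noncomputable def base : GMap Z M := (fst L₁ L₂ ζ).comp L₁.π

theorem base_eq (z : Z) : base L₁ L₂ ζ z = L₂.π (snd L₁ L₂ ζ z) := fiberProd.condition (ζ z)

theorem base_cover (hζ : IsGCover ζ) : IsGCover (base L₁ L₂ ζ) :=
  (hζ.comp (fiberProd.isGCover_fst _ _ L₁.cover L₂.cover)).comp L₁.cover

/-- The map `Z ×_M Z → Y₁^[2]`. -/
noncomputable def fstSq (hζ : IsGCover ζ) :
    GMap (sq (base L₁ L₂ ζ) (base_cover L₁ L₂ ζ hζ)) (sq L₁.π L₁.cover) :=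
  fiberProd.lift L₁.cover ((fiberProd.fst _ _ _).comp (fst L₁ L₂ ζ))
    ((fiberProd.snd _ _ _).comp (fst L₁ L₂ ζ)) fun p => fiberProd.condition p

theorem snd_eq {z z' : Z} (h : base L₁ L₂ ζ z = base L₁ L₂ ζ z') :
    L₂.π (snd L₁ L₂ ζ z) = L₂.π (snd L₁ L₂ ζ z') :=
  (base_eq L₁ L₂ ζ z).symm.trans (h.trans (base_eq L₁ L₂ ζ z'))

/-- The map `Z ×_M Z → Y₂^[2]`. -/
noncomputable def sndSq (hζ : IsGCover ζ) :
    GMap (sq (base L₁ L₂ ζ) (base_cover L₁ L₂ ζ hζ)) (sq L₂.π L₂.cover) :=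
  fiberProd.lift L₂.cover ((fiberProd.fst _ _ _).comp (snd L₁ L₂ ζ))
    ((fiberProd.snd _ _ _).comp (snd L₁ L₂ ζ)) fun p =>
      snd_eq L₁ L₂ ζ (fiberProd.condition p)

end Gerbe

/-- For `K` on `Z` and `α : L₁ ⊗ ζ₂^* K → ζ₁^* K ⊗ L₂` on `Z ×_M Z`, the statement
`α (l ⊗ k') = k ⊗ m` over the point `(z, z')`. -/
def AlphaRel {L₁ L₂ : Gerbe M} {Z : GManifold.{v, u} G} {ζ : GMap Z (L₁.prod L₂)}
    {hζ : IsGCover ζ} {K : GBundle Z}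
    (α : Iso ((L₁.L.pull (Gerbe.fstSq L₁ L₂ ζ hζ)).tensor (K.pull (fiberProd.snd _ _ _)))
      ((K.pull (fiberProd.fst _ _ _)).tensor (L₂.L.pull (Gerbe.sndSq L₁ L₂ ζ hζ))))
    {z z' : Z} (h : Gerbe.base L₁ L₂ ζ z = Gerbe.base L₁ L₂ ζ z') 
    (l : L₁.fib (a := Gerbe.fst L₁ L₂ ζ z) (b := Gerbe.fst L₁ L₂ ζ z') h)
    (k' : K.fiber z') (k : K.fiber z)
    (m : L₂.fib (a := Gerbe.snd L₁ L₂ ζ z) (b := Gerbe.snd L₁ L₂ ζ z')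
      (Gerbe.snd_eq L₁ L₂ ζ h)) : Prop :=
  α.toFun (fiberProd.mk (Gerbe.base_cover L₁ L₂ ζ hζ) z z' h)
    (tmul (T := L₁.L.fiber _) (S := K.fiber z') l k') =
    tmul (T := K.fiber z) (S := L₂.L.fiber _) k m

/-- The data `(K, α)` of an isomorphism of gerbes on a given `G`-cover `ζ : Z → Y₁ ×_M Y₂`: an
equivariant circle bundle `K` on `Z` and an isomorphism `α : L₁ ⊗ ζ₂^* K → ζ₁^* K ⊗ L₂` over
`Z ×_M Z`, compatible with the multiplications.  The compatibility
`α₁₃ ∘ (μ₁ ⊗ id) = (id ⊗ μ₂) ∘ (α₁₂ ⊗ id) ∘ (id ⊗ α₂₃)` over `Z ×_M Z ×_M Z` is spelled out on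
elements `l ⊗ l' ⊗ k₃`, with `α₂₃ (l' ⊗ k₃) = k₂ ⊗ m'` and `α₁₂ (l ⊗ k₂) = k₁ ⊗ m`. -/
structure IsoData (L₁ L₂ : Gerbe M) {Z : GManifold.{v, u} G} (ζ : GMap Z (L₁.prod L₂))
    (hζ : IsGCover ζ) where
  K : GBundle Z
  α : Iso ((L₁.L.pull (Gerbe.fstSq L₁ L₂ ζ hζ)).tensor (K.pull (fiberProd.snd _ _ _)))
    ((K.pull (fiberProd.fst _ _ _)).tensor (L₂.L.pull (Gerbe.sndSq L₁ L₂ ζ hζ)))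
  compat : ∀ {z₁ z₂ z₃ : Z} (h : Gerbe.base L₁ L₂ ζ z₁ = Gerbe.base L₁ L₂ ζ z₂)
    (h' : Gerbe.base L₁ L₂ ζ z₂ = Gerbe.base L₁ L₂ ζ z₃) l l' k₃ k₂ k₁ m m',
    AlphaRel α h' l' k₃ k₂ m' → AlphaRel α h l k₂ k₁ m →
      AlphaRel α (h.trans h')
        (mulAt L₁.μ (a := Gerbe.fst L₁ L₂ ζ z₁) (b := Gerbe.fst L₁ L₂ ζ z₂)
          (c := Gerbe.fst L₁ L₂ ζ z₃) h h' l l') k₃ k₁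
        (mulAt L₂.μ (a := Gerbe.snd L₁ L₂ ζ z₁) (b := Gerbe.snd L₁ L₂ ζ z₂)
          (c := Gerbe.snd L₁ L₂ ζ z₃) (Gerbe.snd_eq L₁ L₂ ζ h) (Gerbe.snd_eq L₁ L₂ ζ h') m m')

/-- A `1`-morphism (isomorphism) `L₁ → L₂` of equivariant bundle gerbes. -/
structure GerbeHom (L₁ L₂ : Gerbe M) where
  Z : GManifold.{v, u} G
  ζ : GMap Z (L₁.prod L₂)
  cover : IsGCover ζ
  data : IsoData L₁ L₂ ζ cover

/-- A fiber product (stable) isomorphism `L₁ → L₂`: the `G`-cover is the identity of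
`Y₁ ×_M Y₂`. -/
structure FPHom (L₁ L₂ : Gerbe M) where
  data : IsoData L₁ L₂ (GMap.id (L₁.prod L₂)) (IsGCover.id _)

/-- A fiber product isomorphism is in particular a `1`-morphism. -/
noncomputable def FPHom.toHom {L₁ L₂ : Gerbe M} (K : FPHom L₁ L₂) : GerbeHom L₁ L₂ :=
  ⟨_, _, _, K.data⟩

end Gerbes

section Units
variable {M : GManifold.{v, u} G}

namespace Gerbe
variable (L : Gerbe M)

theorem mulAt_smul_left {a b c : L.Y} (hab : L.π a = L.π b) (hbc : L.π b = L.π c) (z : Circle)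
    (l : L.fib hab) (l' : L.fib hbc) :
    mulAt L.μ hab hbc (z • l) l' = z • mulAt L.μ hab hbc l l' :=
  L.μ.map_smul (fiberProd.mk L.cover a (fiberProd.mk L.cover b c hbc) hab) z (tmul (T := L.fib hab) (S := L.fib hbc) l l')

theorem mulAt_smul_right {a b c : L.Y} (hab : L.π a = L.π b) (hbc : L.π b = L.π c) (z : Circle)
    (l : L.fib hab) (l' : L.fib hbc) :
    mulAt L.μ hab hbc l (z • l') = z • mulAt L.μ hab hbc l l' := by
  rw [← mulAt_smul_left]
  exact congrArg (L.μ.toFun _) (smul_tmul_comm (T := L.fib hab) (S := L.fib hbc) z l l').symm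

theorem mulAt_left_cancel {a b c : L.Y} (hab : L.π a = L.π b) (hbc : L.π b = L.π c)
    {l : L.fib hab} {l' l'' : L.fib hbc} (h : mulAt L.μ hab hbc l l' = mulAt L.μ hab hbc l l'') :
    l' = l'' :=
  tmul_left_cancel (T := L.fib hab) (S := L.fib hbc) (L.μ.injective _ h)

theorem mulAt_right_cancel {a b c : L.Y} (hab : L.π a = L.π b) (hbc : L.π b = L.π c)
    {l l' : L.fib hab} {l'' : L.fib hbc} (h : mulAt L.μ hab hbc l l'' = mulAt L.μ hab hbc l' l'') :
    l = l' :=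
  tmul_right_cancel (T := L.fib hab) (S := L.fib hbc) (L.μ.injective _ h)

/-- The unit of the multiplication over `(a, a)`. -/
theorem existsUnique_unit (a : L.Y) :
    ∃! e : L.fib (rfl : L.π a = L.π a), mulAt L.μ rfl rfl e e = e := by
  obtain ⟨l⟩ := CircleTorsor.nonempty (T := L.fib (rfl : L.π a = L.π a))
  have key : ∀ z : Circle, mulAt L.μ rfl rfl (z • l) (z • l) = z • l ↔
      z = ratio l (mulAt L.μ rfl rfl l l) := by
    intro z
    rw [mulAt_smul_left, mulAt_smul_right]
    constructor
    · intro h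
      have h1 : z • mulAt L.μ rfl rfl l l = l := by
        have := congrArg (fun t => z⁻¹ • t) h
        simpa only [inv_smul_smul] using this
      exact (ratio_unique h1).symm
    · rintro rfl
      rw [ratio_smul]
  refine ⟨ratio l (mulAt L.μ rfl rfl l l) • l, (key _).2 rfl, fun e he => ?_⟩
  have h2 := (key (ratio e l)).1 (by rw [ratio_smul]; exact he)
  rw [← h2, ratio_smul]

/-- The unit of the multiplication over `(a, a)`. -/
noncomputable def unit₀ (a : L.Y) : L.fib (rfl : L.π a = L.π a) := (L.existsUnique_unit a).choose

theorem unit₀_mul_self (a : L.Y) : mulAt L.μ rfl rfl (L.unit₀ a) (L.unit₀ a) = L.unit₀ a :=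
  (L.existsUnique_unit a).choose_spec.1

theorem eq_unit₀ {a : L.Y} {e : L.fib (rfl : L.π a = L.π a)} (h : mulAt L.μ rfl rfl e e = e) :
    e = L.unit₀ a :=
  (L.existsUnique_unit a).choose_spec.2 e h

theorem unit₀_mul {a b : L.Y} (h : L.π a = L.π b) (l : L.fib h) :
    mulAt L.μ rfl h (L.unit₀ a) l = l := by
  have h1 := L.assoc rfl rfl h (L.unit₀ a) (L.unit₀ a) l
  rw [L.unit₀_mul_self] at h1
  exact (L.mulAt_left_cancel rfl h h1).symm

theorem mul_unit₀ {a b : L.Y} (h : L.π a = L.π b) (l : L.fib h) :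
    mulAt L.μ h rfl l (L.unit₀ b) = l := by
  have h1 := L.assoc h rfl rfl l (L.unit₀ b) (L.unit₀ b)
  rw [L.unit₀_mul_self] at h1
  exact L.mulAt_right_cancel h rfl h1

/-- The unit over `(a, b)` with `a = b`. -/
noncomputable def unit {a b : L.Y} (h : a = b) (hab : L.π a = L.π b) : L.fib hab :=
  L.cast rfl h rfl hab (L.unit₀ a)

theorem cast_rfl {a b : L.Y} (h : L.π a = L.π b) (l : L.fib h) : L.cast rfl rfl h h l = l := rfl

theorem cast_unit {a b a' b' : L.Y} (ha : a = a') (hb : b = b') (h : a = b) (h' : L.π a = L.π b)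
    (h'' : L.π a' = L.π b') :
    L.cast ha hb h' h'' (L.unit h h') = L.unit (by rw [← ha, ← hb, h]) h'' := by
  subst ha hb h; rfl

theorem unit_mul {a b c : L.Y} (h : a = b) (hab : L.π a = L.π b) (hbc : L.π b = L.π c)
    (l : L.fib hbc) :
    mulAt L.μ hab hbc (L.unit h hab) l = L.cast h.symm rfl hbc (hab.trans hbc) l := by
  subst h; exact L.unit₀_mul hbc l

theorem mul_unit {a b c : L.Y} (h : b = c) (hab : L.π a = L.π b) (hbc : L.π b = L.π c)
    (l : L.fib hab) :
    mulAt L.μ hab hbc l (L.unit h hbc) = L.cast rfl h hab (hab.trans hbc) l := by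
  subst h; exact L.mul_unit₀ hab l

theorem cast_cast {a b a' b' a'' b'' : L.Y} (ha : a = a') (hb : b = b') (ha' : a' = a'')
    (hb' : b' = b'') (h : L.π a = L.π b) (h' : L.π a' = L.π b') (h'' : L.π a'' = L.π b'')
    (l : L.fib h) : L.cast ha' hb' h' h'' (L.cast ha hb h h' l) =
      L.cast (ha.trans ha') (hb.trans hb') h h'' l := by
  subst ha hb ha' hb'; rfl

/-- The diagonal `Y → Y^[2]`. -/
noncomputable def diag : GMap L.Y (sq L.π L.cover) :=
  fiberProd.lift L.cover (GMap.id _) (GMap.id _) fun _ => rfl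

/-- The diagonal `Y → Y^[3]`. -/
noncomputable def diag3 : GMap L.Y (cube L.π L.cover) :=
  fiberProd.lift L.cover (GMap.id _) L.diag fun _ => rfl

theorem unit₀_ratio (y a : L.Y) :
    ratio (L.unit₀ y) ((L.L.pull L.diag).sec a y) =
      (ratio ((L.μ.pull L.diag3).toFun y (tmul (T := (L.L.pull L.diag).fiber y)
        (S := (L.L.pull L.diag).fiber y) ((L.L.pull L.diag).sec a y)
        ((L.L.pull L.diag).sec a y))) ((L.L.pull L.diag).sec a y))⁻¹ := by
  set s : L.fib (rfl : L.π y = L.π y) := (L.L.pull L.diag).sec a y with hs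
  change ratio (L.unit₀ y) s = (ratio (mulAt L.μ rfl rfl s s) s)⁻¹
  rw [ratio_inv]
  apply ratio_unique
  apply L.eq_unit₀
  rw [L.mulAt_smul_left, L.mulAt_smul_right, ratio_smul]

/-- The units form a smooth invariant section of `L` along the diagonal. -/
noncomputable def unitSect : Sect (L.L.pull L.diag) where
  toFun y := L.unit₀ y
  act g x y h := by
    subst h
    apply L.eq_unit₀
    have h1 := (L.μ.pull L.diag3).map_act g (x := x) rfl (tmul (T := (L.L.pull L.diag).fiber x)
        (S := (L.L.pull L.diag).fiber x) (L.unit₀ x) (L.unit₀ x))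
    refine Eq.trans h1 ?_
    exact congrArg ((L.L.pull L.diag).act g (x := x) rfl) (L.unit₀_mul_self x)
  smooth x := by
    have e : (fun y => ratio (T := (L.L.pull L.diag).fiber y) (L.unit₀ y)
      ((L.L.pull L.diag).sec x y)) = _ := funext fun y => L.unit₀_ratio y x
    rw [e]
    exact ((L.μ.pull L.diag3).smooth x x x ⟨((L.L.pull (proj12 L.π L.cover)).tensor
      (L.L.pull (proj23 L.π L.cover))).mem_dom _, (L.L.pull (proj13 L.π L.cover)).mem_dom _⟩).inv

theorem unitSect_flat (A : Connection L.L)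
    (h : L.μ.Preserves ((A.pull (proj12 L.π L.cover)).tensor (A.pull (proj23 L.π L.cover)))
      (A.pull (proj13 L.π L.cover))) : L.unitSect.Flat (A.pull L.diag) := by
  intro x
  have e : (fun y => ratio (T := (L.L.pull L.diag).fiber y) (L.unitSect.toFun y)
      ((L.L.pull L.diag).sec x y)) = _ := funext fun y => L.unit₀_ratio y x
  have hd : x ∈ (((L.L.pull (proj12 L.π L.cover)).tensor
      (L.L.pull (proj23 L.π L.cover))).pull L.diag3).dom x ∩
        ((L.L.pull (proj13 L.π L.cover)).pull L.diag3).dom x :=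
    ⟨GBundle.mem_dom _ _, GBundle.mem_dom _ _⟩
  have h1 := h.pull L.diag3 x x x hd
  rw [Connection.pull_tensor, Connection.pull_pull, Connection.pull_pull,
    Connection.pull_pull] at h1
  have h2 : (A.pull L.diag).form x x + (A.pull L.diag).form x x = (A.pull L.diag).form x x + _ := h1
  have h3 := add_left_cancel h2
  have h4 := (L.μ.pull L.diag3).smooth x x x hd
  rw [e]
  refine Eq.trans (congrArg₂ (· + ·) h3 (dlog_inv h4)) ?_
  exact add_neg_cancel _

end Gerbe
end Units

section Descent
variable {M : GManifold.{v, u} G} {L₁ L₂ : Gerbe M} {Z : GManifold.{v, u} G}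
  {ζ : GMap Z (L₁.prod L₂)} {hζ : IsGCover ζ}

namespace IsoData
open Gerbe (fst snd base base_cover fstSq sndSq snd_eq)
variable (D : IsoData L₁ L₂ ζ hζ) {z z' : Z} {h : base L₁ L₂ ζ z = base L₁ L₂ ζ z'}
  {l : L₁.fib (a := fst L₁ L₂ ζ z) (b := fst L₁ L₂ ζ z') h}
  {m : L₂.fib (a := snd L₁ L₂ ζ z) (b := snd L₁ L₂ ζ z') (snd_eq L₁ L₂ ζ h)}
  {k' k'' : D.K.fiber z'} {k k₂ : D.K.fiber z}

theorem rel_exists (h : base L₁ L₂ ζ z = base L₁ L₂ ζ z')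
    (l : L₁.fib (a := fst L₁ L₂ ζ z) (b := fst L₁ L₂ ζ z') h) (k' : D.K.fiber z') :
    ∃ k m, AlphaRel D.α h l k' k m := by
  obtain ⟨k, m, e⟩ := tmul_surj (T := D.K.fiber z) (S := L₂.fib (snd_eq L₁ L₂ ζ h))
    (D.α.toFun (fiberProd.mk (base_cover L₁ L₂ ζ hζ) z z' h)
      (tmul (T := L₁.fib _) (S := D.K.fiber z') l k'))
  exact ⟨k, m, e.symm⟩

theorem rel_unique (h1 : AlphaRel D.α h l k' k m) (h2 : AlphaRel D.α h l k' k₂ m) : k = k₂ :=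
  tmul_right_cancel (T := D.K.fiber z) (S := L₂.fib (snd_eq L₁ L₂ ζ h)) (h1.symm.trans h2)

theorem rel_unique' (h1 : AlphaRel D.α h l k' k m) (h2 : AlphaRel D.α h l k'' k m) : k' = k'' :=
  tmul_left_cancel (T := L₁.fib h) (S := D.K.fiber z')
    (D.α.injective (fiberProd.mk (base_cover L₁ L₂ ζ hζ) z z' h) (h1.trans h2.symm))

theorem rel_congr {l₂ : L₁.fib (a := fst L₁ L₂ ζ z) (b := fst L₁ L₂ ζ z') h}
    {m₂ : L₂.fib (a := snd L₁ L₂ ζ z) (b := snd L₁ L₂ ζ z') (snd_eq L₁ L₂ ζ h)}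
    (hl : l = l₂) (hm : m = m₂) (hr : AlphaRel D.α h l k' k m) : AlphaRel D.α h l₂ k' k m₂ := by
  subst hl hm; exact hr

variable (ζ hζ) in
/-- The map `(z, z') ↦ (z', z)` from `Z ×_{Y₁ ×_M Y₂} Z` to `Z ×_M Z`. -/
noncomputable def swap : GMap (fiberProd ζ ζ hζ) (sq (base L₁ L₂ ζ) (base_cover L₁ L₂ ζ hζ)) :=
  fiberProd.lift _ (fiberProd.snd _ _ _) (fiberProd.fst _ _ _) fun q =>
    congrArg (fun p => L₁.π (fiberProd.fst _ _ L₁.cover p)) (fiberProd.condition q).symm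

variable (ζ hζ) in
theorem unit_left_aux (q : fiberProd ζ ζ hζ) :
    ((fiberProd.snd ζ ζ hζ).comp (fst L₁ L₂ ζ)).comp L₁.diag q =
      (swap ζ hζ).comp (fstSq L₁ L₂ ζ hζ) q :=
  fiberProd.ext rfl
    (congrArg (fun p => (fiberProd.fst _ _ L₁.cover p)) (fiberProd.condition q).symm)

variable (ζ hζ) in
theorem unit_right_aux (q : fiberProd ζ ζ hζ) :
    ((fiberProd.snd ζ ζ hζ).comp (snd L₁ L₂ ζ)).comp L₂.diag q =
      (swap ζ hζ).comp (sndSq L₁ L₂ ζ hζ) q :=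
  fiberProd.ext rfl
    (congrArg (fun p => (fiberProd.snd _ _ L₁.cover p)) (fiberProd.condition q).symm)

variable (ζ hζ) in
/-- The unit section of `L₁` pulled back along `swap`. -/
noncomputable def unitLeft : Sect ((L₁.L.pull (fstSq L₁ L₂ ζ hζ)).pull (swap ζ hζ)) :=
  (L₁.unitSect.pull ((fiberProd.snd ζ ζ hζ).comp (fst L₁ L₂ ζ))).map
    (Iso.cong L₁.L _ _ (unit_left_aux ζ hζ))

variable (ζ hζ) in
/-- The unit section of `L₂` pulled back along `swap`. -/
noncomputable def unitRight : Sect ((L₂.L.pull (sndSq L₁ L₂ ζ hζ)).pull (swap ζ hζ)) :=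
  (L₂.unitSect.pull ((fiberProd.snd ζ ζ hζ).comp (snd L₁ L₂ ζ))).map
    (Iso.cong L₂.L _ _ (unit_right_aux ζ hζ))

/-- The descent isomorphism `ζ₁^* K → ζ₂^* K` over `Z ×_{Y₁ ×_M Y₂} Z`, obtained from `α` by
inserting the units of the two multiplications. -/
noncomputable def desc : Iso (D.K.pull (fiberProd.fst ζ ζ hζ)) (D.K.pull (fiberProd.snd ζ ζ hζ)) :=
  (((unitLeft ζ hζ).tmulLeft (D.K.pull (fiberProd.fst ζ ζ hζ))).comp
    (D.α.pull (swap ζ hζ))).comp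
      ((unitRight ζ hζ).tmulRight (D.K.pull (fiberProd.snd ζ ζ hζ))).symm

/-- The descent isomorphism on points. -/
noncomputable def d (hz : ζ z = ζ z') (k : D.K.fiber z) : D.K.fiber z' :=
  D.desc.toFun (fiberProd.mk hζ z z' hz) k

theorem base_of_eq (hz : ζ z = ζ z') : base L₁ L₂ ζ z = base L₁ L₂ ζ z' :=
  congrArg (fun p => L₁.π (fiberProd.fst _ _ L₁.cover p)) hz

theorem fst_of_eq (hz : ζ z = ζ z') : fst L₁ L₂ ζ z = fst L₁ L₂ ζ z' :=
  congrArg (fun p => (fiberProd.fst _ _ L₁.cover p)) hz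

theorem snd_of_eq (hz : ζ z = ζ z') : snd L₁ L₂ ζ z = snd L₁ L₂ ζ z' :=
  congrArg (fun p => (fiberProd.snd _ _ L₁.cover p)) hz

theorem d_rel (hz : ζ z = ζ z') (k : D.K.fiber z) :
    AlphaRel D.α (base_of_eq hz.symm) (L₁.unit (fst_of_eq hz.symm) _) k (D.d hz k)
      (L₂.unit (snd_of_eq hz.symm) _) :=
  (((unitRight ζ hζ).tmulRight (D.K.pull (fiberProd.snd ζ ζ hζ))).apply_symm
    (fiberProd.mk hζ z z' hz) _).symm

theorem d_unique (hz : ζ z = ζ z') {k : D.K.fiber z} {k' : D.K.fiber z'}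
    (h : AlphaRel D.α (base_of_eq hz.symm) (L₁.unit (fst_of_eq hz.symm) _) k k'
      (L₂.unit (snd_of_eq hz.symm) _)) : D.d hz k = k' :=
  D.rel_unique (D.d_rel hz k) h

theorem d_injective (hz : ζ z = ζ z') : Injective (D.d hz) :=
  D.desc.injective (fiberProd.mk hζ z z' hz)

theorem d_trans {z'' : Z} (hz : ζ z = ζ z') (hz' : ζ z' = ζ z'') (k : D.K.fiber z) :
    D.d hz' (D.d hz k) = D.d (hz.trans hz') k := by
  have h1 := D.compat _ _ _ _ _ _ _ _ _ (D.d_rel hz k) (D.d_rel hz' (D.d hz k))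
  exact (D.d_unique (hz.trans hz') (D.rel_congr ((L₁.unit_mul _ _ _ _).trans (L₁.cast_unit _ _ _ _ _))
    ((L₂.unit_mul _ _ _ _).trans (L₂.cast_unit _ _ _ _ _)) h1)).symm

theorem d_self (k : D.K.fiber z) : D.d rfl k = k :=
  D.d_injective rfl (D.d_trans rfl rfl k)

theorem d_eq (hz : z = z') (k : D.K.fiber z) : D.d (congrArg ζ hz) k = D.K.tr hz k := by
  subst hz; exact D.d_self k

theorem d_compat {a b a' b' : Z} (hab : ζ a = ζ b) (hab' : ζ a' = ζ b')
    {h : base L₁ L₂ ζ a = base L₁ L₂ ζ a'} {h' : base L₁ L₂ ζ b = base L₁ L₂ ζ b'}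
    {l : L₁.fib (a := fst L₁ L₂ ζ a) (b := fst L₁ L₂ ζ a') h}
    {m : L₂.fib (a := snd L₁ L₂ ζ a) (b := snd L₁ L₂ ζ a') (snd_eq L₁ L₂ ζ h)}
    {k' : D.K.fiber a'} {k : D.K.fiber a} (hr : AlphaRel D.α h l k' k m) :
    AlphaRel D.α h' (L₁.cast (fst_of_eq hab) (fst_of_eq hab') h h' l) (D.d hab' k') (D.d hab k)
      (L₂.cast (snd_of_eq hab) (snd_of_eq hab') (snd_eq L₁ L₂ ζ h) (snd_eq L₁ L₂ ζ h') m) := by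
  have h1 := D.compat _ _ _ _ _ _ _ _ _ hr (D.d_rel hab k)
  have h2 := D.d_rel hab'.symm (D.d hab' k')
  rw [D.d_trans, D.d_self] at h2
  have h3 := D.compat _ _ _ _ _ _ _ _ _ h2 h1
  exact D.rel_congr (((L₁.mul_unit _ _ _ _).trans (congrArg _ (L₁.unit_mul _ _ _ _))).trans
      (L₁.cast_cast _ _ _ _ _ _ _ _))
    (((L₂.mul_unit _ _ _ _).trans (congrArg _ (L₂.unit_mul _ _ _ _))).trans
      (L₂.cast_cast _ _ _ _ _ _ _ _)) h3

theorem rel_tr {a b a' b' : Z} (hab : a = b) (hab' : a' = b')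
    {h : base L₁ L₂ ζ a = base L₁ L₂ ζ a'} (h' : base L₁ L₂ ζ b = base L₁ L₂ ζ b')
    {l : L₁.fib (a := fst L₁ L₂ ζ a) (b := fst L₁ L₂ ζ a') h}
    {m : L₂.fib (a := snd L₁ L₂ ζ a) (b := snd L₁ L₂ ζ a') (snd_eq L₁ L₂ ζ h)}
    {k' : D.K.fiber a'} {k : D.K.fiber a} (hr : AlphaRel D.α h l k' k m) :
    AlphaRel D.α h' (L₁.cast (congrArg _ hab) (congrArg _ hab') h h' l) (D.K.tr hab' k')
      (D.K.tr hab k) (L₂.cast (congrArg _ hab) (congrArg _ hab') (snd_eq L₁ L₂ ζ h)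
        (snd_eq L₁ L₂ ζ h') m) := by
  subst hab hab'; exact hr

theorem desc_preserves (A₁ : Connection L₁.L) (A₂ : Connection L₂.L) (B : Connection D.K)
    (h₁ : L₁.μ.Preserves ((A₁.pull (proj12 L₁.π L₁.cover)).tensor
      (A₁.pull (proj23 L₁.π L₁.cover))) (A₁.pull (proj13 L₁.π L₁.cover)))
    (h₂ : L₂.μ.Preserves ((A₂.pull (proj12 L₂.π L₂.cover)).tensor
      (A₂.pull (proj23 L₂.π L₂.cover))) (A₂.pull (proj13 L₂.π L₂.cover)))
    (hα : D.α.Preserves ((A₁.pull (fstSq L₁ L₂ ζ hζ)).tensor (B.pull (fiberProd.snd _ _ _)))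
      ((B.pull (fiberProd.fst _ _ _)).tensor (A₂.pull (sndSq L₁ L₂ ζ hζ)))) :
    D.desc.Preserves (B.pull (fiberProd.fst ζ ζ hζ)) (B.pull (fiberProd.snd ζ ζ hζ)) := by
  have e1 : (unitLeft ζ hζ).Flat ((A₁.pull (fstSq L₁ L₂ ζ hζ)).pull (swap ζ hζ)) := by
    rw [Connection.pull_pull]
    refine Sect.Flat.map ?_ (Iso.cong_preserves A₁ _ _ (unit_left_aux ζ hζ))
    rw [← Connection.pull_pull]
    exact (L₁.unitSect_flat A₁ h₁).pull _
  have e2 : (unitRight ζ hζ).Flat ((A₂.pull (sndSq L₁ L₂ ζ hζ)).pull (swap ζ hζ)) := by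
    rw [Connection.pull_pull]
    refine Sect.Flat.map ?_ (Iso.cong_preserves A₂ _ _ (unit_right_aux ζ hζ))
    rw [← Connection.pull_pull]
    exact (L₂.unitSect_flat A₂ h₂).pull _
  have h3 := hα.pull (swap ζ hζ)
  rw [Connection.pull_tensor, Connection.pull_tensor] at h3
  have h4 : (B.pull (fiberProd.snd (base L₁ L₂ ζ) (base L₁ L₂ ζ)
      (base_cover L₁ L₂ ζ hζ))).pull (swap ζ hζ) = B.pull (fiberProd.fst ζ ζ hζ) :=
    Connection.pull_pull _ _ _
  have h5 : (B.pull (fiberProd.fst (base L₁ L₂ ζ) (base L₁ L₂ ζ)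
      (base_cover L₁ L₂ ζ hζ))).pull (swap ζ hζ) = B.pull (fiberProd.snd ζ ζ hζ) :=
    Connection.pull_pull _ _ _
  rw [h4, h5] at h3
  exact ((e1.tmulLeft (B.pull (fiberProd.fst ζ ζ hζ))).comp h3).comp
    (e2.tmulRight (B.pull (fiberProd.snd ζ ζ hζ))).symm

end IsoData
end Descent

section TwoMorphisms
open Gerbe (fst snd base base_cover fstSq sndSq snd_eq)
open IsoData (base_of_eq fst_of_eq snd_of_eq)
variable {M : GManifold.{v, u} G} {L₁ L₂ : Gerbe M}

/-- The fiber product `Z₁ ×_{Y₁ ×_M Y₂} Z₂` of the covers of two `1`-morphisms. -/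
noncomputable abbrev GerbeHom.prod (K₁ K₂ : GerbeHom L₁ L₂) : GManifold.{v, u} G :=
  fiberProd K₁.ζ K₂.ζ K₁.cover

/-- The first projection. -/
noncomputable abbrev GerbeHom.pr₁ (K₁ K₂ : GerbeHom L₁ L₂) : GMap (K₁.prod K₂) K₁.Z :=
  fiberProd.fst K₁.ζ K₂.ζ K₁.cover

/-- The second projection. -/
noncomputable abbrev GerbeHom.pr₂ (K₁ K₂ : GerbeHom L₁ L₂) : GMap (K₁.prod K₂) K₂.Z :=
  fiberProd.snd K₁.ζ K₂.ζ K₁.cover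

/-- A representative of a `2`-morphism `K₁ ⇒ K₂`: a `G`-cover `map : W → Z₁ ×_{Y₁ ×_M Y₂} Z₂` and an
isomorphism `β : K₁ → K₂` over `W` which is compatible with `α₁` and `α₂` over `W ×_M W`: if
`α₁ (l ⊗ k') = k ⊗ m` over `(w, w')`, then `α₂ (l ⊗ β k') = β k ⊗ m`.  Here `l` and `m` are moved
by `cast` between fibers of `L₁` and of `L₂` over equal points, as the two components of `map w`
have the same image in `Y₁ ×_M Y₂` (this is `e`, and likewise `e'`; both always hold). -/
structure TwoMorRep (K₁ K₂ : GerbeHom L₁ L₂) where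
  W : GManifold.{v, u} G
  map : GMap W (K₁.prod K₂)
  cover : IsGCover map
  β : Iso (K₁.data.K.pull (map.comp (K₁.pr₁ K₂))) (K₂.data.K.pull (map.comp (K₁.pr₂ K₂)))
  compat : ∀ (w w' : W)
    (h : base L₁ L₂ K₁.ζ (K₁.pr₁ K₂ (map w)) = base L₁ L₂ K₁.ζ (K₁.pr₁ K₂ (map w')))
    (h₂ : base L₁ L₂ K₂.ζ (K₁.pr₂ K₂ (map w)) = base L₁ L₂ K₂.ζ (K₁.pr₂ K₂ (map w')))
    (e : K₁.ζ (K₁.pr₁ K₂ (map w)) = K₂.ζ (K₁.pr₂ K₂ (map w)))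
    (e' : K₁.ζ (K₁.pr₁ K₂ (map w')) = K₂.ζ (K₁.pr₂ K₂ (map w'))) l k' k m,
    AlphaRel K₁.data.α h l k' k m →
      AlphaRel K₂.data.α h₂
        (L₁.cast (a := fst L₁ L₂ K₁.ζ (K₁.pr₁ K₂ (map w)))
          (b := fst L₁ L₂ K₁.ζ (K₁.pr₁ K₂ (map w')))
          (a' := fst L₁ L₂ K₂.ζ (K₁.pr₂ K₂ (map w)))
          (b' := fst L₁ L₂ K₂.ζ (K₁.pr₂ K₂ (map w')))
          (congrArg (fiberProd.fst _ _ L₁.cover) e) (congrArg (fiberProd.fst _ _ L₁.cover) e')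
          h h₂ l)
        (β.toFun w' k') (β.toFun w k)
        (L₂.cast (a := snd L₁ L₂ K₁.ζ (K₁.pr₁ K₂ (map w)))
          (b := snd L₁ L₂ K₁.ζ (K₁.pr₁ K₂ (map w')))
          (a' := snd L₁ L₂ K₂.ζ (K₁.pr₂ K₂ (map w)))
          (b' := snd L₁ L₂ K₂.ζ (K₁.pr₂ K₂ (map w')))
          (congrArg (fiberProd.snd _ _ L₁.cover) e) (congrArg (fiberProd.snd _ _ L₁.cover) e')
          (snd_eq L₁ L₂ K₁.ζ h) (snd_eq L₁ L₂ K₂.ζ h₂) m)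

namespace TwoMorRep
variable {K₁ K₂ K₃ K₄ : GerbeHom L₁ L₂}

/-- The component `W → Z₁` of `map`. -/
noncomputable def z₁ (J : TwoMorRep K₁ K₂) : GMap J.W K₁.Z := J.map.comp (K₁.pr₁ K₂)

/-- The component `W → Z₂` of `map`. -/
noncomputable def z₂ (J : TwoMorRep K₁ K₂) : GMap J.W K₂.Z := J.map.comp (K₁.pr₂ K₂)

theorem ζ_eq (J : TwoMorRep K₁ K₂) (w : J.W) : K₁.ζ (J.z₁ w) = K₂.ζ (J.z₂ w) :=
  fiberProd.condition (J.map w)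

/-- Two representatives `(W₁, β₁)` and `(W₂, β₂)` are equivalent if there are `G`-covers
`π₁ : X → W₁` and `π₂ : X → W₂` with `map₁ ∘ π₁ = map₂ ∘ π₂` and `π₁^* β₁ = π₂^* β₂`. -/
def Equiv (J J' : TwoMorRep K₁ K₂) : Prop :=
  ∃ (X : GManifold.{v, u} G) (π₁ : GMap X J.W) (π₂ : GMap X J'.W),
    IsGCover π₁ ∧ IsGCover π₂ ∧ ∃ h : ∀ x, J.map (π₁ x) = J'.map (π₂ x),
      ∀ (x : X) (k : K₁.data.K.fiber (K₁.pr₁ K₂ (J.map (π₁ x)))),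
        J'.β.toFun (π₂ x) (K₁.data.K.tr (congrArg (K₁.pr₁ K₂) (h x)) k) =
          K₂.data.K.tr (congrArg (K₁.pr₂ K₂) (h x)) (J.β.toFun (π₁ x) k)

variable (J : TwoMorRep K₁ K₂)

theorem β_d (w w' : J.W) (h : K₁.ζ (J.z₁ w) = K₁.ζ (J.z₁ w'))
    (h₂ : K₂.ζ (J.z₂ w) = K₂.ζ (J.z₂ w')) (k : K₁.data.K.fiber (J.z₁ w)) :
    J.β.toFun w' (K₁.data.d h k) = K₂.data.d h₂ (J.β.toFun w k) := by
  have h1 := J.compat w' w _ (base_of_eq h₂.symm) (J.ζ_eq w') (J.ζ_eq w) _ _ _ _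
    (K₁.data.d_rel h k)
  exact (K₂.data.d_unique h₂ (K₂.data.rel_congr (L₁.cast_unit _ _ _ _ _)
    (L₂.cast_unit _ _ _ _ _) h1)).symm

theorem exists_w {a : K₁.Z} {b : K₂.Z} (h : K₁.ζ a = K₂.ζ b) :
    ∃ w, J.z₁ w = a ∧ J.z₂ w = b := by
  obtain ⟨w, hw⟩ := J.cover.surjective (fiberProd.mk K₁.cover a b h)
  exact ⟨w, congrArg (K₁.pr₁ K₂) hw, congrArg (K₁.pr₂ K₂) hw⟩

/-- The value of `β` over a point `(a, b)`; it does not depend on the point of `W` over it. -/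
noncomputable def at' {a : K₁.Z} {b : K₂.Z} (h : K₁.ζ a = K₂.ζ b) (k : K₁.data.K.fiber a) :
    K₂.data.K.fiber b :=
  K₂.data.K.tr (J.exists_w h).choose_spec.2
    (J.β.toFun _ (K₁.data.K.tr (J.exists_w h).choose_spec.1.symm k))

theorem at_eq (w : J.W) (h : K₁.ζ (J.z₁ w) = K₂.ζ (J.z₂ w)) (k : K₁.data.K.fiber (J.z₁ w)) :
    J.at' h k = J.β.toFun w k := by
  have e1 := (J.exists_w h).choose_spec.1
  have e2 := (J.exists_w h).choose_spec.2
  have h1 := J.β_d (J.exists_w h).choose w (congrArg K₁.ζ e1) (congrArg K₂.ζ e2)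
    (K₁.data.K.tr e1.symm k)
  have h2 := K₁.data.d_eq e1 (K₁.data.K.tr e1.symm k)
  rw [GBundle.tr_tr] at h2
  have h3 := K₂.data.d_eq e2 (J.β.toFun _ (K₁.data.K.tr e1.symm k))
  exact h3.symm.trans (h1.symm.trans (congrArg (J.β.toFun w) h2))

theorem at_d {a a' : K₁.Z} {b b' : K₂.Z} (h : K₁.ζ a = K₂.ζ b) (h' : K₁.ζ a' = K₂.ζ b')
    (ha : K₁.ζ a = K₁.ζ a') (hb : K₂.ζ b = K₂.ζ b') (k : K₁.data.K.fiber a) :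
    J.at' h' (K₁.data.d ha k) = K₂.data.d hb (J.at' h k) := by
  obtain ⟨w, rfl, rfl⟩ := J.exists_w h
  obtain ⟨w', rfl, rfl⟩ := J.exists_w h'
  rw [J.at_eq, J.at_eq]
  exact J.β_d w w' ha hb k

theorem equiv_iff {J J' : TwoMorRep K₁ K₂} :
    J.Equiv J' ↔ ∀ (a : K₁.Z) (b : K₂.Z) (h : K₁.ζ a = K₂.ζ b) k, J.at' h k = J'.at' h k := by
  constructor
  · rintro ⟨X, π₁, π₂, c1, c2, e, hβ⟩ a b h k
    obtain ⟨w, rfl, rfl⟩ := J.exists_w h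
    obtain ⟨x, rfl⟩ := c1.surjective w
    have key : ∀ (a : K₁.Z) (b : K₂.Z) (ha : J.z₁ (π₁ x) = a) (hb : J.z₂ (π₁ x) = b)
        (h2 : K₁.ζ a = K₂.ζ b), K₂.data.K.tr hb (J.at' h k) = J'.at' h2 (K₁.data.K.tr ha k) →
        J.at' h k = J'.at' h k := by
      intro a b ha hb h2 h3
      subst ha hb; exact h3
    refine key (J'.z₁ (π₂ x)) (J'.z₂ (π₂ x)) (congrArg (K₁.pr₁ K₂) (e x))
      (congrArg (K₁.pr₂ K₂) (e x)) (J'.ζ_eq _) ?_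
    rw [J.at_eq, J'.at_eq]
    exact (hβ x k).symm
  · intro h
    refine ⟨fiberProd J.map J'.map J.cover, fiberProd.fst _ _ _, fiberProd.snd _ _ _,
      fiberProd.isGCover_fst _ _ _ J'.cover, fiberProd.isGCover_snd _ _ _,
      fun x => fiberProd.condition x, fun x => ?_⟩
    set w := fiberProd.fst J.map J'.map J.cover x
    set w' : J'.W := fiberProd.snd J.map J'.map J.cover x
    have e : J.map w = J'.map w' := fiberProd.condition x
    intro k
    have key : ∀ (a : K₁.Z) (b : K₂.Z) (ha : J.z₁ w = a) (hb : J.z₂ w = b)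
        (h2 : K₁.ζ a = K₂.ζ b), J'.at' h2 (K₁.data.K.tr ha k) =
          K₂.data.K.tr hb (J.β.toFun w k) := by
      intro a b ha hb h2
      subst ha hb
      exact (h _ _ _ _).symm.trans (J.at_eq w h2 k)
    refine Eq.trans (J'.at_eq w' (J'.ζ_eq w') _).symm ?_
    exact key _ _ (congrArg (K₁.pr₁ K₂) e) (congrArg (K₁.pr₂ K₂) e) _

instance setoid (K₁ K₂ : GerbeHom L₁ L₂) : Setoid (TwoMorRep K₁ K₂) where
  r := Equiv
  iseqv := by
    refine ⟨fun J => ?_, fun {J J'} h => ?_, fun {J J' J''} h h' => ?_⟩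
    · exact equiv_iff.2 fun _ _ _ _ => rfl
    · exact equiv_iff.2 fun a b e k => (equiv_iff.1 h a b e k).symm
    · exact equiv_iff.2 fun a b e k => (equiv_iff.1 h a b e k).trans (equiv_iff.1 h' a b e k)

/-- The identity `2`-morphism, given by the descent isomorphism of `K` over
`Z ×_{Y₁ ×_M Y₂} Z`. -/
noncomputable def id (K : GerbeHom L₁ L₂) : TwoMorRep K K where
  W := K.prod K
  map := GMap.id _
  cover := IsGCover.id _
  β := K.data.desc
  compat _ _ _ _ e e' _ _ _ _ hr := K.data.d_compat e e' hr

theorem id_at (K : GerbeHom L₁ L₂) {a b : K.Z} (h : K.ζ a = K.ζ b) (k : K.data.K.fiber a) :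
    (id K).at' h k = K.data.d h k :=
  (id K).at_eq (fiberProd.mk K.cover a b h) h k

/-- The fiber product `W ×_{Z₂} W'`. -/
noncomputable def compW (J : TwoMorRep K₁ K₂) (J' : TwoMorRep K₂ K₃) : GManifold.{v, u} G :=
  fiberProd J.z₂ J'.z₁ (J.cover.comp (fiberProd.isGCover_snd _ _ _))

/-- The first projection. -/
noncomputable def comp₁ (J : TwoMorRep K₁ K₂) (J' : TwoMorRep K₂ K₃) : GMap (J.compW J') J.W :=
  fiberProd.fst _ _ _

/-- The second projection. -/
noncomputable def comp₂ (J : TwoMorRep K₁ K₂) (J' : TwoMorRep K₂ K₃) : GMap (J.compW J') J'.W :=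
  fiberProd.snd _ _ _

theorem comp_eq (J : TwoMorRep K₁ K₂) (J' : TwoMorRep K₂ K₃) (x : J.compW J') :
    J.z₂ (J.comp₁ J' x) = J'.z₁ (J.comp₂ J' x) := fiberProd.condition x

/-- The map `W ×_{Z₂} W' → Z₁ ×_{Y₁ ×_M Y₂} Z₃`. -/
noncomputable def compMap (J : TwoMorRep K₁ K₂) (J' : TwoMorRep K₂ K₃) :
    GMap (J.compW J') (K₁.prod K₃) :=
  fiberProd.lift K₁.cover ((J.comp₁ J').comp J.z₁) ((J.comp₂ J').comp J'.z₂) fun x =>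
    (J.ζ_eq _).trans ((congrArg K₂.ζ (J.comp_eq J' x)).trans (J'.ζ_eq _))

theorem compMap_cover (J : TwoMorRep K₁ K₂) (J' : TwoMorRep K₂ K₃) : IsGCover (J.compMap J') := by
  refine IsGCover.of_sections (fun p => ?_) fun x => ?_
  · have hp : K₁.ζ (K₁.pr₁ K₃ p) = K₃.ζ (K₁.pr₂ K₃ p) := fiberProd.condition p
    obtain ⟨b, hb⟩ := K₂.cover.surjective (K₁.ζ (K₁.pr₁ K₃ p))
    obtain ⟨w, h1, h2⟩ := J.exists_w hb.symm
    obtain ⟨w', h3, h4⟩ := J'.exists_w (hb.trans hp)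
    exact ⟨fiberProd.mk _ w w' (h2.trans h3.symm), fiberProd.ext h1 h4⟩
  · have hx : J.z₂ (J.comp₁ J' x) = J'.z₁ (J.comp₂ J' x) := J.comp_eq J' x
    set p := J.compMap J' x with hp
    have e1 : K₁.pr₁ K₃ p = J.z₁ (J.comp₁ J' x) := rfl
    have e2 : K₁.pr₂ K₃ p = J'.z₂ (J.comp₂ J' x) := rfl
    obtain ⟨σ, s1, s2, s3⟩ := J.cover.sections (J.comp₁ J' x)
    obtain ⟨σ', s1', s2', s3'⟩ := J'.cover.sections (J.comp₂ J' x)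
    obtain ⟨t, t1, t2, t3⟩ := K₂.cover.sections (J.z₂ (J.comp₁ J' x))
    have hz : K₁.ζ (K₁.pr₁ K₃ p) = K₂.ζ (J.z₂ (J.comp₁ J' x)) := J.ζ_eq _
    rw [← hz] at t1 t2 t3
    have f1 := ((K₁.pr₁ K₃).comp K₁.ζ).contMDiffAt p
    have g1 : ContMDiffAt (K₁.prod K₃).model K₂.Z.model ∞
        (fun q => t (K₁.ζ (K₁.pr₁ K₃ q))) p := t1.comp p f1
    have g2 := f1.continuousAt.eventually t3
    obtain ⟨q, q1, q2, q3⟩ := fiberProd.exists_mk_section (J := (K₁.prod K₃).model)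
      (hf := K₁.cover) (g := K₂.ζ) (a := fun q => K₁.pr₁ K₃ q)
      (b := fun q => t (K₁.ζ (K₁.pr₁ K₃ q))) (x := p) (J.map (J.comp₁ J' x))
      ((K₁.pr₁ K₃).contMDiffAt p) g1 (g2.mono fun y hy => Eq.symm hy) rfl t2
    obtain ⟨q', q1', q2', q3'⟩ := fiberProd.exists_mk_section (J := (K₁.prod K₃).model)
      (hf := K₂.cover) (g := K₃.ζ) (a := fun q => t (K₁.ζ (K₁.pr₁ K₃ q)))
      (b := fun q => K₁.pr₂ K₃ q) (x := p) (J'.map (J.comp₂ J' x))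
      g1 ((K₁.pr₂ K₃).contMDiffAt p)
      (g2.mono fun y hy => hy.trans (fiberProd.condition y)) (t2.trans hx) rfl
    rw [← q2] at s1 s2 s3
    rw [← q2'] at s1' s2' s3'
    have r3 := q1.continuousAt.eventually s3
    have r3' := q1'.continuousAt.eventually s3'
    obtain ⟨k, k1, k2, k3⟩ := fiberProd.exists_mk_section (J := (K₁.prod K₃).model)
      (hf := J.cover.comp (fiberProd.isGCover_snd _ _ _)) (f := J.z₂) (g := J'.z₁)
      (a := fun y => σ (q y)) (b := fun y => σ' (q' y)) (x := p) x
      (s1.comp p q1) (s1'.comp p q1')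
      (by
        filter_upwards [r3, r3', q3, q3'] with y h1 h2 h3 h4
        have h5 : J.z₂ (σ (q y)) = K₁.pr₂ K₂ (q y) := congrArg (K₁.pr₂ K₂) h1
        have h6 : J'.z₁ (σ' (q' y)) = K₂.pr₁ K₃ (q' y) := congrArg (K₂.pr₁ K₃) h2
        exact h5.trans (h3.2.trans (h4.1.symm.trans h6.symm))) s2 s2'
    refine ⟨k, k1, k2, ?_⟩
    filter_upwards [r3, r3', q3, q3', k3] with y h1 h2 h3 h4 h5
    have h6 : J.z₁ (σ (q y)) = K₁.pr₁ K₂ (q y) := congrArg (K₁.pr₁ K₂) h1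
    have h7 : J'.z₂ (σ' (q' y)) = K₂.pr₂ K₃ (q' y) := congrArg (K₂.pr₂ K₃) h2
    exact fiberProd.ext ((congrArg J.z₁ h5.1).trans (h6.trans h3.1))
      ((congrArg J'.z₂ h5.2).trans (h7.trans h4.2))

/-- The composition: first `J`, then `J'`. -/
noncomputable def comp (J : TwoMorRep K₁ K₂) (J' : TwoMorRep K₂ K₃) : TwoMorRep K₁ K₃ where
  W := J.compW J'
  map := J.compMap J'
  cover := J.compMap_cover J'
  β := ((J.β.pull (J.comp₁ J')).comp (Iso.cong K₂.data.K ((J.comp₁ J').comp J.z₂)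
    ((J.comp₂ J').comp J'.z₁) (J.comp_eq J'))).comp (J'.β.pull (J.comp₂ J'))
  compat w w' h h₂ e e' l k' k m hr := by
    have e1 := J.ζ_eq (J.comp₁ J' w)
    have e1' := J.ζ_eq (J.comp₁ J' w')
    have c := J.comp_eq J' w
    have c' := J.comp_eq J' w'
    have hb : base L₁ L₂ K₂.ζ (J.z₂ (J.comp₁ J' w)) = base L₁ L₂ K₂.ζ (J.z₂ (J.comp₁ J' w')) :=
      ((congrArg (fun p => L₁.π (fiberProd.fst _ _ L₁.cover p)) e1).symm.trans h).trans
        (congrArg (fun p => L₁.π (fiberProd.fst _ _ L₁.cover p)) e1')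
    have h1 := J.compat _ _ h hb e1 e1' _ _ _ _ hr
    have h2 := K₂.data.rel_tr c c' (by rw [← c, ← c']; exact hb) h1
    have h3 := J'.compat _ _ _ h₂ (J'.ζ_eq _) (J'.ζ_eq _) _ _ _ _ h2
    exact K₃.data.rel_congr
      ((L₁.cast_cast _ _ _ _ _ _ _ _).trans (L₁.cast_cast _ _ _ _ _ _ _ _))
      ((L₂.cast_cast _ _ _ _ _ _ _ _).trans (L₂.cast_cast _ _ _ _ _ _ _ _)) h3

theorem comp_at (J : TwoMorRep K₁ K₂) (J' : TwoMorRep K₂ K₃) {a : K₁.Z} {b : K₂.Z} {c : K₃.Z}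
    (h : K₁.ζ a = K₂.ζ b) (h' : K₂.ζ b = K₃.ζ c) (k : K₁.data.K.fiber a) :
    (J.comp J').at' (h.trans h') k = J'.at' h' (J.at' h k) := by
  obtain ⟨w, rfl, rfl⟩ := J.exists_w h
  obtain ⟨w', h3, rfl⟩ := J'.exists_w h'
  have h1 := (J.comp J').at_eq (fiberProd.mk (f := J.z₂) (g := J'.z₁)
    (J.cover.comp (fiberProd.isGCover_snd _ _ _)) w w' h3.symm)
    (h.trans h' : K₁.ζ (J.z₁ w) = K₃.ζ (J'.z₂ w')) k
  refine h1.trans ?_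
  change J'.β.toFun w' (K₂.data.K.tr h3.symm (J.β.toFun w k)) = _
  rw [← J.at_eq w h]
  refine (J'.at_eq w' (J'.ζ_eq w') _).symm.trans ?_
  have key : ∀ (b : K₂.Z) (hb : J.z₂ w = b) (e : K₂.ζ b = K₃.ζ (J'.z₂ w')) (x : K₂.data.K.fiber
      (J.z₂ w)), J'.at' e (K₂.data.K.tr hb x) = J'.at' h' x := by
    intro b hb e x; subst hb; rfl
  exact key _ _ _ _

end TwoMorRep
end TwoMorphisms

section Categories
open CategoryTheory
open Gerbe (fst snd base base_cover fstSq sndSq snd_eq)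
variable {M : GManifold.{v, u} G} {L₁ L₂ : Gerbe M}

namespace TwoMorRep
variable {K₁ K₂ K₃ K₄ : GerbeHom L₁ L₂}

theorem exists_mid (K₁ K₂ : GerbeHom L₁ L₂) (a : K₁.Z) : ∃ b : K₂.Z, K₁.ζ a = K₂.ζ b := by
  obtain ⟨b, hb⟩ := K₂.cover.surjective (K₁.ζ a)
  exact ⟨b, hb.symm⟩

theorem comp_congr {J J' : TwoMorRep K₁ K₂} {I I' : TwoMorRep K₂ K₃} (h : J ≈ J') (h' : I ≈ I') :
    J.comp I ≈ J'.comp I' := by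
  refine equiv_iff.2 fun a c e k => ?_
  obtain ⟨b, hb⟩ := exists_mid K₁ K₂ a
  rw [comp_at J I hb (hb.symm.trans e), comp_at J' I' hb (hb.symm.trans e),
    equiv_iff.1 h, equiv_iff.1 h']

theorem id_comp (J : TwoMorRep K₁ K₂) : (id K₁).comp J ≈ J := by
  refine equiv_iff.2 fun a c e k => ?_
  rw [comp_at (id K₁) J rfl e, id_at, IsoData.d_self]

theorem comp_id (J : TwoMorRep K₁ K₂) : J.comp (id K₂) ≈ J := by
  refine equiv_iff.2 fun a c e k => ?_
  rw [comp_at J (id K₂) e rfl, id_at, IsoData.d_self]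

theorem comp_assoc (J : TwoMorRep K₁ K₂) (J' : TwoMorRep K₂ K₃) (J'' : TwoMorRep K₃ K₄) :
    (J.comp J').comp J'' ≈ J.comp (J'.comp J'') := by
  refine equiv_iff.2 fun a d e k => ?_
  obtain ⟨b, hb⟩ := exists_mid K₁ K₂ a
  obtain ⟨c, hc⟩ := exists_mid K₂ K₃ b
  have hd : K₃.ζ c = K₄.ζ d := hc.symm.trans (hb.symm.trans e)
  rw [comp_at (J.comp J') J'' (hb.trans hc) hd, comp_at J J' hb hc,
    comp_at J (J'.comp J'') hb (hc.trans hd), comp_at J' J'' hc hd]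

end TwoMorRep

/-- The category of `1`-morphisms `L₁ → L₂` and `2`-morphisms between them. -/
noncomputable instance : Category (GerbeHom L₁ L₂) where
  Hom K₁ K₂ := Quotient (TwoMorRep.setoid K₁ K₂)
  id K := Quotient.mk _ (TwoMorRep.id K)
  comp J J' := Quotient.map₂ TwoMorRep.comp (fun _ _ h _ _ h' => TwoMorRep.comp_congr h h') J J'
  id_comp J := by
    induction J using Quotient.inductionOn with
    | h J => exact Quotient.sound J.id_comp
  comp_id J := by
    induction J using Quotient.inductionOn with
    | h J => exact Quotient.sound J.comp_id
  assoc J J' J'' := by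
    induction J using Quotient.inductionOn with
    | h J =>
      induction J' using Quotient.inductionOn with
      | h J' =>
        induction J'' using Quotient.inductionOn with
        | h J'' => exact Quotient.sound (J.comp_assoc J' J'')

/-- A `2`-morphism of fiber product isomorphisms whose `G`-cover is the identity of `Y₁ ×_M Y₂`:
an isomorphism `β : K₁ → K₂` over `Y₁ ×_M Y₂` compatible with `α₁` and `α₂`. -/
@[ext] structure FPTwoMor (K₁ K₂ : FPHom L₁ L₂) where
  β : Iso K₁.data.K K₂.data.K
  compat : ∀ (p p' : L₁.prod L₂)
    (h : base L₁ L₂ (GMap.id (L₁.prod L₂)) p = base L₁ L₂ (GMap.id (L₁.prod L₂)) p') l k' k m,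
    AlphaRel K₁.data.α h l k' k m → AlphaRel K₂.data.α h l (β.toFun p' k') (β.toFun p k) m

/-- The category of fiber product isomorphisms `L₁ → L₂`. -/
noncomputable instance : Category (FPHom L₁ L₂) where
  Hom := FPTwoMor
  id _ := ⟨Iso.id _, fun _ _ _ _ _ _ _ h => h⟩
  comp β β' := ⟨β.β.comp β'.β, fun p p' h _ _ _ _ hr => β'.compat p p' h _ _ _ _
    (β.compat p p' h _ _ _ _ hr)⟩
  id_comp _ := rfl
  comp_id _ := rfl
  assoc _ _ _ := rfl

namespace FPTwoMor
variable {K₁ K₂ K₃ : FPHom L₁ L₂}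

/-- The diagonal `P → P ×_P P` of `P = Y₁ ×_M Y₂`. -/
noncomputable def diag (K₁ K₂ : FPHom L₁ L₂) :
    GMap (L₁.prod L₂) (K₁.toHom.prod K₂.toHom) :=
  fiberProd.lift _ (GMap.id _) (GMap.id _) fun _ => rfl

theorem diag_cover (K₁ K₂ : FPHom L₁ L₂) : IsGCover (diag K₁ K₂) := by
  have key : ∀ x, diag K₁ K₂ (K₁.toHom.pr₁ K₂.toHom x) = x := fun x =>
    fiberProd.ext rfl (fiberProd.condition x : _)
  refine IsGCover.of_sections (fun x => ⟨_, key x⟩) fun p => ⟨K₁.toHom.pr₁ K₂.toHom,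
    (K₁.toHom.pr₁ K₂.toHom).contMDiffAt _, rfl, Filter.Eventually.of_forall key⟩

/-- A `2`-morphism over the identity cover is in particular a `2`-morphism, with
`P → P ×_P P` the canonical identification. -/
noncomputable def toRep (β : FPTwoMor K₁ K₂) : TwoMorRep K₁.toHom K₂.toHom where
  W := L₁.prod L₂
  map := diag K₁ K₂
  cover := diag_cover K₁ K₂
  β := β.β.pull ((diag K₁ K₂).comp (K₁.toHom.pr₁ K₂.toHom))
  compat w w' h _ _ _ _ _ _ _ hr := β.compat w w' h _ _ _ _ hr

theorem toRep_at (β : FPTwoMor K₁ K₂) (p : L₁.prod L₂) (k : K₁.data.K.fiber p) :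
    β.toRep.at' (a := p) (b := p) rfl k = β.β.toFun p k :=
  β.toRep.at_eq p rfl k

end FPTwoMor

/-- The inclusion of fiber product isomorphisms into all isomorphisms. -/
noncomputable def fpInclusion (L₁ L₂ : Gerbe M) : FPHom L₁ L₂ ⥤ GerbeHom L₁ L₂ where
  obj K := K.toHom
  map β := Quotient.mk _ (FPTwoMor.toRep β)
  map_id K := by
    refine Quotient.sound (TwoMorRep.equiv_iff.2 fun a b h k => ?_)
    obtain rfl : a = b := h
    exact (FPTwoMor.toRep_at _ _ _).trans
      ((TwoMorRep.id_at K.toHom rfl k).trans (IsoData.d_self _ k)).symm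
  map_comp β β' := by
    refine Quotient.sound (TwoMorRep.equiv_iff.2 fun a b h k => ?_)
    obtain rfl : a = b := h
    refine (FPTwoMor.toRep_at _ _ _).trans (Eq.symm ?_)
    refine (TwoMorRep.comp_at (FPTwoMor.toRep β) (FPTwoMor.toRep β') (b := a) rfl rfl k).trans ?_
    refine (FPTwoMor.toRep_at β' a _).trans ?_
    exact congrArg (β'.β.toFun a) (FPTwoMor.toRep_at β a k)

end Categories

section Connections
open CategoryTheory
open Gerbe (fst snd base base_cover fstSq sndSq snd_eq)
variable {M : GManifold.{v, u} G}

/-- A `G`-equivariant bundle gerbe on `M` with `G`-equivariant connection: a bundle gerbe with an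
invariant connection on `L` preserved by `μ` and an equivariant `2`-form `B` on `Y` such that
`curv_G = π₂^* B - π₁^* B` on `Y^[2]`. -/
structure GerbeConn (M : GManifold.{v, u} G) extends Gerbe M where
  conn : Connection L
  preserves : μ.Preserves ((conn.pull (proj12 π cover)).tensor (conn.pull (proj23 π cover)))
    (conn.pull (proj13 π cover))
  B : EquivForm2 Y
  curv_eq : conn.curv =
    B.toForm2.pull (fiberProd.snd π π cover) - B.toForm2.pull (fiberProd.fst π π cover)

variable {L₁ L₂ : GerbeConn M}

/-- A connection on the data `(K, α)` of an isomorphism of gerbes: an invariant connection on `K`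
preserved by `α`, with `curv_G = ζ^* (B₂ - B₁)`. -/
structure ConnData (L₁ L₂ : GerbeConn M) {Z : GManifold.{v, u} G}
    {ζ : GMap Z (L₁.toGerbe.prod L₂.toGerbe)} {hζ : IsGCover ζ}
    (D : IsoData L₁.toGerbe L₂.toGerbe ζ hζ) where
  conn : Connection D.K
  curv_eq : conn.curv = L₂.B.toForm2.pull (snd L₁.toGerbe L₂.toGerbe ζ) -
    L₁.B.toForm2.pull (fst L₁.toGerbe L₂.toGerbe ζ)
  preserves : D.α.Preserves
    ((L₁.conn.pull (fstSq L₁.toGerbe L₂.toGerbe ζ hζ)).tensor (conn.pull (fiberProd.snd _ _ _)))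
    ((conn.pull (fiberProd.fst _ _ _)).tensor (L₂.conn.pull (sndSq L₁.toGerbe L₂.toGerbe ζ hζ)))

/-- A `1`-morphism (isomorphism) `L₁ → L₂` of equivariant bundle gerbes with connection. -/
structure GerbeConnHom (L₁ L₂ : GerbeConn M) where
  hom : GerbeHom L₁.toGerbe L₂.toGerbe
  conn : ConnData L₁ L₂ hom.data

/-- A fiber product isomorphism of equivariant bundle gerbes with connection. -/
structure FPConnHom (L₁ L₂ : GerbeConn M) where
  hom : FPHom L₁.toGerbe L₂.toGerbe
  conn : ConnData L₁ L₂ hom.data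

/-- A representative of a `2`-morphism of `1`-morphisms with connection: `β` preserves the
connections. -/
def TwoMorRepConn (K₁ K₂ : GerbeConnHom L₁ L₂) :=
  {J : TwoMorRep K₁.hom K₂.hom // J.β.Preserves
    (K₁.conn.conn.pull (J.map.comp (K₁.hom.pr₁ K₂.hom)))
    (K₂.conn.conn.pull (J.map.comp (K₁.hom.pr₂ K₂.hom)))}

namespace TwoMorRepConn
variable {K₁ K₂ K₃ : GerbeConnHom L₁ L₂}

/-- Equivalence of representatives, as for gerbes without connection. -/
instance setoid (K₁ K₂ : GerbeConnHom L₁ L₂) : Setoid (TwoMorRepConn K₁ K₂) :=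
  (TwoMorRep.setoid K₁.hom K₂.hom).comap Subtype.val

/-- The identity `2`-morphism. -/
noncomputable def id (K : GerbeConnHom L₁ L₂) : TwoMorRepConn K K :=
  ⟨TwoMorRep.id K.hom, K.hom.data.desc_preserves L₁.conn L₂.conn K.conn.conn L₁.preserves
    L₂.preserves K.conn.preserves⟩

/-- The composition: first `J`, then `J'`. -/
noncomputable def comp (J : TwoMorRepConn K₁ K₂) (J' : TwoMorRepConn K₂ K₃) :
    TwoMorRepConn K₁ K₃ :=
  ⟨J.1.comp J'.1, by
    have h1 := J.2.pull (J.1.comp₁ J'.1)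
    have h2 := J'.2.pull (J.1.comp₂ J'.1)
    have h3 := Iso.cong_preserves K₂.conn.conn ((J.1.comp₁ J'.1).comp J.1.z₂)
      ((J.1.comp₂ J'.1).comp J'.1.z₁) (J.1.comp_eq J'.1)
    rw [Connection.pull_pull, Connection.pull_pull] at h1 h2
    exact (h1.comp h3).comp h2⟩

end TwoMorRepConn

/-- The category of `1`-morphisms with connection `L₁ → L₂` and `2`-morphisms between them. -/
noncomputable instance : Category (GerbeConnHom L₁ L₂) where
  Hom K₁ K₂ := Quotient (TwoMorRepConn.setoid K₁ K₂)
  id K := Quotient.mk _ (TwoMorRepConn.id K)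
  comp J J' := Quotient.map₂ TwoMorRepConn.comp
    (fun _ _ h _ _ h' => TwoMorRep.comp_congr h h') J J'
  id_comp J := by
    induction J using Quotient.inductionOn with
    | h J => exact Quotient.sound J.1.id_comp
  comp_id J := by
    induction J using Quotient.inductionOn with
    | h J => exact Quotient.sound J.1.comp_id
  assoc J J' J'' := by
    induction J using Quotient.inductionOn with
    | h J =>
      induction J' using Quotient.inductionOn with
      | h J' =>
        induction J'' using Quotient.inductionOn with
        | h J'' => exact Quotient.sound (J.1.comp_assoc J'.1 J''.1)

/-- The category of fiber product isomorphisms with connection `L₁ → L₂`. -/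
noncomputable instance : Category (FPConnHom L₁ L₂) where
  Hom K₁ K₂ := {β : FPTwoMor K₁.hom K₂.hom // β.β.Preserves K₁.conn.conn K₂.conn.conn}
  id _ := ⟨⟨Iso.id _, fun _ _ _ _ _ _ _ h => h⟩, Iso.id_preserves _⟩
  comp β β' := ⟨⟨β.1.β.comp β'.1.β, fun p p' h _ _ _ _ hr => β'.1.compat p p' h _ _ _ _
    (β.1.compat p p' h _ _ _ _ hr)⟩, β.2.comp β'.2⟩
  id_comp _ := rfl
  comp_id _ := rfl
  assoc _ _ _ := rfl

/-- The inclusion of fiber product isomorphisms with connection into all isomorphisms with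
connection. -/
noncomputable def fpInclusionConn (L₁ L₂ : GerbeConn M) :
    FPConnHom L₁ L₂ ⥤ GerbeConnHom L₁ L₂ where
  obj K := ⟨K.hom.toHom, K.conn⟩
  map {K₁ K₂} β := Quotient.mk (TwoMorRepConn.setoid ⟨K₁.hom.toHom, K₁.conn⟩ ⟨K₂.hom.toHom, K₂.conn⟩)
    ⟨FPTwoMor.toRep β.1, β.2.pull _⟩
  map_id K := by
    exact Quotient.sound (Quotient.exact ((fpInclusion L₁.toGerbe L₂.toGerbe).map_id K.hom) :)
  map_comp {K₁ K₂ K₃} β β' := by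
    exact Quotient.sound (Quotient.exact
      ((fpInclusion L₁.toGerbe L₂.toGerbe).map_comp (X := K₁.hom) (Y := K₂.hom) (Z := K₃.hom) β.1 β'.1) :)

end Connections

end EqGerbe

/-!
A `1`-morphism of bundle gerbes lives on a `G`-cover `ζ : Z → P` of `P = Y₁ ×_M Y₂`, a fiber product
morphism on `P` itself, and everything living on `Z` descends to `P`. Inserting the units of the
multiplications `μ₁`, `μ₂` into `α` gives an isomorphism between the two pullbacks of `K` to
`Z ×_P Z`; compatibility of `α` with `μ₁` and `μ₂` makes it a cocycle, which is preserved by the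
connection of `K` when there is one. Equivariant circle bundles with connection form a stack for
`G`-covers, so `K` descends.

*Descent of bundles* (`DescentDatum.descend`). The fiber of the descended bundle at `x` is the fiber
of `K` at a chosen point over `x`, and its local trivializations are those of `K` along local
sections of the cover; all structure maps are compared through `DescentDatum.transition`, the
smooth transition function of the gluing isomorphism. The canonical isomorphism with `K` over the
cover is `DescentDatum.descendIso`.

*Descent of connections* (`DescentDatum.descendConn`). The local connection forms are pulled back
along the local sections. By naturality of the exterior derivative (`extDeriv1_pullback`), the
equivariant curvature of the result is the pullback of that of `K` along a local section. Hence if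
the curvature of `K` is `ζ^* C`, that of the descended bundle is `C`
(`DescentDatum.curv_descendConn`); this is applied to `C = B₂ - B₁`.

*Descent of isomorphisms* (`Iso.descend`). An isomorphism over a cover which agrees on its fibers
descends, and preserves connections if it did so upstairs, because the differential of a submersion
is surjective. Along `Z ×_M Z → P ×_M P` this descends `α`, and the descended data together with
`descendIso` show that the inclusion is essentially surjective. Along the cover `W → P` underlying
a `2`-morphism between fiber product morphisms it shows that the inclusion is full. Faithfulness
holds because equivalent representatives have equal values over each point of `P`.
-/

namespace EqGerbe

/-! ### Local sections and the exterior derivative -/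

section Calculus
variable {m n : ℕ} {A C : Type*}
    [TopologicalSpace A] [ChartedSpace (EuclideanSpace ℝ (Fin m)) A] [IsManifold (𝓡 m) ∞ A]
    [TopologicalSpace C] [ChartedSpace (EuclideanSpace ℝ (Fin n)) C] [IsManifold (𝓡 n) ∞ C]

/-- A submersion has a local section which is smooth on a whole neighbourhood: being of class `C^∞`
at a point is not an open condition, so this is stronger than `exists_section_of_isSubmersion`. -/
theorem exists_section_on_of_isSubmersion {f : A → C} (hf : IsSubmersion (𝓡 m) (𝓡 n) ∞ f) (x : A) :
    ∃ (U : Set C) (σ : C → A), IsOpen U ∧ f x ∈ U ∧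
      ∀ y ∈ U, ContMDiffAt (𝓡 n) (𝓡 m) ∞ σ y ∧ f (σ y) = y := by
  have h0 := hf.isSubmersionOfComplement_complement x
  let F := hf.complement
  let φ := h0.domChart
  let ψ := h0.codChart
  let q : EuclideanSpace ℝ (Fin m) ≃L[ℝ] EuclideanSpace ℝ (Fin n) × F := h0.equiv
  have hφs : x ∈ φ.source := h0.mem_domChart_source
  have hψs : f x ∈ ψ.source := h0.mem_codChart_source
  have hφ : φ ∈ IsManifold.maximalAtlas (𝓡 m) ∞ A := h0.domChart_mem_maximalAtlas
  have hψ : ψ ∈ IsManifold.maximalAtlas (𝓡 n) ∞ C := h0.codChart_mem_maximalAtlas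
  have hsub : ∀ x ∈ φ.source, f x ∈ ψ.source := h0.source_subset_preimage_source
  have hnorm : ∀ u ∈ φ.target, ψ (f (φ.symm u)) = (q u).1 := by
    intro u hu
    have := h0.writtenInCharts (show u ∈ (h0.domChart.extend (𝓡 m)).target by simpa using hu)
    simpa using this
  have hx0 : (q (φ x)).1 = ψ (f x) := by rw [← hnorm _ (φ.map_source hφs), φ.left_inv hφs]
  let τ : C → EuclideanSpace ℝ (Fin m) := fun y => q.symm (ψ y, (q (φ x)).2)
  have hτx : τ (f x) = φ x := by simp [τ, ← hx0]
  have hτ : ∀ y ∈ ψ.source, ContMDiffAt (𝓡 n) (𝓡 m) ∞ τ y := fun y hy =>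
    q.symm.contDiff.contMDiff.contMDiffAt.comp y
      ((contMDiffAt_of_mem_maximalAtlas hψ hy).prodMk_space contMDiffAt_const)
  have hτc : ContinuousOn τ ψ.source := fun y hy => (hτ y hy).continuousAt.continuousWithinAt
  refine ⟨ψ.source ∩ τ ⁻¹' φ.target, fun y => φ.symm (τ y),
    hτc.isOpen_inter_preimage ψ.open_source φ.open_target, ⟨hψs, ?_⟩, fun y hy => ⟨?_, ?_⟩⟩
  · rw [mem_preimage, hτx]; exact φ.map_source hφs
  · exact (contMDiffAt_symm_of_mem_maximalAtlas hφ hy.2).comp (I' := 𝓡 m) y (hτ y hy.1)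
  · refine ψ.injOn (hsub _ (φ.map_target hy.2)) hy.1 ?_
    rw [hnorm _ hy.2]
    simp [τ]

theorem differentiableAt_of_forall_apply {E D F : Type*} [NormedAddCommGroup E] [NormedSpace ℝ E]
    [FiniteDimensional ℝ E] [NormedAddCommGroup D] [NormedSpace ℝ D] [NormedAddCommGroup F]
    [NormedSpace ℝ F] {a : D → E →L[ℝ] F} {x : D} (h : ∀ v, DifferentiableAt ℝ (fun e => a e v) x) :
    DifferentiableAt ℝ a x := by
  let d := Module.finrank ℝ E
  have hd : d = Module.finrank ℝ (Fin d → ℝ) := (Module.finrank_fin_fun ℝ).symm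
  let e₁ := ContinuousLinearEquiv.ofFinrankEq hd
  let e₂ := (e₁.arrowCongr (1 : F ≃L[ℝ] F)).trans (ContinuousLinearEquiv.piRing (Fin d))
  rw [← e₂.comp_differentiableAt_iff]
  exact differentiableAt_pi.2 fun i => h _

/-- The tangent map of a map which is smooth on an open set only. -/
theorem contMDiffAt_tangentMap {E H M E' H' M' : Type*} [NormedAddCommGroup E] [NormedSpace ℝ E]
    [TopologicalSpace H] {I : ModelWithCorners ℝ E H} [TopologicalSpace M] [ChartedSpace H M]
    [IsManifold I 1 M] [NormedAddCommGroup E'] [NormedSpace ℝ E'] [TopologicalSpace H']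
    {I' : ModelWithCorners ℝ E' H'} [TopologicalSpace M'] [ChartedSpace H' M'] [IsManifold I' 1 M']
    {f : M → M'} {U : Set M} (hU : IsOpen U) (hf : ∀ y ∈ U, ContMDiffAt I I' ∞ f y)
    {w : TangentBundle I M} (hw : w.proj ∈ U) :
    ContMDiffAt I.tangent I'.tangent ∞ (tangentMap I I' f) w := by
  have h1 : ContMDiffOn I I' ∞ f U := fun y hy => (hf y hy).contMDiffWithinAt
  have h2 := h1.contMDiffOn_tangentMapWithin (m := ∞) (by simp) hU.uniqueMDiffOn
  have h3 : Bundle.TotalSpace.proj ⁻¹' U ∈ 𝓝 w :=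
    (hU.preimage (FiberBundle.continuous_proj E (TangentSpace I : M → Type _))).mem_nhds hw
  refine (h2.contMDiffAt h3).congr_of_eventuallyEq ?_
  filter_upwards [h3] with p hp
  exact (tangentMapWithin_eq_tangentMap (hU.uniqueMDiffOn _ hp)
    ((hf _ hp).mdifferentiableAt (by simp))).symm

/-- Naturality of the exterior derivative of `1`-forms on vector spaces: the second derivative of
`s` drops out because it is symmetric. -/
theorem fderiv_pullback_antisymm {E F : Type*} [NormedAddCommGroup E] [NormedSpace ℝ E]
    [NormedAddCommGroup F] [NormedSpace ℝ F] {a : F → F →L[ℝ] ℝ} {b : E → E →L[ℝ] ℝ} {s : E → F}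
    {x : E} (ha : DifferentiableAt ℝ a (s x)) (hs : ContDiffAt ℝ ∞ s x)
    (hb : ∀ᶠ e in 𝓝 x, b e = (a (s e)).comp (fderiv ℝ s e)) (v w : E) :
    fderiv ℝ b x v w - fderiv ℝ b x w v =
      fderiv ℝ a (s x) (fderiv ℝ s x v) (fderiv ℝ s x w) -
        fderiv ℝ a (s x) (fderiv ℝ s x w) (fderiv ℝ s x v) := by
  have hsd : DifferentiableAt ℝ s x := hs.differentiableAt (by simp)
  have hsd2 : DifferentiableAt ℝ (fderiv ℝ s) x :=
    (hs.fderiv_right (m := 1) (by norm_cast)).differentiableAt (by simp)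
  have hsymm : IsSymmSndFDerivAt ℝ s x := hs.isSymmSndFDerivAt (by simp; norm_cast)
  have hD := ((ha.hasFDerivAt.comp x hsd.hasFDerivAt).clm_comp hsd2.hasFDerivAt).fderiv
  have key : ∀ v w : E, fderiv ℝ b x v w =
      a (s x) (fderiv ℝ (fderiv ℝ s) x v w) +
        fderiv ℝ a (s x) (fderiv ℝ s x v) (fderiv ℝ s x w) := by
    intro v w
    rw [(Filter.EventuallyEq.fderiv_eq hb).trans hD]
    rfl
  rw [key, key, hsymm v w]
  ring

/-- Tangent spaces at different points are the same vector space, so linear forms at equal points can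
be composed with the same map; this avoids rewriting base points in dependent types. -/
theorem covector_comp_congr {a b : C} (Θ : ∀ y : C, TangentSpace (𝓡 n) y →L[ℝ] ℝ) (h : a = b)
    {E : Type*} [AddCommGroup E] [Module ℝ E] [TopologicalSpace E]
    (L : E →L[ℝ] EuclideanSpace ℝ (Fin n)) :
    (Θ a).comp (M₂ := TangentSpace (𝓡 n) a) L = (Θ b).comp (M₂ := TangentSpace (𝓡 n) b) L := by
  subst h; rfl

/-- Naturality of the exterior derivative. The form `Θ` only has to be smooth at the points of the
tangent space at `σ x`. -/
theorem extDeriv1_pullback {Θ : ∀ y : C, TangentSpace (𝓡 n) y →L[ℝ] ℝ} {σ : A → C} {x : A}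
    (hσ : ∀ᶠ y in 𝓝 x, ContMDiffAt (𝓡 m) (𝓡 n) ∞ σ y)
    (hΘ : ∀ w : TangentBundle (𝓡 n) C, w.proj = σ x → ContMDiffAt (𝓡 n).tangent 𝓘(ℝ, ℝ) ∞
      (fun w : TangentBundle (𝓡 n) C => Θ w.proj w.snd) w) :
    extDeriv1 (fun y => (Θ (σ y)).comp (mfderiv (𝓡 m) (𝓡 n) σ y)) x =
      pullBilin (extDeriv1 Θ (σ x)) (mfderiv (𝓡 m) (𝓡 n) σ x) := by
  let Em := EuclideanSpace ℝ (Fin m)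
  let En := EuclideanSpace ℝ (Fin n)
  let φ := extChartAt (𝓡 m) x
  let ψ := extChartAt (𝓡 n) (σ x)
  let s : Em → En := fun e => ψ (σ (φ.symm e))
  let a : En → En →L[ℝ] ℝ := fun e => (Θ (ψ.symm e)).comp (mfderiv 𝓘(ℝ, En) (𝓡 n) ψ.symm e)
  have hφx : φ.symm (φ x) = x := extChartAt_to_inv x
  have hsx : s (φ x) = ψ (σ x) := by simp only [s, hφx]
  have hφt : φ.target ∈ 𝓝 (φ x) := extChartAt_target_mem_nhds x
  have hφs : ∀ e ∈ φ.target, ContMDiffAt 𝓘(ℝ, Em) (𝓡 m) ∞ φ.symm e := fun e he =>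
    (contMDiffOn_extChartAt_symm x).contMDiffAt ((isOpen_extChartAt_target x).mem_nhds he)
  have hψs : ∀ e ∈ ψ.target, ContMDiffAt 𝓘(ℝ, En) (𝓡 n) ∞ ψ.symm e := fun e he =>
    (contMDiffOn_extChartAt_symm (σ x)).contMDiffAt
      ((isOpen_extChartAt_target (σ x)).mem_nhds he)
  have hφc : Filter.Tendsto φ.symm (𝓝 (φ x)) (𝓝 x) := by
    have := (hφs (φ x) (mem_extChartAt_target x)).continuousAt.tendsto
    rwa [hφx] at this
  have hσx := hσ.self_of_nhds
  -- the points at which all the maps are smooth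
  have hev : ∀ᶠ e in 𝓝 (φ x), e ∈ φ.target ∧ ContMDiffAt (𝓡 m) (𝓡 n) ∞ σ (φ.symm e) ∧
      σ (φ.symm e) ∈ ψ.source := by
    have h1 := hφc.eventually (hσx.continuousAt.eventually
      (extChartAt_source_mem_nhds (I := 𝓡 n) (σ x)))
    filter_upwards [hφt, hφc.eventually hσ, h1] with e h1 h2 h3
    exact ⟨h1, h2, h3⟩
  have hs : ∀ e, e ∈ φ.target ∧ ContMDiffAt (𝓡 m) (𝓡 n) ∞ σ (φ.symm e) ∧
      σ (φ.symm e) ∈ ψ.source → ContDiffAt ℝ ∞ s e := by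
    rintro e ⟨h1, h2, h3⟩
    have h4 : ContMDiffAt (𝓡 n) 𝓘(ℝ, En) ∞ ψ (σ (φ.symm e)) :=
      contMDiffAt_extChartAt' (by rwa [extChartAt_source] at h3)
    exact (h4.comp e (h2.comp e (hφs e h1))).contDiffAt
  -- in the charts, `σ^* Θ` is the pullback of `a` along `s`
  have key1 : ∀ᶠ e in 𝓝 (φ x), (((Θ (σ (φ.symm e))).comp (mfderiv (𝓡 m) (𝓡 n) σ (φ.symm e))).comp
      (mfderiv 𝓘(ℝ, Em) (𝓡 m) φ.symm e) : Em →L[ℝ] ℝ) = (a (s e)).comp (fderiv ℝ s e) := by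
    filter_upwards [hev, hev.eventually_nhds] with e he he'
    have h3 : ψ.symm (s e) = σ (φ.symm e) := ψ.left_inv he.2.2
    have h4 : s e ∈ ψ.target := ψ.map_source he.2.2
    have h5 : (fun e => ψ.symm (s e)) =ᶠ[𝓝 e] fun e => σ (φ.symm e) :=
      he'.mono fun e he => ψ.left_inv he.2.2
    have h6 : mfderiv 𝓘(ℝ, Em) (𝓡 n) (fun e => ψ.symm (s e)) e =
        (mfderiv 𝓘(ℝ, En) (𝓡 n) ψ.symm (s e)).comp (mfderiv 𝓘(ℝ, Em) 𝓘(ℝ, En) s e) :=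
      mfderiv_comp e ((hψs _ h4).mdifferentiableAt (by simp))
        ((hs e he).contMDiffAt.mdifferentiableAt (by simp))
    have h7 : mfderiv 𝓘(ℝ, Em) (𝓡 n) (fun e => σ (φ.symm e)) e =
        (mfderiv (𝓡 m) (𝓡 n) σ (φ.symm e)).comp (mfderiv 𝓘(ℝ, Em) (𝓡 m) φ.symm e) :=
      mfderiv_comp e (he.2.1.mdifferentiableAt (by simp))
        ((hφs _ he.1).mdifferentiableAt (by simp))
    refine (congrArg (fun L : Em →L[ℝ] En => (Θ (σ (φ.symm e))).comp
      (M₂ := TangentSpace (𝓡 n) (σ (φ.symm e))) L) (h5.mfderiv_eq.trans h7).symm).trans ?_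
    refine (covector_comp_congr Θ h3.symm
      (mfderiv 𝓘(ℝ, Em) (𝓡 n) (fun e => ψ.symm (s e)) e : Em →L[ℝ] En)).trans ?_
    rw [h6, mfderiv_eq_fderiv]
    rfl
  have key2 : DifferentiableAt ℝ a (ψ (σ x)) := by
    refine differentiableAt_of_forall_apply fun v => ?_
    have h1 : ContMDiffAt 𝓘(ℝ, En).tangent (𝓡 n).tangent ∞
        (tangentMap 𝓘(ℝ, En) (𝓡 n) ψ.symm) (⟨ψ (σ x), v⟩ : TangentBundle 𝓘(ℝ, En) En) :=
      contMDiffAt_tangentMap (isOpen_extChartAt_target (σ x)) hψs (mem_extChartAt_target _)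
    have h2 : ContMDiffAt 𝓘(ℝ, En) 𝓘(ℝ, En).tangent ∞
        (fun e : En => (⟨e, v⟩ : TangentBundle 𝓘(ℝ, En) En)) (ψ (σ x)) :=
      contMDiffAt_vectorSpace_iff_contDiffAt.2 contDiffAt_const
    have h3 := ((hΘ _ (extChartAt_to_inv (I := 𝓡 n) (σ x))).comp _ h1).comp (ψ (σ x)) h2
    exact h3.contDiffAt.differentiableAt (by simp)
  have hT : (mfderiv (𝓡 m) (𝓡 n) σ x : Em →L[ℝ] En) = fderiv ℝ s (φ x) := by
    rw [(hσx.mdifferentiableAt (by simp)).mfderiv]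
    simp only [mfld_simps, fderivWithin_univ]
    rfl
  have key3 := fderiv_pullback_antisymm (hsx ▸ key2) (hs _ hev.self_of_nhds) key1
  rw [hsx, ← hT] at key3
  ext v w
  exact key3 v w

end Calculus

/-! ### Covers and descent of isomorphisms -/

variable {G : CompactLieGroup.{v}}

section Covers
variable {X Y : GManifold.{v, u} G}

theorem IsGCover.exists_section_on {f : GMap Y X} (hf : IsGCover f) (x : X) :
    ∃ (U : Set X) (σ : X → Y), IsOpen U ∧ x ∈ U ∧
      ∀ x' ∈ U, ContMDiffAt X.model Y.model ∞ σ x' ∧ f (σ x') = x' := by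
  obtain ⟨y, rfl⟩ := hf.surjective x
  exact exists_section_on_of_isSubmersion hf.submersion y

/-- The differential of a local section is a right inverse of the differential of the map. -/
theorem mfderiv_comp_section {f : GMap Y X} {σ : X → Y} {x : X}
    (hσ : ContMDiffAt X.model Y.model ∞ σ x) (h : ∀ᶠ x' in 𝓝 x, f (σ x') = x') :
    (mfderiv Y.model X.model f (σ x)).comp (mfderiv X.model Y.model σ x) =
      ContinuousLinearMap.id ℝ (EuclideanSpace ℝ (Fin X.dim)) := by
  have h1 : HasMFDerivAt X.model X.model (f ∘ σ) x
      ((mfderiv Y.model X.model f (σ x)).comp (mfderiv X.model Y.model σ x)) :=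
    (f.mdiff _).hasMFDerivAt.comp x (hσ.mdifferentiableAt (by simp)).hasMFDerivAt
  have h2 : HasMFDerivAt X.model X.model (f ∘ σ) x (ContinuousLinearMap.id ℝ _) :=
    (hasMFDerivAt_id x).congr_of_eventuallyEq h
  exact hasMFDerivAt_unique h1 h2

theorem IsGCover.mfderiv_surjective {f : GMap Y X} (hf : IsGCover f) (y : Y) :
    Surjective (mfderiv Y.model X.model f y) := by
  obtain ⟨σ, s1, s2, s3⟩ := hf.sections y
  have h := mfderiv_comp_section s1 s3
  rw [s2] at h
  exact fun v => ⟨mfderiv X.model Y.model σ (f y) v, DFunLike.congr_fun h v⟩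

end Covers

namespace Iso
variable {X Y : GManifold.{v, u} G} {P Q P' Q' : GBundle X}

/-- The tensor product of two isomorphisms. -/
def tensorMap (φ : Iso P P') (ψ : Iso Q Q') : Iso (P.tensor Q) (P'.tensor Q') where
  toFun x := Quotient.map' (s₁ := tensorSetoid _ _) (s₂ := tensorSetoid _ _)
    (fun a => (φ.toFun x a.1, ψ.toFun x a.2)) fun a b ⟨z, h1, h2⟩ =>
      ⟨z, by rw [← φ.map_smul, h1], by rw [← ψ.map_smul, h2]⟩
  map_smul x z p := by
    obtain ⟨a, b, rfl⟩ := tmul_surj p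
    exact congrArg (fun t => tmul t (ψ.toFun x b)) (φ.map_smul x z a)
  map_act g x y h p := by
    obtain ⟨a, b, rfl⟩ := tmul_surj p
    exact congrArg₂ tmul (φ.map_act g h a) (ψ.map_act g h b)
  smooth i j x hx :=
    ((φ.smooth i j x ⟨hx.1.1, hx.2.1⟩).mul
      (ψ.smooth i j x ⟨hx.1.2, hx.2.2⟩)).congr_of_eventuallyEq
      (Filter.Eventually.of_forall fun y => ratio_tmul (φ.toFun y (P.sec i y)) (P'.sec j y)
        (ψ.toFun y (Q.sec i y)) (Q'.sec j y))

theorem Preserves.tensorMap {φ : Iso P P'} {ψ : Iso Q Q'} {A : Connection P} {A' : Connection P'}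
    {B : Connection Q} {B' : Connection Q'} (h : φ.Preserves A A') (h' : ψ.Preserves B B') :
    (φ.tensorMap ψ).Preserves (A.tensor B) (A'.tensor B') := by
  intro i j x hx
  have e : (fun y => ratio ((φ.tensorMap ψ).toFun y ((P.tensor Q).sec i y))
      ((P'.tensor Q').sec j y)) = fun y => ratio (φ.toFun y (P.sec i y)) (P'.sec j y) *
        ratio (ψ.toFun y (Q.sec i y)) (Q'.sec j y) :=
    funext fun y => ratio_tmul _ _ _ _
  rw [e, dlog_mul (φ.smooth i j x ⟨hx.1.1, hx.2.1⟩) (ψ.smooth i j x ⟨hx.1.2, hx.2.2⟩)]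
  change A.form i x + B.form i x = A'.form j x + B'.form j x + _
  rw [h i j x ⟨hx.1.1, hx.2.1⟩, h' i j x ⟨hx.1.2, hx.2.2⟩]
  abel

theorem symm_apply (φ : Iso P Q) (x : X) (p : P.fiber x) : φ.symm.toFun x (φ.toFun x p) = p :=
  φ.injective x (φ.apply_symm x _)

section Descend
variable {f : GMap Y X} (hf : IsGCover f) (ψ : Iso (P.pull f) (Q.pull f))
  (hψ : ∀ y y' (e : f y = f y') (p : P.fiber (f y)),
    ψ.toFun y' (P.tr e p) = Q.tr e (ψ.toFun y p))

/-- The value of the descended isomorphism, computed at a chosen point of the cover. -/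
noncomputable def descendFun (x : X) (p : P.fiber x) : Q.fiber x :=
  Q.tr (hf.surjective x).choose_spec
    (ψ.toFun (hf.surjective x).choose (P.tr (hf.surjective x).choose_spec.symm p))

include hψ in
theorem descendFun_apply (y : Y) (p : P.fiber (f y)) :
    descendFun hf ψ (f y) p = ψ.toFun y p := by
  unfold descendFun
  rw [← hψ, GBundle.tr_tr, GBundle.tr_rfl]

include hψ in
theorem descendFun_smul (x : X) (z : Circle) (p : P.fiber x) :
    descendFun hf ψ x (z • p) = z • descendFun hf ψ x p := by
  obtain ⟨y, rfl⟩ := hf.surjective x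
  rw [descendFun_apply hf ψ hψ, descendFun_apply hf ψ hψ]
  exact ψ.map_smul y z p

include hψ in
theorem descendFun_ratio (i y : Y) (x : X) (h : f y = x) :
    ratio (descendFun hf ψ x (P.sec (f i) x)) (Q.sec (f i) x) =
      ratio (ψ.toFun y ((P.pull f).sec i y)) ((Q.pull f).sec i y) := by
  subst h
  rw [descendFun_apply hf ψ hψ]; rfl

/-- Descent of isomorphisms: an isomorphism of the pullbacks along a `G`-cover which agrees on
the fibers of the cover comes from an isomorphism over the base. -/
noncomputable def descend : Iso P Q where
  toFun := descendFun hf ψ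
  map_smul := descendFun_smul hf ψ hψ
  map_act g x x' h p := by
    obtain ⟨y, rfl⟩ := hf.surjective x
    obtain rfl : f (g • y) = x' := (f.map_smul g y).trans h
    rw [descendFun_apply hf ψ hψ, descendFun_apply hf ψ hψ]
    exact ψ.map_act g rfl p
  smooth := by
    refine smooth_of (descendFun_smul hf ψ hψ) fun x => ?_
    obtain ⟨y, rfl⟩ := hf.surjective x
    obtain ⟨σ, s1, s2, s3⟩ := hf.sections y
    have h1 := ψ.smooth y y y ⟨GBundle.mem_dom _ _, GBundle.mem_dom _ _⟩
    rw [← s2] at h1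
    refine (h1.comp (f y) s1).congr_of_eventuallyEq ?_
    filter_upwards [s3] with x' hx'
    rw [s2]
    exact descendFun_ratio hf ψ hψ y (σ x') x' hx'

theorem descend_apply (y : Y) (p : P.fiber (f y)) :
    (descend hf ψ hψ).toFun (f y) p = ψ.toFun y p := descendFun_apply hf ψ hψ y p

theorem descend_preserves {A : Connection P} {B : Connection Q}
    (h : ψ.Preserves (A.pull f) (B.pull f)) : (descend hf ψ hψ).Preserves A B := by
  refine preserves_of _ fun x => ?_
  obtain ⟨y, rfl⟩ := hf.surjective x
  have h1 := h y y y ⟨GBundle.mem_dom _ _, GBundle.mem_dom _ _⟩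
  have e : (fun y' => ratio (ψ.toFun y' ((P.pull f).sec y y')) ((Q.pull f).sec y y')) = fun y' =>
      ratio ((descend hf ψ hψ).toFun (f y') (P.sec (f y) (f y'))) (Q.sec (f y) (f y')) :=
    funext fun y' => (descendFun_ratio hf ψ hψ y y' _ rfl).symm
  rw [e, dlog_comp (u := fun x => ratio ((descend hf ψ hψ).toFun x (P.sec (f y) x))
    (Q.sec (f y) x)) ((descend hf ψ hψ).smooth _ _ _
      ⟨GBundle.mem_dom _ _, GBundle.mem_dom _ _⟩) (f.mdiff y)] at h1
  ext v
  obtain ⟨w, rfl⟩ := hf.mfderiv_surjective y v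
  exact DFunLike.congr_fun h1 w

end Descend
end Iso

/-! ### Descent of equivariant circle bundles -/

section LocalSections
variable {X Y : GManifold.{v, u} G} {f : GMap Y X}

namespace IsGCover
variable (hf : IsGCover f)

/-- A chosen open neighbourhood of `x` carrying a smooth section of the cover. -/
noncomputable def nbhd (x : X) : Set X := (hf.exists_section_on x).choose

/-- A chosen section of the cover; it is smooth on `hf.nbhd x`, and its values elsewhere are
irrelevant. -/
noncomputable def lsec (x : X) : X → Y := (hf.exists_section_on x).choose_spec.choose

theorem isOpen_nbhd (x : X) : IsOpen (hf.nbhd x) :=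
  (hf.exists_section_on x).choose_spec.choose_spec.1

theorem mem_nbhd (x : X) : x ∈ hf.nbhd x :=
  (hf.exists_section_on x).choose_spec.choose_spec.2.1

theorem contMDiffAt_lsec {x x' : X} (h : x' ∈ hf.nbhd x) :
    ContMDiffAt X.model Y.model ∞ (hf.lsec x) x' :=
  ((hf.exists_section_on x).choose_spec.choose_spec.2.2 x' h).1

theorem apply_lsec {x x' : X} (h : x' ∈ hf.nbhd x) : f (hf.lsec x x') = x' :=
  ((hf.exists_section_on x).choose_spec.choose_spec.2.2 x' h).2

/-- A chosen point of the cover over `x`. -/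
noncomputable def pt (x : X) : Y := hf.lsec x x

theorem apply_pt (x : X) : f (hf.pt x) = x := hf.apply_lsec (hf.mem_nbhd x)

theorem eventually_nbhd {x x' : X} (h : x' ∈ hf.nbhd x) : ∀ᶠ y in 𝓝 x', y ∈ hf.nbhd x :=
  (hf.isOpen_nbhd x).mem_nhds h

end IsGCover
end LocalSections

/-- A descent datum for equivariant circle bundles along a `G`-cover `f : Y → X`: a bundle `K` on
`Y` and an isomorphism between its two pullbacks to `Y ×_X Y` satisfying the cocycle condition. -/
structure DescentDatum {X Y : GManifold.{v, u} G} (f : GMap Y X) (hf : IsGCover f) where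
  K : GBundle Y
  glue : Iso (K.pull (fiberProd.fst f f hf)) (K.pull (fiberProd.snd f f hf))
  cocycle : ∀ {y y' y'' : Y} (h : f y = f y') (h' : f y' = f y'') (k : K.fiber y),
    glue.toFun (fiberProd.mk hf y' y'' h') (glue.toFun (fiberProd.mk hf y y' h) k) =
      glue.toFun (fiberProd.mk hf y y'' (h.trans h')) k

namespace DescentDatum
variable {X Y : GManifold.{v, u} G} {f : GMap Y X} {hf : IsGCover f} (D : DescentDatum f hf)

/-- The gluing isomorphism on points. -/
noncomputable def move {y y' : Y} (h : f y = f y') (k : D.K.fiber y) : D.K.fiber y' :=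
  D.glue.toFun (fiberProd.mk hf y y' h) k

theorem move_move {y y' y'' : Y} (h : f y = f y') (h' : f y' = f y'') (k : D.K.fiber y) :
    D.move h' (D.move h k) = D.move (h.trans h') k := D.cocycle h h' k

theorem move_self {y : Y} (h : f y = f y) (k : D.K.fiber y) : D.move h k = k :=
  D.glue.injective (fiberProd.mk hf y y h) (D.cocycle h h k)

theorem move_smul {y y' : Y} (h : f y = f y') (z : Circle) (k : D.K.fiber y) :
    D.move h (z • k) = z • D.move h k := D.glue.map_smul (fiberProd.mk hf y y' h) z k

theorem ratio_move {y y' : Y} (h : f y = f y') (k k' : D.K.fiber y) :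
    ratio (D.move h k) (D.move h k') = ratio k k' := ratio_map (D.move_smul h) k k'

theorem act_move (g : G) {y y' w w' : Y} (h : f y = f y') (hw : g • y = w) (hw' : g • y' = w')
    (h' : f w = f w') (k : D.K.fiber y) :
    D.K.act g hw' (D.move h k) = D.move h' (D.K.act g hw k) := by
  subst hw hw'
  exact (D.glue.map_act g (x := fiberProd.mk hf y y' h) rfl k).symm

/-- The gluing isomorphism at `(y, y')` in the local trivializations `i` and `j` of `K` (and `1`
if `y` and `y'` lie in different fibers). -/
noncomputable def transition (i j y y' : Y) : Circle :=
  open Classical in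
  if h : f y = f y' then ratio (D.move h (D.K.sec i y)) (D.K.sec j y') else 1

theorem transition_of_eq (i j : Y) {y y' : Y} (h : f y = f y') :
    D.transition i j y y' = ratio (D.move h (D.K.sec i y)) (D.K.sec j y') := dif_pos h

section Transition
variable {i j : Y}

/-- Locally, two maps to `Y` which agree over `X` are the components of a map to `Y ×_X Y`, and the
transition function along them is that of the gluing isomorphism. The indices of the trivializations
over `Y ×_X Y` are points of that space; the diagonal points stand for `i` and `j`. -/
theorem exists_transition_eq {EN HN N : Type*} [NormedAddCommGroup EN] [NormedSpace ℝ EN]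
    [TopologicalSpace HN] {J : ModelWithCorners ℝ EN HN} [TopologicalSpace N] [ChartedSpace HN N]
    {a b : N → Y} {x : N} (ha : ContMDiffAt J Y.model ∞ a x) (hb : ContMDiffAt J Y.model ∞ b x)
    (h : ∀ᶠ t in 𝓝 x, f (a t) = f (b t)) :
    ∃ k : N → fiberProd f f hf, ContMDiffAt J (fiberProd f f hf).model ∞ k x ∧
      (∀ᶠ t in 𝓝 x, fiberProd.fst f f hf (k t) = a t) ∧
      (∀ᶠ t in 𝓝 x, fiberProd.snd f f hf (k t) = b t) ∧
      ∀ᶠ t in 𝓝 x, D.transition i j (a t) (b t) =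
        ratio (D.glue.toFun (k t) ((D.K.pull (fiberProd.fst f f hf)).sec
          (fiberProd.mk hf i i rfl) (k t))) ((D.K.pull (fiberProd.snd f f hf)).sec
            (fiberProd.mk hf j j rfl) (k t)) := by
  obtain ⟨k, k1, -, k3⟩ := fiberProd.exists_mk_section (hf := hf) (g := f) (fiberProd.mk hf (a x)
    (b x) h.self_of_nhds) ha hb h rfl rfl
  refine ⟨k, k1, k3.mono fun _ h => h.1, k3.mono fun _ h => h.2, ?_⟩
  filter_upwards [k3] with t ht
  rw [← ht.1, ← ht.2]
  exact D.transition_of_eq i j (fiberProd.condition (k t))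

theorem contMDiffAt_transition {EN HN N : Type*} [NormedAddCommGroup EN] [NormedSpace ℝ EN]
    [TopologicalSpace HN] {J : ModelWithCorners ℝ EN HN} [TopologicalSpace N] [ChartedSpace HN N]
    {a b : N → Y} {x : N} (ha : ContMDiffAt J Y.model ∞ a x) (hb : ContMDiffAt J Y.model ∞ b x)
    (h : ∀ᶠ t in 𝓝 x, f (a t) = f (b t)) (hi : a x ∈ D.K.dom i) (hj : b x ∈ D.K.dom j) :
    ContMDiffAt J (𝓡 1) ∞ (fun t => D.transition i j (a t) (b t)) x := by
  obtain ⟨k, k1, k2, k3, k4⟩ := D.exists_transition_eq (i := i) (j := j) ha hb h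
  refine ((D.glue.smooth (fiberProd.mk hf i i rfl) (fiberProd.mk hf j j rfl) (k x)
    ⟨?_, ?_⟩).comp x k1).congr_of_eventuallyEq k4
  · change fiberProd.fst f f hf (k x) ∈ D.K.dom i
    rw [k2.self_of_nhds]; exact hi
  · change fiberProd.snd f f hf (k x) ∈ D.K.dom j
    rw [k3.self_of_nhds]; exact hj

/-- A connection preserved by the gluing isomorphism, restricted along two maps to `Y` which agree
over `X`: the two restrictions differ by the logarithmic differential of the transition function. -/
theorem form_eq_add_dlog_transition {n : ℕ} {N : Type*} [TopologicalSpace N]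
    [ChartedSpace (EuclideanSpace ℝ (Fin n)) N]
    {A : Connection D.K}
    (hA : D.glue.Preserves (A.pull (fiberProd.fst f f hf)) (A.pull (fiberProd.snd f f hf)))
    {a b : N → Y} {x : N} (ha : ContMDiffAt (𝓡 n) Y.model ∞ a x)
    (hb : ContMDiffAt (𝓡 n) Y.model ∞ b x)
    (h : ∀ᶠ t in 𝓝 x, f (a t) = f (b t)) (hi : a x ∈ D.K.dom i) (hj : b x ∈ D.K.dom j) :
    (A.form i (a x)).comp (mfderiv (𝓡 n) Y.model a x) =
      (A.form j (b x)).comp (mfderiv (𝓡 n) Y.model b x) +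
        dlog n (fun t => D.transition i j (a t) (b t)) x := by
  obtain ⟨k, k1, k2, k3, k4⟩ := D.exists_transition_eq (i := i) (j := j) ha hb h
  have hk : MDifferentiableAt (𝓡 n) (fiberProd f f hf).model k x := k1.mdifferentiableAt (by simp)
  have hmem : k x ∈ (D.K.pull (fiberProd.fst f f hf)).dom (fiberProd.mk hf i i rfl) ∩
      (D.K.pull (fiberProd.snd f f hf)).dom (fiberProd.mk hf j j rfl) := by
    refine ⟨?_, ?_⟩
    · change fiberProd.fst f f hf (k x) ∈ D.K.dom i
      rw [k2.self_of_nhds]; exact hi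
    · change fiberProd.snd f f hf (k x) ∈ D.K.dom j
      rw [k3.self_of_nhds]; exact hj
  have h1 := hA (fiberProd.mk hf i i rfl) (fiberProd.mk hf j j rfl) (k x) hmem
  have e1 : mfderiv (𝓡 n) Y.model a x = (mfderiv (fiberProd f f hf).model Y.model
      (fiberProd.fst f f hf) (k x)).comp (mfderiv (𝓡 n) (fiberProd f f hf).model k x) :=
    (Filter.EventuallyEq.mfderiv_eq (k2.mono fun _ h => h.symm)).trans
      (mfderiv_comp x ((fiberProd.fst f f hf).mdiff _) hk)
  have e2 : mfderiv (𝓡 n) Y.model b x = (mfderiv (fiberProd f f hf).model Y.model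
      (fiberProd.snd f f hf) (k x)).comp (mfderiv (𝓡 n) (fiberProd f f hf).model k x) :=
    (Filter.EventuallyEq.mfderiv_eq (k3.mono fun _ h => h.symm)).trans
      (mfderiv_comp x ((fiberProd.snd f f hf).mdiff _) hk)
  rw [dlog_congr k4, dlog_comp (D.glue.smooth _ _ (k x) hmem) hk]
  refine (congrArg ((A.form i (a x)).comp) e1).trans ?_
  refine (covector_comp_congr (A.form i) k2.self_of_nhds.symm _).trans ?_
  refine Eq.trans ?_ (congrArg (fun L => L + _)
    ((congrArg ((A.form j (b x)).comp) e2).trans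
      (covector_comp_congr (A.form j) k3.self_of_nhds.symm _)).symm)
  ext t
  exact DFunLike.congr_fun h1 _

end Transition

/-- The section of the descended bundle over the neighbourhood of `i`, transported to the chosen
points of the fibers. -/
noncomputable def descendSec (i x : X) : D.K.fiber (hf.pt x) :=
  open Classical in
  if h : f (hf.lsec i x) = x then
    D.move (h.trans (hf.apply_pt x).symm) (D.K.sec (hf.pt i) (hf.lsec i x))
  else D.K.sec (hf.pt x) (hf.pt x)

theorem descendSec_of_mem {i x : X} (h : x ∈ hf.nbhd i) : D.descendSec i x =
    D.move ((hf.apply_lsec h).trans (hf.apply_pt x).symm) (D.K.sec (hf.pt i) (hf.lsec i x)) :=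
  dif_pos (hf.apply_lsec h)

theorem move_descendSec {i x : X} (h : x ∈ hf.nbhd i) {y : Y} (hy : f (hf.pt x) = f y) (j : Y) :
    ratio (D.move hy (D.descendSec i x)) (D.K.sec j y) =
      D.transition (hf.pt i) j (hf.lsec i x) y := by
  rw [D.descendSec_of_mem h, D.move_move]
  exact (D.transition_of_eq _ _ _).symm

theorem ratio_descendSec {i j x : X} (hi : x ∈ hf.nbhd i) (hj : x ∈ hf.nbhd j) :
    ratio (D.descendSec i x) (D.descendSec j x) =
      D.transition (hf.pt i) (hf.pt j) (hf.lsec i x) (hf.lsec j x) := by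
  have h : f (hf.pt x) = f (hf.lsec j x) := (hf.apply_pt x).trans (hf.apply_lsec hj).symm
  rw [← D.move_descendSec hi h, ← D.ratio_move h]
  congr 1
  rw [D.descendSec_of_mem hj, D.move_move, D.move_self]

/-- The lift of the action to the descended bundle. -/
noncomputable def descendAct (g : G) {x x' : X} (h : g • x = x') (k : D.K.fiber (hf.pt x)) :
    D.K.fiber (hf.pt x') :=
  D.move (by rw [f.map_smul, hf.apply_pt, hf.apply_pt, h]) (D.K.act g (x := hf.pt x) rfl k)

/-- The action on the descended bundle in local trivializations. The intermediate index `l` is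
arbitrary: it factors the map through the fiber of `K` at `g • hf.lsec i x`. -/
theorem ratio_descendAct (g : G) {i j x : X} (hi : x ∈ hf.nbhd i) (hj : g • x ∈ hf.nbhd j)
    (l : Y) :
    ratio (D.descendAct g (x := x) rfl (D.descendSec i x)) (D.descendSec j (g • x)) =
      ratio (D.K.act g (x := hf.lsec i x) rfl (D.K.sec (hf.pt i) (hf.lsec i x)))
        (D.K.sec l (g • hf.lsec i x)) *
      D.transition l (hf.pt j) (g • hf.lsec i x) (hf.lsec j (g • x)) := by
  have h1 : f (hf.pt (g • x)) = f (hf.lsec j (g • x)) :=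
    (hf.apply_pt _).trans (hf.apply_lsec hj).symm
  have h2 : f (g • hf.lsec i x) = f (hf.lsec j (g • x)) := by
    rw [f.map_smul, hf.apply_lsec hi, hf.apply_lsec hj]
  have h3 : f (g • hf.lsec i x) = f (g • hf.pt x) := by
    rw [f.map_smul, f.map_smul, hf.apply_lsec hi, hf.apply_pt]
  rw [D.transition_of_eq l _ h2, ← D.ratio_move h2, ratio_mul, ← D.ratio_move h1]
  congr 1
  · rw [descendAct, D.descendSec_of_mem hi, D.act_move g _ rfl rfl h3, D.move_move, D.move_move]
  · rw [D.descendSec_of_mem hj, D.move_move, D.move_self]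

/-- The descended bundle. Its fiber at `x` is the fiber of `K` at the chosen point over `x`, and
its local sections are those of `K` along local sections of the cover, moved to the chosen points
by the gluing isomorphism. -/
noncomputable def descend : GBundle X where
  fiber x := D.K.fiber (hf.pt x)
  dom i := hf.nbhd i ∩ hf.lsec i ⁻¹' D.K.dom (hf.pt i)
  isOpen_dom i := ContinuousOn.isOpen_inter_preimage
    (fun _ hx => (hf.contMDiffAt_lsec hx).continuousAt.continuousWithinAt) (hf.isOpen_nbhd i)
    (D.K.isOpen_dom _)
  mem_dom i := ⟨hf.mem_nbhd i, D.K.mem_dom _⟩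
  sec := D.descendSec
  smooth_sec i j x hx := by
    refine (D.contMDiffAt_transition (hf.contMDiffAt_lsec hx.1.1) (hf.contMDiffAt_lsec hx.2.1) ?_
      hx.1.2 hx.2.2).congr_of_eventuallyEq ?_
    · filter_upwards [hf.eventually_nbhd hx.1.1, hf.eventually_nbhd hx.2.1] with t h1 h2
      rw [hf.apply_lsec h1, hf.apply_lsec h2]
    · filter_upwards [hf.eventually_nbhd hx.1.1, hf.eventually_nbhd hx.2.1] with t h1 h2
      exact D.ratio_descendSec h1 h2
  act g _ _ h := D.descendAct g h
  act_smul g x y h z p := by rw [descendAct, D.K.act_smul, D.move_smul]; rfl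
  one_act {x} h p := by
    have h1 : f ((1 : G) • hf.pt x) = f (hf.pt x) := by rw [one_smul]
    have key : ∀ (y : Y) (hy : (1 : G) • hf.pt x = y) (h' : f y = f (hf.pt x)),
        y = hf.pt x → D.move h' (D.K.act 1 hy p) = p := by
      intro y hy h' e
      subst e
      rw [D.K.one_act, D.move_self]
    exact key _ rfl _ (one_smul _ _)
  mul_act g g' x y w h h' h'' p := by
    have e : f ((g * g') • hf.pt x) = f (g • hf.pt y) := by
      rw [f.map_smul, f.map_smul, hf.apply_pt, hf.apply_pt, ← h, mul_smul]
    unfold descendAct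
    rw [D.act_move g _ (mul_smul g g' _).symm rfl e, D.move_move,
      ← D.K.mul_act g g' rfl (mul_smul g g' _).symm rfl]
  smooth_act i j g x hx hg := by
    have h1 : ContMDiffAt ((𝓡 G.dim).prod X.model) Y.model ∞
        (fun q : G × X => hf.lsec i q.2) (g, x) :=
      (hf.contMDiffAt_lsec hx.1).comp (g, x) contMDiffAt_snd
    have h2 : ContMDiffAt ((𝓡 G.dim).prod X.model) Y.model ∞
        (fun q : G × X => q.1 • hf.lsec i q.2) (g, x) := contMDiffAt_fst.smul h1
    have h3 : ContMDiffAt ((𝓡 G.dim).prod X.model) X.model ∞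
        (fun q : G × X => q.1 • q.2) (g, x) := contMDiffAt_fst.smul contMDiffAt_snd
    have h4 : ContMDiffAt ((𝓡 G.dim).prod X.model) Y.model ∞
        (fun q : G × X => hf.lsec j (q.1 • q.2)) (g, x) :=
      ContMDiffAt.comp (I' := X.model) (g, x) (hf.contMDiffAt_lsec hg.1) h3
    have e1 := (continuousAt_snd (p := (g, x))).eventually (hf.eventually_nbhd hx.1)
    have e2 := h3.continuousAt.eventually (hf.eventually_nbhd hg.1)
    have h5 := D.contMDiffAt_transition (i := g • hf.lsec i x) (j := hf.pt j) h2 h4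
      (by
        filter_upwards [e1, e2] with q h1 h2
        rw [f.map_smul, hf.apply_lsec h1, hf.apply_lsec h2]) (D.K.mem_dom _) hg.2
    have h6 := (D.K.smooth_act (hf.pt i) (g • hf.lsec i x) g (hf.lsec i x) hx.2
      (D.K.mem_dom _)).comp (g, x) (f := fun q : G × X => (q.1, hf.lsec i q.2))
      (contMDiffAt_fst.prodMk h1)
    refine (h6.mul h5).congr_of_eventuallyEq ?_
    filter_upwards [e1, e2] with q h1 h2
    exact D.ratio_descendAct q.1 h1 h2 _

/-- The canonical isomorphism between the pullback of the descended bundle and `K`. -/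
noncomputable def descendIso : Iso (D.descend.pull f) D.K where
  toFun y := D.move (hf.apply_pt (f y))
  map_smul y := D.move_smul _
  map_act g y y' h k := by
    subst h
    have e : f (g • hf.pt (f y)) = f (g • y) := by rw [f.map_smul, f.map_smul, hf.apply_pt]
    exact (D.move_move _ _ _).trans (D.act_move g _ rfl rfl e k).symm
  smooth := by
    refine Iso.smooth_of (P := D.descend.pull f) (φ := fun y => D.move (hf.apply_pt (f y)))
      (fun y => D.move_smul _) fun y => ?_
    have h1 : ContMDiffAt Y.model Y.model ∞ (fun t => hf.lsec (f y) (f t)) y :=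
      (hf.contMDiffAt_lsec (hf.mem_nbhd (f y))).comp y (f.contMDiffAt y)
    have e1 := (f.contMDiffAt y).continuousAt.eventually
      (hf.eventually_nbhd (hf.mem_nbhd (f y)))
    refine (D.contMDiffAt_transition (i := hf.pt (f y)) (j := y) h1 contMDiffAt_id ?_
      (D.K.mem_dom _) (D.K.mem_dom _)).congr_of_eventuallyEq ?_
    · filter_upwards [e1] with t ht
      exact hf.apply_lsec ht
    · filter_upwards [e1] with t ht
      exact D.move_descendSec ht _ _

end DescentDatum

/-! ### Descent of connections and their curvature -/

namespace DescentDatum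
variable {X Y : GManifold.{v, u} G} {f : GMap Y X} {hf : IsGCover f} (D : DescentDatum f hf)
  (A : Connection D.K)

/-- The local forms of the descended connection: those of `A`, pulled back along the local
sections of the cover. -/
noncomputable def descendForm (i x : X) : TangentSpace X.model x →L[ℝ] ℝ :=
  (A.form (hf.pt i) (hf.lsec i x)).comp (mfderiv X.model Y.model (hf.lsec i) x)

variable {A}
  (hA : D.glue.Preserves (A.pull (fiberProd.fst f f hf)) (A.pull (fiberProd.snd f f hf)))

include hA in
theorem descendForm_gauge (i j x : X) (hx : x ∈ D.descend.dom i ∩ D.descend.dom j) :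
    D.descendForm A i x = D.descendForm A j x +
      dlog X.dim (fun y => ratio (D.descend.sec i y) (D.descend.sec j y)) x := by
  have e1 := hf.eventually_nbhd hx.1.1
  have e2 := hf.eventually_nbhd hx.2.1
  have e : dlog X.dim (fun y => ratio (D.descend.sec i y) (D.descend.sec j y)) x = _ :=
    dlog_congr (e1.and e2 |>.mono fun t ht => D.ratio_descendSec ht.1 ht.2)
  rw [e]
  refine D.form_eq_add_dlog_transition hA (hf.contMDiffAt_lsec hx.1.1)
    (hf.contMDiffAt_lsec hx.2.1) ?_ hx.1.2 hx.2.2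
  filter_upwards [e1, e2] with t h1 h2
  rw [hf.apply_lsec h1, hf.apply_lsec h2]

/-- Invariance of `A`, pulled back along a local section of the cover. -/
theorem dlog_act_sec (A : Connection D.K) {i : X} (g : G) {x : X} (hx : x ∈ D.descend.dom i) :
    (A.form (hf.pt i) (hf.lsec i x)).comp (mfderiv X.model Y.model (hf.lsec i) x) =
      (A.form (g • hf.lsec i x) (g • hf.lsec i x)).comp
        (mfderiv X.model Y.model (fun t => g • hf.lsec i t) x) +
      dlog X.dim (fun t => ratio (D.K.act g (x := hf.lsec i t) rfl (D.K.sec (hf.pt i) (hf.lsec i t)))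
        (D.K.sec (g • hf.lsec i x) (g • hf.lsec i t))) x := by
  have h0 : MDifferentiableAt X.model Y.model (hf.lsec i) x :=
    (hf.contMDiffAt_lsec hx.1).mdifferentiableAt (by simp)
  have h1 : mfderiv X.model Y.model (fun t => g • hf.lsec i t) x =
      (mfderiv Y.model Y.model (fun y => g • y) (hf.lsec i x)).comp
        (mfderiv X.model Y.model (hf.lsec i) x) :=
    mfderiv_comp x (Y.mdiff_smul g _) h0
  rw [dlog_comp (u := fun y => ratio (D.K.act g (y := g • y) rfl (D.K.sec (hf.pt i) y))
    (D.K.sec (g • hf.lsec i x) (g • y))) (D.K.smooth_act' _ _ g _ hx.2 (D.K.mem_dom _)) h0,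
    A.invariant _ _ g _ hx.2 (D.K.mem_dom (g • hf.lsec i x)), ContinuousLinearMap.add_comp, h1]
  rfl

include hA in
theorem descendForm_invariant (i j : X) (g : G) (x : X) (hx : x ∈ D.descend.dom i)
    (hg : g • x ∈ D.descend.dom j) :
    D.descendForm A i x = (D.descendForm A j (g • x)).comp
        (mfderiv X.model X.model (fun y => g • y) x) +
      dlog X.dim (fun y => ratio (D.descend.act g (y := g • y) rfl (D.descend.sec i y))
        (D.descend.sec j (g • y))) x := by
  have hs : ContMDiffAt X.model X.model ∞ (fun t : X => g • t) x :=
    ((contMDiff_const (I := X.model) (I' := 𝓡 G.dim) (c := g)).smul contMDiff_id :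
      ContMDiff X.model X.model ∞ fun y : X => g • y) x
  have e1 := hf.eventually_nbhd hx.1
  have e2 := hs.continuousAt.eventually (hf.eventually_nbhd hg.1)
  have e : dlog X.dim (fun y => ratio (D.descend.act g (y := g • y) rfl (D.descend.sec i y))
      (D.descend.sec j (g • y))) x = _ :=
    dlog_congr (e1.and e2 |>.mono fun t ht =>
      D.ratio_descendAct g ht.1 ht.2 (g • hf.lsec i x))
  have ha : ContMDiffAt X.model Y.model ∞ (fun t => g • hf.lsec i t) x :=
    (contMDiffAt_const (I' := 𝓡 G.dim) (c := g)).smul (hf.contMDiffAt_lsec hx.1)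
  have hb : ContMDiffAt X.model Y.model ∞ (fun t => hf.lsec j (g • t)) x :=
    ContMDiffAt.comp (I' := X.model) x (hf.contMDiffAt_lsec hg.1) hs
  have hab : ∀ᶠ t in 𝓝 x, f (g • hf.lsec i t) = f (hf.lsec j (g • t)) := by
    filter_upwards [e1, e2] with t h1 h2
    rw [f.map_smul, hf.apply_lsec h1, hf.apply_lsec h2]
  have h1 : mfderiv X.model Y.model (fun t => hf.lsec j (g • t)) x =
      (mfderiv X.model Y.model (hf.lsec j) (g • x)).comp
        (mfderiv X.model X.model (fun y => g • y) x) :=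
    mfderiv_comp x ((hf.contMDiffAt_lsec hg.1).mdifferentiableAt (by simp)) (X.mdiff_smul g x)
  have h2 := D.form_eq_add_dlog_transition hA (i := g • hf.lsec i x) ha hb hab (D.K.mem_dom _) hg.2
  have h3 := D.dlog_act_sec A g hx
  have h4 : ContMDiffAt X.model (𝓡 1) ∞ (fun t => ratio (D.K.act g (x := hf.lsec i t) rfl
      (D.K.sec (hf.pt i) (hf.lsec i t))) (D.K.sec (g • hf.lsec i x) (g • hf.lsec i t))) x :=
    (D.K.smooth_act' (hf.pt i) (g • hf.lsec i x) g (hf.lsec i x) hx.2 (D.K.mem_dom _)).comp x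
      (hf.contMDiffAt_lsec hx.1)
  rw [e, dlog_mul h4 (D.contMDiffAt_transition ha hb hab (D.K.mem_dom _) hg.2)]
  rw [h2, h1] at h3
  refine h3.trans ?_
  unfold descendForm
  rw [ContinuousLinearMap.comp_assoc]
  abel

/-- The descended connection. -/
noncomputable def descendConn : Connection D.descend where
  form := D.descendForm A
  smooth i w hw :=
    (A.smooth (hf.pt i) (tangentMap X.model Y.model (hf.lsec i) w) hw.2).comp w
      (contMDiffAt_tangentMap (hf.isOpen_nbhd i) (fun _ h => hf.contMDiffAt_lsec h) hw.1)
  gauge := D.descendForm_gauge hA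
  invariant := D.descendForm_invariant hA

theorem descendIso_preserves : D.descendIso.Preserves ((D.descendConn hA).pull f) A := by
  refine Iso.preserves_of _ fun y => ?_
  have h0 := hf.contMDiffAt_lsec (hf.mem_nbhd (f y))
  have h1 : ContMDiffAt Y.model Y.model ∞ (fun t => hf.lsec (f y) (f t)) y :=
    h0.comp y (f.contMDiffAt y)
  have e1 := (f.contMDiffAt y).continuousAt.eventually (hf.eventually_nbhd (hf.mem_nbhd (f y)))
  have h2 := D.form_eq_add_dlog_transition hA (i := hf.pt (f y)) (j := y) h1 contMDiffAt_id
    (by filter_upwards [e1] with t ht; exact hf.apply_lsec ht) (D.K.mem_dom _) (D.K.mem_dom _)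
  have e : dlog Y.dim (fun t => ratio (D.descendIso.toFun t ((D.descend.pull f).sec y t))
      (D.K.sec y t)) y = _ :=
    dlog_congr (e1.mono fun t ht => D.move_descendSec ht _ _)
  have h3 : mfderiv Y.model Y.model (fun t => hf.lsec (f y) (f t)) y =
      (mfderiv X.model Y.model (hf.lsec (f y)) (f y)).comp (mfderiv Y.model X.model f y) :=
    mfderiv_comp y (h0.mdifferentiableAt (by simp)) (f.mdiff y)
  have h4 : mfderiv Y.model Y.model (fun t : Y => t) y = ContinuousLinearMap.id ℝ _ := mfderiv_id
  rw [e]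
  refine Eq.trans ?_ (h2.trans (congrArg (· + _) ?_))
  · rw [h3]; rfl
  · exact (congrArg ((A.form y y).comp) h4).trans (ContinuousLinearMap.comp_id _)

/-- The curvature of the descended connection is the pullback of the curvature of `A` along the
local sections of the cover. -/
theorem curv_descendConn_form (x : X) :
    (D.descendConn hA).curv.form x =
      pullBilin (A.curv.form (hf.pt x)) (mfderiv X.model Y.model (hf.lsec x) x) := by
  refine extDeriv1_pullback ?_ ?_
  · filter_upwards [hf.eventually_nbhd (hf.mem_nbhd x)] with t ht
    exact hf.contMDiffAt_lsec ht
  · intro w hw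
    refine A.smooth (hf.pt x) w ?_
    rw [hw]; exact D.K.mem_dom _

/-- The moment part of the curvature. Along the orbit of the chosen point over `x`, moving by `g` and
then back to the local section contributes a transition term, whose logarithmic differential is the
difference between the values of `A` on the fundamental vector field of `Y` and on the image of that
of `X` under the local section. -/
theorem curv_descendConn_moment (x : X) :
    (D.descendConn hA).curv.moment x = A.curv.moment (hf.pt x) := by
  have h0 := hf.contMDiffAt_lsec (hf.mem_nbhd x)
  have ho : ContMDiffAt (𝓡 G.dim) X.model ∞ (fun g : G => g • x) 1 :=
    contMDiffAt_id.smul contMDiffAt_const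
  have ha : ContMDiffAt (𝓡 G.dim) Y.model ∞ (fun g : G => g • hf.pt x) 1 :=
    contMDiffAt_id.smul contMDiffAt_const
  have hx : (1 : G) • x ∈ hf.nbhd x := by rw [one_smul]; exact hf.mem_nbhd x
  have h1 := hf.contMDiffAt_lsec hx
  have hb : ContMDiffAt (𝓡 G.dim) Y.model ∞ (fun g : G => hf.lsec x (g • x)) 1 :=
    ContMDiffAt.comp (I' := X.model) 1 h1 ho
  have hev := ho.continuousAt.eventually (hf.eventually_nbhd hx)
  have hab : ∀ᶠ g : G in 𝓝 1, f (g • hf.pt x) = f (hf.lsec x (g • x)) := by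
    filter_upwards [hev] with g hg
    rw [f.map_smul, hf.apply_pt, hf.apply_lsec hg]
  have hi : (1 : G) • hf.pt x ∈ D.K.dom (hf.pt x) := by rw [one_smul]; exact D.K.mem_dom _
  have hj : hf.lsec x ((1 : G) • x) ∈ D.K.dom (hf.pt x) := by rw [one_smul]; exact D.K.mem_dom _
  have hu : ContMDiffAt (𝓡 G.dim) (𝓡 1) ∞ (fun g : G => ratio
      (D.K.act g (x := hf.pt x) rfl (D.K.sec (hf.pt x) (hf.pt x)))
      (D.K.sec (hf.pt x) (g • hf.pt x))) 1 :=
    (D.K.smooth_act (hf.pt x) (hf.pt x) 1 (hf.pt x) (D.K.mem_dom _) hi).comp 1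
      (f := fun g : G => (g, hf.pt x)) (contMDiffAt_id.prodMk contMDiffAt_const)
  have e : dlog G.dim (fun g : G => ratio (D.descend.act g (y := g • x) rfl (D.descend.sec x x))
      (D.descend.sec x (g • x))) 1 = _ :=
    dlog_congr (hev.mono fun g hg =>
      D.ratio_descendAct g (hf.mem_nbhd x) hg (hf.pt x))
  have h2 := D.form_eq_add_dlog_transition hA (i := hf.pt x) (j := hf.pt x) ha hb hab hi hj
  have h3 : mfderiv (𝓡 G.dim) Y.model (fun g : G => hf.lsec x (g • x)) 1 =
      (mfderiv X.model Y.model (hf.lsec x) ((1 : G) • x)).comp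
        (mfderiv (𝓡 G.dim) X.model (fun g : G => g • x) 1) :=
    mfderiv_comp 1 (h1.mdifferentiableAt (by simp)) (ho.mdifferentiableAt (by simp))
  have h4 : (A.form (hf.pt x) (hf.pt x)).comp (Y.fundamental (hf.pt x)) =
      (D.descendForm A x x).comp (X.fundamental x) + _ :=
    ((covector_comp_congr (A.form (hf.pt x)) (one_smul G (hf.pt x)) _).symm.trans h2).trans
      (congrArg (· + _) ((congrArg ((A.form (hf.pt x) (hf.lsec x ((1 : G) • x))).comp) h3).trans
        (covector_comp_congr (D.descendForm A x) (one_smul G x) _)))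
  refine congrArg Neg.neg ?_
  change (D.descendForm A x x).comp (X.fundamental x) + _ =
    (A.form (hf.pt x) (hf.pt x)).comp (Y.fundamental (hf.pt x)) + _
  rw [h4, e]
  refine (congrArg (_ + ·) (dlog_mul hu (D.contMDiffAt_transition ha hb hab hi hj))).trans ?_
  rw [add_assoc]
  exact congrArg (_ + ·) (add_comm _ _)

end DescentDatum

/-! ### Descent of the isomorphism `α` -/

namespace GBundle
variable {X Y : GManifold.{v, u} G}

theorem tensor_tr (P Q : GBundle X) {x y : X} (h : x = y) (p : P.fiber x) (q : Q.fiber x) :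
    (P.tensor Q).tr h (tmul p q) = tmul (P.tr h p) (Q.tr h q) := by subst h; rfl

theorem pull_tr (P : GBundle Y) (f : GMap X Y) {x y : X} (h : x = y) (p : P.fiber (f x)) :
    (P.pull f).tr h p = P.tr (congrArg f h) p := by subst h; rfl

end GBundle

theorem DescentDatum.descendIso_tr {X Y : GManifold.{v, u} G} {f : GMap Y X} {hf : IsGCover f}
    (D : DescentDatum f hf) {y y' : Y} (e : f y = f y') (k : D.descend.fiber (f y)) :
    D.descendIso.toFun y' (D.descend.tr e k) = D.move e (D.descendIso.toFun y k) := by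
  have key : ∀ (x : X) (e : f y = x) (h : f (hf.pt x) = f y') (h' : f y = f y'),
      D.move h (D.descend.tr e k) = D.move h' (D.descendIso.toFun y k) := by
    intro x e h h'
    subst e
    exact (D.move_move _ _ _).symm
  exact key _ e _ _

namespace IsoData
open Gerbe (fst snd base base_cover fstSq sndSq snd_eq)
variable {M : GManifold.{v, u} G} {L₁ L₂ : Gerbe M} {Z : GManifold.{v, u} G}
  {ζ : GMap Z (L₁.prod L₂)} {hζ : IsGCover ζ}

variable (ζ hζ) in
/-- The map `Z ×_M Z → P ×_M P` induced by a cover `Z → P = Y₁ ×_M Y₂`. -/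
noncomputable def sqMap : GMap (sq (base L₁ L₂ ζ) (base_cover L₁ L₂ ζ hζ))
    (sq (base L₁ L₂ (GMap.id (L₁.prod L₂))) (base_cover L₁ L₂ _ (IsGCover.id _))) :=
  fiberProd.lift _ ((fiberProd.fst _ _ _).comp ζ) ((fiberProd.snd _ _ _).comp ζ)
    fun p => fiberProd.condition p

variable (ζ hζ) in
theorem sqMap_cover : IsGCover (sqMap ζ hζ) := by
  refine IsGCover.of_sections (fun p => ?_) fun x => ?_
  · obtain ⟨z, hz⟩ := hζ.surjective (fiberProd.fst _ _ _ p)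
    obtain ⟨z', hz'⟩ := hζ.surjective (fiberProd.snd _ _ _ p)
    refine ⟨fiberProd.mk _ z z' ?_, fiberProd.ext hz hz'⟩
    have h := fiberProd.condition p
    rw [← hz, ← hz'] at h
    exact h
  · let P2 := sq (base L₁ L₂ (GMap.id (L₁.prod L₂))) (base_cover L₁ L₂ _ (IsGCover.id _))
    let p1 : GMap P2 (L₁.prod L₂) := fiberProd.fst _ _ _
    let p2 : GMap P2 (L₁.prod L₂) := fiberProd.snd _ _ _
    obtain ⟨σ, s1, s2, s3⟩ := hζ.sections (fiberProd.fst _ _ _ x)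
    obtain ⟨σ', s1', s2', s3'⟩ := hζ.sections (fiberProd.snd _ _ _ x)
    have t3 := (p1.contMDiffAt (sqMap ζ hζ x)).continuousAt.eventually s3
    have t3' := (p2.contMDiffAt (sqMap ζ hζ x)).continuousAt.eventually s3'
    obtain ⟨k, k1, k2, k3⟩ := fiberProd.exists_mk_section (J := P2.model)
      (hf := base_cover L₁ L₂ ζ hζ) (g := base L₁ L₂ ζ) (a := fun p => σ (p1 p))
      (b := fun p => σ' (p2 p)) (x := sqMap ζ hζ x) x
      (ContMDiffAt.comp (I' := (L₁.prod L₂).model) _ s1 (p1.contMDiffAt _))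
      (ContMDiffAt.comp (I' := (L₁.prod L₂).model) _ s1' (p2.contMDiffAt _))
      (by
        filter_upwards [t3, t3'] with p h1 h2
        change L₁.π (fiberProd.fst _ _ L₁.cover (ζ (σ (p1 p)))) =
          L₁.π (fiberProd.fst _ _ L₁.cover (ζ (σ' (p2 p))))
        rw [h1, h2]
        exact fiberProd.condition p) s2 s2'
    refine ⟨k, k1, k2, ?_⟩
    filter_upwards [t3, t3', k3] with p h1 h2 h3
    exact fiberProd.ext ((congrArg ζ h3.1).trans h1) ((congrArg ζ h3.2).trans h2)

variable (D : IsoData L₁ L₂ ζ hζ)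

/-- The descent datum of the bundle `K` of an isomorphism of gerbes. -/
noncomputable def descentDatum : DescentDatum ζ hζ where
  K := D.K
  glue := D.desc
  cocycle h h' k := D.d_trans h h' k

/-- The bundle on `Y₁ ×_M Y₂` descended from `K`. -/
noncomputable abbrev Q : GBundle (L₁.prod L₂) := D.descentDatum.descend

/-- The canonical isomorphism `ζ^* Q → K`. -/
noncomputable abbrev θ : Iso (D.Q.pull ζ) D.K := D.descentDatum.descendIso

theorem θ_tr {z z' : Z} (e : ζ z = ζ z') (k : D.Q.fiber (ζ z)) :
    D.θ.toFun z' (D.Q.tr e k) = D.d e (D.θ.toFun z k) :=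
  D.descentDatum.descendIso_tr e k

/-- The source `L₁ ⊗ p₂^* Q` over `P ×_M P` of the descended `α`. -/
noncomputable abbrev αSource :
    GBundle (sq (base L₁ L₂ (GMap.id (L₁.prod L₂))) (base_cover L₁ L₂ _ (IsGCover.id _))) :=
  (L₁.L.pull (fstSq L₁ L₂ (GMap.id (L₁.prod L₂)) (IsGCover.id _))).tensor
    (D.Q.pull (fiberProd.snd _ _ _))

/-- The target `p₁^* Q ⊗ L₂` over `P ×_M P` of the descended `α`. -/
noncomputable abbrev αTarget :
    GBundle (sq (base L₁ L₂ (GMap.id (L₁.prod L₂))) (base_cover L₁ L₂ _ (IsGCover.id _))) :=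
  (D.Q.pull (fiberProd.fst _ _ _)).tensor
    (L₂.L.pull (sndSq L₁ L₂ (GMap.id (L₁.prod L₂)) (IsGCover.id _)))

/-- The isomorphism `α`, transported along `θ`, over the cover `Z ×_M Z` of `P ×_M P`. -/
noncomputable def αPull :
    Iso (D.αSource.pull (sqMap ζ hζ)) (D.αTarget.pull (sqMap ζ hζ)) :=
  (((Iso.id (L₁.L.pull (fstSq L₁ L₂ ζ hζ))).tensorMap
      (D.θ.pull (fiberProd.snd _ _ (base_cover L₁ L₂ ζ hζ)))).comp D.α).comp
    ((D.θ.pull (fiberProd.fst _ _ (base_cover L₁ L₂ ζ hζ))).tensorMap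
      (Iso.id (L₂.L.pull (sndSq L₁ L₂ ζ hζ)))).symm

section
variable {z z' : Z} (h : base L₁ L₂ ζ z = base L₁ L₂ ζ z')
    (l : L₁.fib (a := fst L₁ L₂ ζ z) (b := fst L₁ L₂ ζ z') h)
    (k' : D.Q.fiber (ζ z')) (k : D.Q.fiber (ζ z))
    (m : L₂.fib (a := snd L₁ L₂ ζ z) (b := snd L₁ L₂ ζ z') (snd_eq L₁ L₂ ζ h))

/-- On elements, `αPull` is `α` read through `θ`. -/
theorem αPull_iff :
    D.αPull.toFun (fiberProd.mk (base_cover L₁ L₂ ζ hζ) z z' h)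
        (tmul (T := L₁.fib _) (S := D.Q.fiber (ζ z')) l k') =
      tmul (T := D.Q.fiber (ζ z)) (S := L₂.fib _) k m ↔
    AlphaRel D.α h l (D.θ.toFun z' k') (D.θ.toFun z k) m := by
  let χ := (D.θ.pull (fiberProd.fst _ _ (base_cover L₁ L₂ ζ hζ))).tensorMap
      (Iso.id (L₂.L.pull (sndSq L₁ L₂ ζ hζ)))
  let q := fiberProd.mk (base_cover L₁ L₂ ζ hζ) z z' h
  have h1 : χ.toFun q (D.αPull.toFun q (tmul (T := L₁.fib _) (S := D.Q.fiber (ζ z')) l k')) =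
      D.α.toFun q (tmul (T := L₁.fib h) (S := D.K.fiber z') l (D.θ.toFun z' k')) :=
    χ.apply_symm q _
  constructor
  · intro h2
    exact h1.symm.trans (congrArg (χ.toFun q) h2)
  · intro h2
    exact χ.injective q (h1.trans h2)

end

/-- `αPull` agrees on the fibers of `Z ×_M Z → P ×_M P`, because `α` is compatible with the descent
isomorphism of `K`. -/
theorem αPull_tr (q q' : sq (base L₁ L₂ ζ) (base_cover L₁ L₂ ζ hζ))
    (e : sqMap ζ hζ q = sqMap ζ hζ q')
    (p : D.αSource.fiber (sqMap ζ hζ q)) :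
    D.αPull.toFun q' (D.αSource.tr e p) = D.αTarget.tr e (D.αPull.toFun q p) := by
  obtain ⟨⟨a, a'⟩, h⟩ := q
  obtain ⟨⟨b, b'⟩, h'⟩ := q'
  have e1 : ζ a = ζ b := congrArg (fiberProd.fst _ _ _) e
  have e2 : ζ a' = ζ b' := congrArg (fiberProd.snd _ _ _) e
  obtain ⟨l, k', rfl⟩ := tmul_surj (T := L₁.fib (a := fst L₁ L₂ ζ a) (b := fst L₁ L₂ ζ a') h)
    (S := D.Q.fiber (ζ a')) p
  obtain ⟨k, m, hkm⟩ := tmul_surj (T := D.Q.fiber (ζ a))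
    (S := L₂.fib (a := snd L₁ L₂ ζ a) (b := snd L₁ L₂ ζ a') (snd_eq L₁ L₂ ζ h))
    (D.αPull.toFun (fiberProd.mk (base_cover L₁ L₂ ζ hζ) a a' h)
      (tmul (T := L₁.fib _) (S := D.Q.fiber (ζ a')) l k'))
  have h1 := D.d_compat e1 e2 (h' := h') ((D.αPull_iff h l k' k m).1 hkm.symm)
  rw [← D.θ_tr, ← D.θ_tr] at h1
  have h2 := (D.αPull_iff h' _ _ _ _).2 h1
  refine (congrArg (D.αPull.toFun (fiberProd.mk (base_cover L₁ L₂ ζ hζ) b b' h')) ?_).trans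
    (h2.trans ((congrArg (D.αTarget.tr e) hkm.symm).trans ?_).symm)
  · refine (GBundle.tensor_tr (L₁.L.pull (fstSq L₁ L₂ (GMap.id (L₁.prod L₂)) (IsGCover.id _)))
      (D.Q.pull (fiberProd.snd _ _ _)) e l k').trans ?_
    exact congrArg₂ (tmul (T := L₁.fib _) (S := D.Q.fiber (ζ b'))) 
      (GBundle.pull_tr L₁.L (fstSq L₁ L₂ (GMap.id (L₁.prod L₂)) (IsGCover.id _)) e l)
      (GBundle.pull_tr D.Q (fiberProd.snd _ _ _) e k')
  · refine (GBundle.tensor_tr (D.Q.pull (fiberProd.fst _ _ _))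
      (L₂.L.pull (sndSq L₁ L₂ (GMap.id (L₁.prod L₂)) (IsGCover.id _))) e k m).trans ?_
    exact congrArg₂ (tmul (T := D.Q.fiber (ζ b)) (S := L₂.fib _)) (GBundle.pull_tr D.Q (fiberProd.fst _ _ _) e k)
      (GBundle.pull_tr L₂.L (sndSq L₁ L₂ (GMap.id (L₁.prod L₂)) (IsGCover.id _)) e m)

/-- The isomorphism `α` descends to `P ×_M P`. -/
noncomputable def descendα : Iso D.αSource D.αTarget :=
  Iso.descend (sqMap_cover ζ hζ) D.αPull D.αPull_tr

theorem descendα_rel_iff {z z' : Z} (h : base L₁ L₂ ζ z = base L₁ L₂ ζ z')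
    (l : L₁.fib (a := fst L₁ L₂ ζ z) (b := fst L₁ L₂ ζ z') h)
    (k' : D.Q.fiber (ζ z')) (k : D.Q.fiber (ζ z))
    (m : L₂.fib (a := snd L₁ L₂ ζ z) (b := snd L₁ L₂ ζ z') (snd_eq L₁ L₂ ζ h)) :
    AlphaRel D.descendα (z := ζ z) (z' := ζ z') h l k' k m ↔
      AlphaRel D.α h l (D.θ.toFun z' k') (D.θ.toFun z k) m := by
  rw [← D.αPull_iff]
  exact Eq.congr_left (Iso.descend_apply (sqMap_cover ζ hζ) D.αPull D.αPull_tr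
    (fiberProd.mk (base_cover L₁ L₂ ζ hζ) z z' h) _)

/-- The fiber product isomorphism descended from an isomorphism of gerbes. -/
noncomputable def descend : IsoData L₁ L₂ (GMap.id (L₁.prod L₂)) (IsGCover.id _) where
  K := D.Q
  α := D.descendα
  compat {p₁ p₂ p₃} h h' l l' k₃ k₂ k₁ m m' hr hr' := by
    obtain ⟨z₁, rfl⟩ := hζ.surjective p₁
    obtain ⟨z₂, rfl⟩ := hζ.surjective p₂
    obtain ⟨z₃, rfl⟩ := hζ.surjective p₃
    exact (D.descendα_rel_iff _ _ _ _ _).2 (D.compat _ _ _ _ _ _ _ _ _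
      ((D.descendα_rel_iff _ _ _ _ _).1 hr) ((D.descendα_rel_iff _ _ _ _ _).1 hr'))

end IsoData

/-! ### Inverses and descent of 2-morphisms -/

variable {M : GManifold.{v, u} G}

/-- A tensor can be written with any prescribed first factor. -/
theorem IsoData.rel_exists_right {L₁ L₂ : Gerbe M} {Z : GManifold.{v, u} G}
    {ζ : GMap Z (L₁.prod L₂)} {hζ : IsGCover ζ} (D : IsoData L₁ L₂ ζ hζ) {z z' : Z}
    (h : L₁.base L₂ ζ z = L₁.base L₂ ζ z')
    (l : L₁.fib (a := L₁.fst L₂ ζ z) (b := L₁.fst L₂ ζ z') h) (k' : D.K.fiber z')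
    (k : D.K.fiber z) : ∃ m, AlphaRel D.α h l k' k m := by
  obtain ⟨k₁, m₁, h₁⟩ := D.rel_exists h l k'
  refine ⟨ratio k₁ k • m₁, h₁.trans ?_⟩
  have e := smul_tmul_comm (S := L₂.fib (Gerbe.snd_eq L₁ L₂ ζ h)) (ratio k₁ k) k m₁
  rwa [ratio_smul] at e

theorem IsoData.rel_congr_fiber {L₁ L₂ : Gerbe M} {Z : GManifold.{v, u} G}
    {ζ : GMap Z (L₁.prod L₂)} {hζ : IsGCover ζ} (D : IsoData L₁ L₂ ζ hζ) {z z' : Z}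
    {h : L₁.base L₂ ζ z = L₁.base L₂ ζ z'}
    {l : L₁.fib (a := L₁.fst L₂ ζ z) (b := L₁.fst L₂ ζ z') h}
    {m : L₂.fib (a := L₁.snd L₂ ζ z) (b := L₁.snd L₂ ζ z') (Gerbe.snd_eq L₁ L₂ ζ h)}
    {k' k₂' : D.K.fiber z'} {k k₂ : D.K.fiber z} (hk' : k' = k₂') (hk : k = k₂)
    (hr : AlphaRel D.α h l k' k m) : AlphaRel D.α h l k₂' k₂ m := by
  subst hk' hk; exact hr

section Inverse
variable {L₁ L₂ : Gerbe M} {K₁ K₂ : GerbeHom L₁ L₂}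

namespace TwoMorRep

/-- The exchange of the factors of `Z₁ ×_P Z₂`. -/
noncomputable def exchange (K₁ K₂ : GerbeHom L₁ L₂) : GMap (K₁.prod K₂) (K₂.prod K₁) :=
  fiberProd.lift K₂.cover (K₁.pr₂ K₂) (K₁.pr₁ K₂) fun x => (fiberProd.condition x).symm

theorem exchange_cover (K₁ K₂ : GerbeHom L₁ L₂) : IsGCover (exchange K₁ K₂) :=
  IsGCover.of_sections (fun x => ⟨exchange K₂ K₁ x, rfl⟩) fun _ =>
    ⟨exchange K₂ K₁, (exchange K₂ K₁).contMDiffAt _, rfl, Filter.Eventually.of_forall fun _ => rfl⟩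

/-- The inverse of a representative of a `2`-morphism, over the same space `W`. -/
noncomputable def symm (J : TwoMorRep K₁ K₂) : TwoMorRep K₂ K₁ where
  W := J.W
  map := J.map.comp (exchange K₁ K₂)
  cover := J.cover.comp (exchange_cover K₁ K₂)
  β := J.β.symm
  compat w w' h h₂ e e' l k' k m hr := by
    obtain ⟨m₁, h₁⟩ := K₁.data.rel_exists_right h₂ (L₁.cast
      (congrArg (fiberProd.fst _ _ L₁.cover) e) (congrArg (fiberProd.fst _ _ L₁.cover) e') h h₂ l)
      (J.β.symm.toFun w' k') (J.β.symm.toFun w k)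
    -- the goal holds with `m₁` in place of `m`; apply `J` to identify the two
    have h₃ := K₂.data.rel_congr_fiber (J.β.apply_symm w' k') (J.β.apply_symm w k)
      (J.compat w w' h₂ h e.symm e'.symm _ _ _ _ h₁)
    have h₄ := K₂.data.rel_congr ((L₁.cast_cast _ _ _ _ _ _ _ _).trans (L₁.cast_rfl _ _)) rfl h₃
    have h₅ := tmul_left_cancel (T := K₂.data.K.fiber (J.z₂ w))
      (S := L₂.fib (Gerbe.snd_eq L₁ L₂ K₂.ζ h)) (hr.symm.trans h₄)
    subst h₅
    exact K₁.data.rel_congr rfl ((L₂.cast_cast _ _ _ _ _ _ _ _).trans (L₂.cast_rfl _ _)).symm h₁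

theorem symm_at (J : TwoMorRep K₁ K₂) {a : K₁.Z} {b : K₂.Z} (h : K₁.ζ a = K₂.ζ b)
    (k : K₁.data.K.fiber a) : J.symm.at' h.symm (J.at' h k) = k := by
  obtain ⟨w, rfl, rfl⟩ := J.exists_w h
  rw [J.at_eq w]
  exact (J.symm.at_eq w h.symm _).trans (J.β.symm_apply w k)

theorem at_symm (J : TwoMorRep K₁ K₂) {a : K₁.Z} {b : K₂.Z} (h : K₁.ζ a = K₂.ζ b)
    (k : K₂.data.K.fiber b) : J.at' h (J.symm.at' h.symm k) = k := by
  obtain ⟨w, rfl, rfl⟩ := J.exists_w h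
  refine (congrArg (J.at' h) (J.symm.at_eq w h.symm k)).trans ?_
  exact (J.at_eq w h _).trans (J.β.apply_symm w k)

theorem comp_symm (J : TwoMorRep K₁ K₂) : J.comp J.symm ≈ id K₁ := by
  refine equiv_iff.2 fun a c e k => ?_
  obtain ⟨b, hb⟩ := exists_mid K₁ K₂ a
  rw [comp_at J J.symm hb (hb.symm.trans e), id_at]
  have h := J.symm.at_d hb.symm (hb.symm.trans e) rfl e (J.at' hb k)
  rwa [IsoData.d_self, J.symm_at] at h

theorem symm_comp (J : TwoMorRep K₁ K₂) : J.symm.comp J ≈ id K₂ := by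
  refine equiv_iff.2 fun a c e k => ?_
  obtain ⟨b, hb⟩ := exists_mid K₂ K₁ a
  rw [comp_at J.symm J hb (hb.symm.trans e), id_at]
  have h := J.at_d hb.symm (hb.symm.trans e) rfl e (J.symm.at' hb k)
  rwa [IsoData.d_self, J.at_symm hb.symm] at h

end TwoMorRep
end Inverse

namespace GerbeHom
variable {L₁ L₂ : Gerbe M} (K : GerbeHom L₁ L₂)

/-- The fiber product isomorphism descended from a `1`-morphism. -/
noncomputable def descend : FPHom L₁ L₂ := ⟨K.data.descend⟩

/-- The map `Z → P ×_P Z`. -/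
noncomputable def graph : GMap K.Z (K.descend.toHom.prod K) :=
  fiberProd.lift _ K.ζ (GMap.id _) fun _ => rfl

theorem graph_cover : IsGCover K.graph := by
  have key : ∀ x, K.graph (K.descend.toHom.pr₂ K x) = x := fun x =>
    fiberProd.ext (fiberProd.condition x).symm rfl
  exact IsGCover.of_sections (fun x => ⟨_, key x⟩) fun p => ⟨K.descend.toHom.pr₂ K,
    (K.descend.toHom.pr₂ K).contMDiffAt _, rfl, Filter.Eventually.of_forall key⟩

/-- The `2`-morphism from the descended fiber product isomorphism to the given `1`-morphism. -/
noncomputable def descendRep : TwoMorRep K.descend.toHom K where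
  W := K.Z
  map := K.graph
  cover := K.graph_cover
  β := K.data.θ
  compat _ _ h _ _ _ l k' k m hr := (K.data.descendα_rel_iff h l k' k m).1 hr

end GerbeHom

namespace TwoMorRep
variable {L₁ L₂ : Gerbe M} {K₁ K₂ : FPHom L₁ L₂} (J : TwoMorRep K₁.toHom K₂.toHom)

theorem z₁_eq_z₂ (w : J.W) : J.z₂ w = J.z₁ w := (J.ζ_eq w).symm

theorem z₁_cover : IsGCover J.z₁ :=
  J.cover.comp (fiberProd.isGCover_fst _ _ _ K₂.toHom.cover)

/-- The isomorphism `β` over `W`, as an isomorphism of pullbacks along the same map `W → P`. -/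
noncomputable def fpPull : Iso (K₁.data.K.pull J.z₁) (K₂.data.K.pull J.z₁) :=
  J.β.comp (Iso.cong K₂.data.K J.z₂ J.z₁ J.z₁_eq_z₂)

theorem fpPull_apply (w : J.W) (k : K₁.data.K.fiber (J.z₁ w)) :
    J.fpPull.toFun w k = J.at' (a := J.z₁ w) (b := J.z₁ w) rfl k := by
  have key : ∀ (b : L₁.prod L₂) (hb : J.z₂ w = b) (h : K₁.toHom.ζ (J.z₁ w) = K₂.toHom.ζ b),
      K₂.data.K.tr hb (J.β.toFun w k) = J.at' h k := by
    intro b hb h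
    subst hb
    exact (J.at_eq w h k).symm
  exact key _ _ _

/-- `fpPull` agrees on the fibers of `W → P`, since its values are those of `at'`. -/
theorem fpPull_tr (w w' : J.W) (e : J.z₁ w = J.z₁ w') (k : K₁.data.K.fiber (J.z₁ w)) :
    J.fpPull.toFun w' (K₁.data.K.tr e k) = K₂.data.K.tr e (J.fpPull.toFun w k) := by
  rw [J.fpPull_apply, J.fpPull_apply]
  have key : ∀ (p : L₁.prod L₂) (e : J.z₁ w = p), J.at' (a := p) (b := p) rfl (K₁.data.K.tr e k) =
      K₂.data.K.tr e (J.at' (a := J.z₁ w) (b := J.z₁ w) rfl k) := by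
    intro p e; subst e; rfl
  exact key _ e

/-- A `2`-morphism between fiber product isomorphisms descends to `P`. -/
noncomputable def toFP : FPTwoMor K₁ K₂ where
  β := Iso.descend J.z₁_cover J.fpPull J.fpPull_tr
  compat p p' h l k' k m hr := by
    obtain ⟨w, rfl⟩ := J.z₁_cover.surjective p
    obtain ⟨w', rfl⟩ := J.z₁_cover.surjective p'
    have e := J.z₁_eq_z₂ w
    have e' := J.z₁_eq_z₂ w'
    have h₁ := J.compat w w' h
      ((congrArg (L₁.base L₂ _) e).trans (h.trans (congrArg (L₁.base L₂ _) e').symm))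
      (J.ζ_eq w) (J.ζ_eq w') _ _ _ _ hr
    have h₂ := K₂.data.rel_congr ((L₁.cast_cast _ _ _ _ _ _ _ _).trans (L₁.cast_rfl _ _))
      ((L₂.cast_cast _ _ _ _ _ _ _ _).trans (L₂.cast_rfl _ _)) (K₂.data.rel_tr e e' h h₁)
    exact K₂.data.rel_congr_fiber
      (Iso.descend_apply J.z₁_cover J.fpPull J.fpPull_tr w' k').symm
      (Iso.descend_apply J.z₁_cover J.fpPull J.fpPull_tr w k).symm h₂

theorem toFP_apply (p : L₁.prod L₂) (k : K₁.data.K.fiber p) :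
    J.toFP.β.toFun p k = J.at' (a := p) (b := p) rfl k := by
  obtain ⟨w, rfl⟩ := J.z₁_cover.surjective p
  exact (Iso.descend_apply J.z₁_cover J.fpPull J.fpPull_tr w k).trans (J.fpPull_apply w k)

theorem toFP_toRep : FPTwoMor.toRep J.toFP ≈ J := by
  refine equiv_iff.2 fun a b h k => ?_
  obtain rfl : a = b := h
  exact (FPTwoMor.toRep_at _ _ _).trans (J.toFP_apply a k)

end TwoMorRep

theorem FPTwoMor.ext_of_equiv {L₁ L₂ : Gerbe M} {K₁ K₂ : FPHom L₁ L₂} {β β' : FPTwoMor K₁ K₂}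
    (h : FPTwoMor.toRep β ≈ FPTwoMor.toRep β') : β = β' := by
  refine FPTwoMor.ext (Iso.ext fun p k => ?_)
  rw [← FPTwoMor.toRep_at, ← FPTwoMor.toRep_at]
  exact TwoMorRep.equiv_iff.1 h p p rfl k

/-! ### Equivariant forms, connection data and the equivalences -/

section Forms
variable {X Y Z : GManifold.{v, u} G}

theorem Connection.pull_id {P : GBundle X} (A : Connection P) : A.pull (GMap.id X) = A := by
  refine Connection.ext fun i x => ?_
  have h : mfderiv X.model X.model (fun x : X => x) x = ContinuousLinearMap.id ℝ _ := mfderiv_id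
  exact (congrArg ((A.form i x).comp) h).trans (ContinuousLinearMap.comp_id _)

theorem Form2.pull_pull (B : Form2 Z) (f : GMap X Y) (g : GMap Y Z) :
    (B.pull g).pull f = B.pull (f.comp g) := by
  refine Form2.ext (funext fun x => ?_) rfl
  have h : mfderiv X.model Z.model (f.comp g) x =
      (mfderiv Y.model Z.model g (f x)).comp (mfderiv X.model Y.model f x) :=
    mfderiv_comp x (g.mdiff _) (f.mdiff x)
  change _ = pullBilin _ (mfderiv X.model Z.model (f.comp g) x)
  rw [h]
  rfl

theorem Form2.pull_sub (B C : Form2 Y) (f : GMap X Y) : (B - C).pull f = B.pull f - C.pull f := rfl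

/-- Pulling a form back to the cover and then along a local section recovers it. -/
theorem Form2.pullBilin_pull_lsec {f : GMap Y X} (hf : IsGCover f) (C : Form2 X) (x : X) :
    pullBilin ((C.pull f).form (hf.pt x)) (mfderiv X.model Y.model (hf.lsec x) x) = C.form x := by
  have h1 := mfderiv_comp_section (f := f) (hf.contMDiffAt_lsec (hf.mem_nbhd x))
    (by filter_upwards [hf.eventually_nbhd (hf.mem_nbhd x)] with t ht; exact hf.apply_lsec ht)
  have h2 : ∀ (x' : X) (_ : x' = x),
      pullBilin (C.form x') (ContinuousLinearMap.id ℝ (EuclideanSpace ℝ (Fin X.dim))) =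
        pullBilin (C.form x) (ContinuousLinearMap.id ℝ (EuclideanSpace ℝ (Fin X.dim))) := by
    rintro _ rfl; rfl
  exact (congrArg (pullBilin (C.form (f (hf.pt x)))) h1).trans (h2 _ (hf.apply_pt x))

/-- If the curvature of a connection upstairs is the pullback of `C`, then `C` is the curvature of the
descended connection. -/
theorem DescentDatum.curv_descendConn {f : GMap Y X} {hf : IsGCover f} (D : DescentDatum f hf)
    {A : Connection D.K}
    (hA : D.glue.Preserves (A.pull (fiberProd.fst f f hf)) (A.pull (fiberProd.snd f f hf)))
    {C : Form2 X} (h : A.curv = C.pull f) : (D.descendConn hA).curv = C := by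
  refine Form2.ext (funext fun x => ?_) (funext fun x => ?_)
  · rw [D.curv_descendConn_form hA, h, Form2.pullBilin_pull_lsec]
  · rw [D.curv_descendConn_moment hA, h]
    exact congrArg C.moment (hf.apply_pt x)

end Forms

section Descent
open Gerbe (fst snd base base_cover fstSq sndSq snd_eq)
variable {L₁ L₂ : GerbeConn M} {Z : GManifold.{v, u} G}
  {ζ : GMap Z (L₁.toGerbe.prod L₂.toGerbe)} {hζ : IsGCover ζ}
  {D : IsoData L₁.toGerbe L₂.toGerbe ζ hζ} (C : ConnData L₁ L₂ D)

namespace ConnData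

theorem glue_preserves : D.descentDatum.glue.Preserves
    (C.conn.pull (fiberProd.fst ζ ζ hζ)) (C.conn.pull (fiberProd.snd ζ ζ hζ)) :=
  D.desc_preserves L₁.conn L₂.conn C.conn L₁.preserves L₂.preserves C.preserves

/-- The connection on the descended bundle. -/
noncomputable def descendConn : Connection D.Q := D.descentDatum.descendConn C.glue_preserves

theorem θ_preserves : D.θ.Preserves (C.descendConn.pull ζ) C.conn :=
  D.descentDatum.descendIso_preserves C.glue_preserves

theorem αPull_preserves : D.αPull.Preserves
    (((L₁.conn.pull (fstSq L₁.toGerbe L₂.toGerbe (GMap.id _) (IsGCover.id _))).tensor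
      (C.descendConn.pull (fiberProd.snd _ _ _))).pull (IsoData.sqMap ζ hζ))
    (((C.descendConn.pull (fiberProd.fst _ _ _)).tensor
      (L₂.conn.pull (sndSq L₁.toGerbe L₂.toGerbe (GMap.id _) (IsGCover.id _)))).pull
        (IsoData.sqMap ζ hζ)) := by
  rw [Connection.pull_tensor, Connection.pull_tensor, Connection.pull_pull, Connection.pull_pull,
    Connection.pull_pull, Connection.pull_pull]
  have h1 := C.θ_preserves.pull
    (fiberProd.snd (base L₁.toGerbe L₂.toGerbe ζ) (base L₁.toGerbe L₂.toGerbe ζ)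
      (base_cover L₁.toGerbe L₂.toGerbe ζ hζ))
  have h2 := C.θ_preserves.pull
    (fiberProd.fst (base L₁.toGerbe L₂.toGerbe ζ) (base L₁.toGerbe L₂.toGerbe ζ)
      (base_cover L₁.toGerbe L₂.toGerbe ζ hζ))
  rw [Connection.pull_pull] at h1 h2
  exact (((Iso.id_preserves _).tensorMap h1).comp C.preserves).comp
    (h2.tensorMap (Iso.id_preserves _)).symm

/-- The connection data on the descended fiber product isomorphism. -/
noncomputable def descend : ConnData L₁ L₂ D.descend where
  conn := C.descendConn
  curv_eq := by
    refine D.descentDatum.curv_descendConn C.glue_preserves ?_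
    rw [Form2.pull_sub, Form2.pull_pull, Form2.pull_pull]
    exact C.curv_eq
  preserves := Iso.descend_preserves (IsoData.sqMap_cover ζ hζ) D.αPull D.αPull_tr
    C.αPull_preserves

end ConnData
end Descent

section Categories
open CategoryTheory

section WithoutConnection
variable (L₁ L₂ : Gerbe M)

instance : (fpInclusion L₁ L₂).Faithful where
  map_injective h := FPTwoMor.ext_of_equiv (Quotient.exact h)

instance : (fpInclusion L₁ L₂).Full where
  map_surjective J := by
    induction J using Quotient.inductionOn with
    | h J => exact ⟨J.toFP, Quotient.sound J.toFP_toRep⟩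

instance : (fpInclusion L₁ L₂).EssSurj where
  mem_essImage K := ⟨K.descend, ⟨{
    hom := Quotient.mk _ K.descendRep
    inv := Quotient.mk _ K.descendRep.symm
    hom_inv_id := Quotient.sound K.descendRep.comp_symm
    inv_hom_id := Quotient.sound K.descendRep.symm_comp }⟩⟩

end WithoutConnection

variable {L₁ L₂ : GerbeConn M}

namespace TwoMorRepConn

/-- The inverse of a `2`-morphism with connection. -/
noncomputable def symm {K₁ K₂ : GerbeConnHom L₁ L₂} (J : TwoMorRepConn K₁ K₂) :
    TwoMorRepConn K₂ K₁ :=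
  ⟨J.1.symm, J.2.symm⟩

end TwoMorRepConn

namespace GerbeConnHom

/-- The fiber product isomorphism with connection descended from a `1`-morphism. -/
noncomputable def descend (K : GerbeConnHom L₁ L₂) : FPConnHom L₁ L₂ :=
  ⟨K.hom.descend, K.conn.descend⟩

/-- The `2`-morphism from the descended fiber product isomorphism to the given `1`-morphism. -/
noncomputable def descendRep (K : GerbeConnHom L₁ L₂) :
    TwoMorRepConn ((fpInclusionConn L₁ L₂).obj K.descend) K :=
  ⟨K.hom.descendRep, by
    have h := K.conn.θ_preserves
    rw [← Connection.pull_id K.conn.conn] at h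
    exact h⟩

end GerbeConnHom

variable (L₁ L₂)

instance : (fpInclusionConn L₁ L₂).Faithful where
  map_injective {K₁ K₂} _ _ h := Subtype.ext (FPTwoMor.ext_of_equiv
    (Quotient.exact (s := TwoMorRepConn.setoid ⟨K₁.hom.toHom, K₁.conn⟩ ⟨K₂.hom.toHom, K₂.conn⟩) h))

instance : (fpInclusionConn L₁ L₂).Full where
  map_surjective {K₁ K₂} J := by
    induction J using Quotient.inductionOn with
    | h J =>
      refine ⟨⟨J.1.toFP, ?_⟩, Quotient.sound J.1.toFP_toRep⟩
      exact Iso.descend_preserves J.1.z₁_cover J.1.fpPull J.1.fpPull_tr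
        (J.2.comp (Iso.cong_preserves K₂.conn.conn _ _ J.1.z₁_eq_z₂))

instance : (fpInclusionConn L₁ L₂).EssSurj where
  mem_essImage K := ⟨K.descend, ⟨{
    hom := Quotient.mk _ K.descendRep
    inv := Quotient.mk _ K.descendRep.symm
    hom_inv_id := Quotient.sound K.descendRep.1.comp_symm
    inv_hom_id := Quotient.sound K.descendRep.1.symm_comp }⟩⟩

end Categories
end EqGerbe

theorem proposition3 {G : EqGerbe.CompactLieGroup.{v}} (M : EqGerbe.GManifold.{v, u} G) :
    (∀ L₁ L₂ : EqGerbe.Gerbe M, (EqGerbe.fpInclusion L₁ L₂).IsEquivalence) ∧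
    (∀ L₁ L₂ : EqGerbe.GerbeConn M, (EqGerbe.fpInclusionConn L₁ L₂).IsEquivalence) :=
  ⟨fun _ _ => {}, fun _ _ => {}⟩
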